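/- **Conventions.** A (generalised) simplicial or square complex may have non-embedded cells, and different cells may have the same boundary; onto each face of each cell there is precisely one attaching map. The *link* of a vertex $v$ of a simplicial complex has one simplex for each simplex $\tau$ of positive dimension and each corner of $\tau$ attached to $v$, namely the face of $\tau$ opposite to that corner. The *link* of a vertex $v$ of a square complex is the graph whose vertices are the ends of edges at $v$ and whose edges are the corners of squares at $v$. A simplicial complex is *simple* if no edge joins a vertex to itself and no two distinct simplices of positive dimension have the same boundary. It is *flag* if it is simple and every finite set of pairwise adjacent vertices spans a simplex. It is *locally $6$-large* if each vertex link is flag and contains no embedded cycle of length $4$ or $5$ without diagonals (edges between nonconsecutive vertices). It is *systolic* if it is connected, simply connected and locally $6$-large. A square complex is *nonpositively curved* if no vertex link contains an embedded combinatorial cycle of length less than $4$, and *CAT(0)* if it is moreover connected and simply connected. A *VH complex* is a square complex whose edges are partitioned into vertical and horizontal ones, such that consecutive sides of each square belong to different classes. Let $X$ be a VH complex. Its *simplexification* $X^*$ is the following simplicial complex. Its vertices are $v^*$, $e^*$, $s^*$ for the vertices $v$, the vertical edges $e$ and the squares $s$ of $X$. Divide each vertical edge $e$ in two at $e^*$ and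 cone off the boundary of each square $s$ (then a hexagon) from $s^*$, dividing $s$ into six triangles. To this triangulation of $X$ attach, for each vertical edge $e$ and each of its two endpoints $v$, the simplex spanned by $v^*$, $e^*$ and all $s_j^*$, where $(s_j)$ are the squares adjacent to $e$, counted with multiplicity; the two simplices of $e$ share the face spanned by $e^*$ and the $s_j^*$. (If there are infinitely many $s_j$, attach all the simplices spanned by finite subsets.) An action of a group on a complex by combinatorial automorphisms is *geometric* if it is proper (all stabilisers of cells are finite) and cocompact (there are finitely many orbits of cells). A group is *systolic* if it acts geometrically on a systolic complex. **Corollary.** If $X$ is a CAT(0) VH complex, then its simplexification $X^*$ is systolic. If moreover a group $G$ acts geometrically on $X$ by combinatorial automorphisms that preserve the set of vertical edges and the set of horizontal edges, then $G$ is systolic. -/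

import Mathlib

open Set Topology

open scoped unitInterval

universe u

/-! ### Generalised simplicial complexes -/

/-- A generalised simplicial complex (simplices need not be embedded, and different simplices may
have the same vertices), presented through its *ordered* simplices: an element of `simplex n` is an
`n`-simplex together with a total ordering of its `n + 1` corners.  For an injection `θ`, `face θ x`
is the face of `x` with corners `θ 0, …, θ m`, in this order; for bijective `θ` it is the same
simplex with its corners reordered.  Hence the simplices themselves are the orbits of the
reorderings.  The law `face_free` says that a simplex is never attached to itself by a nontrivial
permutation of its corners; so onto each face of a simplex there is precisely one attaching map. -/
structure GenSimplicialComplex where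
  simplex : ℕ → Type u
  face : ∀ {m n : ℕ}, (Fin (m + 1) ↪ Fin (n + 1)) → simplex n → simplex m
  face_id : ∀ {n : ℕ} (x : simplex n), face (Function.Embedding.refl _) x = x
  face_comp : ∀ {l m n : ℕ} (η : Fin (l + 1) ↪ Fin (m + 1)) (θ : Fin (m + 1) ↪ Fin (n + 1))
    (x : simplex n), face η (face θ x) = face (η.trans θ) x
  face_free : ∀ {n : ℕ} (θ : Fin (n + 1) ↪ Fin (n + 1)) (x : simplex n),
    face θ x = x → θ = Function.Embedding.refl _

/-- The injection `Fin 1 ↪ Fin (n + 1)` with value `j`. -/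
def pointEmb {n : ℕ} (j : Fin (n + 1)) : Fin (0 + 1) ↪ Fin (n + 1) :=
  ⟨fun _ => j, fun _ _ _ => Subsingleton.elim (α := Fin 1) _ _⟩

/-- The extension of `θ` to an injection that fixes `0` and is `θ` on the successors. -/
def consEmb {m n : ℕ} (θ : Fin (m + 1) ↪ Fin (n + 1)) : Fin (m + 1 + 1) ↪ Fin (n + 1 + 1) :=
  ⟨Fin.cases 0 (fun j => (θ j).succ), by
    intro a b
    refine Fin.cases ?_ (fun a => ?_) a <;> refine Fin.cases ?_ (fun b => ?_) b
    · simp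
    · intro h
      exact absurd h.symm (Fin.succ_ne_zero _)
    · intro h
      exact absurd h (Fin.succ_ne_zero _)
    · intro h
      exact congrArg Fin.succ (θ.injective (Fin.succ_injective _ h))⟩

theorem pointEmb_apply {n : ℕ} (j : Fin (n + 1)) (a) : pointEmb j a = j := rfl

theorem consEmb_zero {m n : ℕ} (θ : Fin (m + 1) ↪ Fin (n + 1)) : consEmb θ 0 = 0 := rfl

theorem consEmb_succ {m n : ℕ} (θ : Fin (m + 1) ↪ Fin (n + 1)) (a : Fin (m + 1)) :
    consEmb θ a.succ = (θ a).succ := rfl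

namespace GenSimplicialComplex

variable (K : GenSimplicialComplex.{u})

/-- The `j`-th corner of an ordered simplex, as a vertex of the complex. -/
def vertex {n : ℕ} (x : K.simplex n) (j : Fin (n + 1)) : K.simplex 0 :=
  K.face (pointEmb j) x

/-- The link of a vertex `v`.  For each simplex of positive dimension and each of its corners
attached to `v` it has one simplex, the face opposite to that corner.  In terms of ordered
simplices: an `n`-simplex of the link is an `(n + 1)`-simplex of `K` whose corner `0` is at `v`. -/
def link (v : K.simplex 0) : GenSimplicialComplex.{u} where
  simplex n := {x : K.simplex (n + 1) // K.vertex x 0 = v}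
  face θ x := ⟨K.face (consEmb θ) x.1, by
    have h : (pointEmb 0).trans (consEmb θ) = pointEmb 0 := by
      ext; rfl
    rw [vertex, K.face_comp, h]
    exact x.2⟩
  face_id x := by
    apply Subtype.ext
    have h : ∀ n, consEmb (Function.Embedding.refl (Fin (n + 1))) = Function.Embedding.refl _ := by
      intro n; ext a; refine Fin.cases ?_ (fun a => ?_) a <;> rfl
    simp [h, K.face_id]
  face_comp η θ x := by
    apply Subtype.ext
    have h : (consEmb η).trans (consEmb θ) = consEmb (η.trans θ) := by
      ext a; refine Fin.cases ?_ (fun a => ?_) a <;> rfl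
    simp [K.face_comp, h]
  face_free θ x hx := by
    have h := K.face_free _ _ (congrArg Subtype.val hx)
    ext1 a
    exact Fin.succ_injective _ (DFunLike.congr_fun h a.succ)

/-- Two vertices are joined by an edge of the complex. -/
def Adj (p q : K.simplex 0) : Prop :=
  ∃ x : K.simplex 1, K.vertex x 0 = p ∧ K.vertex x 1 = q

/-- Two ordered simplices of the same dimension are orderings of the same simplex. -/
def SameSimplex {n : ℕ} (x y : K.simplex n) : Prop :=
  ∃ θ : Fin (n + 1) ↪ Fin (n + 1), K.face θ x = y

/-- Two simplices of the same dimension have the same proper faces. -/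
def SameBoundary {n : ℕ} (x y : K.simplex n) : Prop :=
  ∀ m, m < n → ∀ z : K.simplex m,
    (∃ θ : Fin (m + 1) ↪ Fin (n + 1), K.face θ x = z) ↔
      (∃ θ : Fin (m + 1) ↪ Fin (n + 1), K.face θ y = z)

/-- No edge joins a vertex to itself, and no two simplices of positive dimension have the same
boundary. -/
def IsSimple : Prop :=
  (∀ x : K.simplex 1, K.vertex x 0 ≠ K.vertex x 1) ∧
    ∀ n, 1 ≤ n → ∀ x y : K.simplex n, K.SameBoundary x y → K.SameSimplex x y

/-- The complex is simple and the vertices of each (finite) clique of the `1`-skeleton span a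
simplex. -/
def IsFlag : Prop :=
  K.IsSimple ∧ ∀ (n : ℕ) (p : Fin (n + 1) → K.simplex 0), Function.Injective p →
    (∀ i j, i ≠ j → K.Adj (p i) (p j)) → ∃ x : K.simplex n, ∀ i, K.vertex x i = p i

/-- There is a cycle of length `k` without diagonals: an embedded loop of `k` vertices, such that
no edge connects two of its nonconsecutive vertices. -/
def HasCycleWithoutDiagonals (k : ℕ) : Prop :=
  ∃ p : ZMod k → K.simplex 0, Function.Injective p ∧ (∀ i, K.Adj (p i) (p (i + 1))) ∧
    ∀ i j, i ≠ j → K.Adj (p i) (p j) → j = i + 1 ∨ i = j + 1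

/-- All vertex links are flag and contain no cycles of length `4` or `5` without diagonals. -/
def IsLocallySixLarge : Prop :=
  ∀ v : K.simplex 0, (K.link v).IsFlag ∧ ¬ (K.link v).HasCycleWithoutDiagonals 4 ∧
    ¬ (K.link v).HasCycleWithoutDiagonals 5

/-- The disjoint union of one affine simplex for each ordered simplex. -/
abbrev Cells : Type u := Σ p : (Σ n, K.simplex n), stdSimplex ℝ (Fin (p.1 + 1))

/-- The gluing of each affine simplex to each of its faces (and to its reorderings). -/
inductive Glue : K.Cells → K.Cells → Prop
  | face {m n : ℕ} (θ : Fin (m + 1) ↪ Fin (n + 1)) (x : K.simplex n)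
      (t : stdSimplex ℝ (Fin (m + 1))) :
      Glue ⟨⟨m, K.face θ x⟩, t⟩ ⟨⟨n, x⟩, stdSimplex.map θ t⟩

/-- The geometric realisation, with the quotient topology. -/
def Realization : Type u := Quot K.Glue

instance : TopologicalSpace K.Realization := inferInstanceAs (TopologicalSpace (Quot K.Glue))

/-- A systolic complex: connected, simply connected and locally `6`-large.  (`SimplyConnectedSpace`
contains that the space is nonempty and path connected.) -/
def IsSystolic : Prop := SimplyConnectedSpace K.Realization ∧ K.IsLocallySixLarge

/-- An action of a group by automorphisms of a generalised simplicial complex: compatible actions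
on the sets of ordered simplices. -/
structure Action (G : Type*) [Group G] where
  act : ∀ n, G →* Equiv.Perm (K.simplex n)
  act_face : ∀ (g : G) {m n : ℕ} (θ : Fin (m + 1) ↪ Fin (n + 1)) (x : K.simplex n),
    act m g (K.face θ x) = K.face θ (act n g x)

/-- The action is proper (the stabiliser of each simplex, as a set, is finite) and cocompact
(there are finitely many orbits of simplices). -/
def Action.IsGeometric {K : GenSimplicialComplex.{u}} {G : Type*} [Group G] (ρ : K.Action G) :
    Prop :=
  (∀ n (x : K.simplex n), {g : G | K.SameSimplex x (ρ.act n g x)}.Finite) ∧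
    ∃ F : Set (Σ n, K.simplex n), F.Finite ∧
      ∀ n (x : K.simplex n), ∃ (g : G) (y : K.simplex n), ⟨n, y⟩ ∈ F ∧ ρ.act n g y = x

end GenSimplicialComplex

/-- A systolic group: one that acts geometrically on a systolic complex. -/
def IsSystolicGroup (G : Type u) [Group G] : Prop :=
  ∃ K : GenSimplicialComplex.{u}, K.IsSystolic ∧ ∃ ρ : K.Action G, ρ.IsGeometric

/-! ### Square complexes -/

/-- A generalised square complex, given by its vertices, edges and squares, each edge being
identified with `[0,1]` and each square with `[0,1]²`.  The two coordinates of the square, and its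
two directions, are indexed by `Bool`; so are the two values `0` (`false`) and `1` (`true`).

* `ends e b` is the vertex to which the endpoint `b` of `e` is attached.
* `side s i t` is the edge attached to the side of `s` that is parallel to the `i`-th axis and on
  which the other coordinate is `t`; the attaching map is `x ↦ x` if `reversed s i t = false`, and
  `x ↦ 1 - x` if it is `true`.
* `corner_eq` says that both attaching maps at a corner `c` of `s` give the same vertex.

Cells need not be embedded. -/
structure SquareComplex where
  V : Type u
  E : Type u
  S : Type u
  ends : E → Bool → V
  side : S → Bool → Bool → E
  reversed : S → Bool → Bool → Bool
  corner_eq : ∀ (s : S) (c : Bool → Bool),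
    ends (side s false (c true)) (c false ^^ reversed s false (c true)) =
      ends (side s true (c false)) (c true ^^ reversed s true (c false))

namespace SquareComplex

variable (X : SquareComplex.{u})

/-- `(e, b)` is the oriented edge that starts at the endpoint `b` of `e`. -/
abbrev OrientedEdge : Type u := X.E × Bool

/-- The vertex at which an oriented edge starts. -/
def origin (d : X.OrientedEdge) : X.V := X.ends d.1 d.2

/-- The same edge with the opposite orientation. -/
def rev (d : X.OrientedEdge) : X.OrientedEdge := (d.1, !d.2)

/-- The corners of squares; `(s, c)` is the corner of `s` with coordinates `c`. -/
abbrev Corner : Type u := X.S × (Bool → Bool)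

/-- The side of the square that leaves the corner `q` in the direction `i`, as an oriented edge. -/
def cornerEdge (q : X.Corner) (i : Bool) : X.OrientedEdge :=
  (X.side q.1 i (q.2 (!i)), q.2 i ^^ X.reversed q.1 i (q.2 (!i)))

/-- The next corner of the same square in the direction `i`. -/
def nextCorner (q : X.Corner) (i : Bool) : X.Corner := (q.1, Function.update q.2 i (!q.2 i))

/-- The link of a vertex `v` is the graph whose vertices are the oriented edges that start at `v`
and whose edges are the corners of squares at `v`; the corner `q` connects the two sides of the
square that leave it.  `Joins q d d'`: the edge `q` of a link connects `d` and `d'`. -/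
def Joins (q : X.Corner) (d d' : X.OrientedEdge) : Prop :=
  (X.cornerEdge q false = d ∧ X.cornerEdge q true = d') ∨
    (X.cornerEdge q false = d' ∧ X.cornerEdge q true = d)

/-- The link of `v` contains an embedded combinatorial cycle of length `k`, that is, a cyclic
sequence of `k` distinct vertices and `k` distinct edges of the link (a loop if `k = 1`, a double
edge if `k = 2`). -/
def LinkHasCycle (v : X.V) (k : ℕ) : Prop :=
  ∃ (d : ZMod k → X.OrientedEdge) (q : ZMod k → X.Corner),
    (∀ i, X.origin (d i) = v) ∧ Function.Injective d ∧ Function.Injective q ∧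
      ∀ i, X.Joins (q i) (d i) (d (i + 1))

/-- No vertex link contains an embedded cycle of length less than `4`. -/
def IsNonpositivelyCurved : Prop :=
  ∀ (v : X.V) (k : ℕ), 1 ≤ k → k < 4 → ¬ X.LinkHasCycle v k

/-- The disjoint union of the cells: points, unit intervals and unit squares. -/
abbrev Cells : Type u := (Σ _ : X.V, Unit) ⊕ (Σ _ : X.E, I) ⊕ (Σ _ : X.S, (Bool → I))

/-- The point of an edge. -/
def edgePt (e : X.E) (x : I) : X.Cells := Sum.inr (Sum.inl ⟨e, x⟩)

/-- The point of a square. -/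
def squarePt (s : X.S) (x : Bool → I) : X.Cells := Sum.inr (Sum.inr ⟨s, x⟩)

/-- The endpoint `0` or `1` of the unit interval. -/
def endPt (b : Bool) : I := if b then 1 else 0

/-- The attaching maps of the endpoints of edges and of the sides of squares. -/
inductive Glue : X.Cells → X.Cells → Prop
  | ends (e : X.E) (b : Bool) :
      Glue (X.edgePt e (endPt b)) (Sum.inl ⟨X.ends e b, ()⟩)
  | side (s : X.S) (i t : Bool) (x : I) :
      Glue (X.squarePt s (fun j => if j = i then x else endPt t))
        (X.edgePt (X.side s i t) (if X.reversed s i t then unitInterval.symm x else x))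

/-- The geometric realisation, with the quotient topology. -/
def Realization : Type u := Quot X.Glue

instance : TopologicalSpace X.Realization := inferInstanceAs (TopologicalSpace (Quot X.Glue))

/-- A `CAT(0)` square complex: connected, simply connected and nonpositively curved. -/
def IsCAT0 : Prop := SimplyConnectedSpace X.Realization ∧ X.IsNonpositivelyCurved

/-- An action of a group on a square complex by combinatorial automorphisms, given by its effect on
vertices, oriented edges and corners of squares (so that the way in which a cell is mapped to a
cell is part of the data).  It is compatible with the reversal and the origins of edges, and maps
the two sides of a square at a corner, with the corners at their other ends, to the two sides at
the image corner, with the corners at their other ends. -/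
structure Action (G : Type*) [Group G] where
  onVertex : G →* Equiv.Perm X.V
  onEdge : G →* Equiv.Perm X.OrientedEdge
  onCorner : G →* Equiv.Perm X.Corner
  rev_eq : ∀ g d, onEdge g (X.rev d) = X.rev (onEdge g d)
  origin_eq : ∀ g d, X.origin (onEdge g d) = onVertex g (X.origin d)
  corner_eq : ∀ g q, ∃ π : Equiv.Perm Bool, ∀ i,
    onEdge g (X.cornerEdge q i) = X.cornerEdge (onCorner g q) (π i) ∧
      onCorner g (X.nextCorner q i) = X.nextCorner (onCorner g q) (π i)

namespace Action

variable {X : SquareComplex.{u}} {G : Type*} [Group G] (ρ : X.Action G)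

/-- The induced map on (unoriented) edges. -/
def edgeMap (g : G) (e : X.E) : X.E := (ρ.onEdge g (e, false)).1

/-- The induced map on squares. -/
def squareMap (g : G) (s : X.S) : X.S := (ρ.onCorner g (s, fun _ => false)).1

/-- The action is proper (all stabilisers of cells are finite) and cocompact (there are finitely
many orbits of cells). -/
def IsGeometric : Prop :=
  ((∀ v, {g : G | ρ.onVertex g v = v}.Finite) ∧ (∀ e, {g : G | ρ.edgeMap g e = e}.Finite) ∧
    ∀ s, {g : G | ρ.squareMap g s = s}.Finite) ∧
  (∃ F : Set X.V, F.Finite ∧ ∀ v, ∃ g, ∃ w ∈ F, ρ.onVertex g w = v) ∧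
  (∃ F : Set X.E, F.Finite ∧ ∀ e, ∃ g, ∃ f ∈ F, ρ.edgeMap g f = e) ∧
  ∃ F : Set X.S, F.Finite ∧ ∀ s, ∃ g, ∃ r ∈ F, ρ.squareMap g r = s

end Action

end SquareComplex

/-! ### `VH`-complexes and their simplexification -/

/-- A square complex with a partition of its edges into vertical ones (those in `vertical`) and
horizontal ones (the others), such that any two consecutive sides of a square belong to different
classes. -/
structure VHComplex extends SquareComplex.{u} where
  vertical : Set E
  alternates : ∀ (s : S) (i t t' : Bool), side s i t ∈ vertical ↔ side s (!i) t' ∉ vertical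

namespace VHComplex

variable (X : VHComplex.{u})

/-- The action preserves the sets of vertical and of horizontal edges. -/
def PreservesVH {X : VHComplex.{u}} {G : Type*} [Group G] (ρ : X.toSquareComplex.Action G) :
    Prop :=
  ∀ g e, ρ.edgeMap g e ∈ X.vertical ↔ e ∈ X.vertical

/-- The corners of the star of `e*` in the simplexification, for a vertical edge `e`: one for each
endpoint of `e`, one for `e*` and one for each square adjacent to `e`, counted with
multiplicity. -/
inductive StarCorner (e : X.E) : Type u
  | apex (b : Bool)
  | center
  | square (s : X.S) (i t : Bool) (h : X.side s i t = e)

/-- Distinct corners of the star of `e*` span a simplex if the two endpoints of `e` are not both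
among them: the star is the suspension of the simplex spanned by `e*` and the adjacent squares. -/
def Spans {X : VHComplex.{u}} {e : X.E} {n : ℕ} (f : Fin (n + 1) ↪ X.StarCorner e) : Prop :=
  ∀ j k, f j = .apex false → f k ≠ .apex true

/-- The ordered simplices of the simplexification.

* `vert v`, `edge e`, `square s` are the vertices `v*`, `e*` (for vertical `e`) and `s*`.
* `hor e b` is a horizontal edge, starting at its end `b`.
* `tri s i t f` is the triangle spanned by `s*` and a horizontal side of `s`, with an ordering `f`
  of its corners: `none` is `s*`, and `some a` is the corner of `s` with `i`-th coordinate `a` on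
  that side.
* `star e f` are the simplices of positive dimension in the star of `e*` for vertical `e`. They
  comprise the halves of `e`, the segments that join `s*` to `e*` and to the corners of `s`, the
  triangles of the subdivided squares that have `e*` as a vertex, and all faces of the attached
  simplices spanned by `e*`, one endpoint of `e` and the squares adjacent to `e`. -/
inductive OrderedSimplex : ℕ → Type u
  | vert (v : X.V) : OrderedSimplex 0
  | edge (e : X.E) (he : e ∈ X.vertical) : OrderedSimplex 0
  | square (s : X.S) : OrderedSimplex 0
  | hor (e : X.E) (he : e ∉ X.vertical) (b : Bool) : OrderedSimplex 1
  | tri (s : X.S) (i t : Bool) (h : X.side s i t ∉ X.vertical) (f : Fin 3 ↪ Option Bool) :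
      OrderedSimplex 2
  | star {n : ℕ} (e : X.E) (he : e ∈ X.vertical) (f : Fin (n + 2) ↪ X.StarCorner e)
      (hf : Spans f) : OrderedSimplex (n + 1)

variable {X}

/-- The vertex of the simplexification at a corner of the star of `e*`. -/
def starVertex {e : X.E} (he : e ∈ X.vertical) : X.StarCorner e → X.OrderedSimplex 0
  | .apex b => .vert (X.ends e b)
  | .center => .edge e he
  | .square s _ _ _ => .square s

/-- The ordered simplex spanned by some corners of the star of `e*`. -/
def ofStar {e : X.E} (he : e ∈ X.vertical) : ∀ {m : ℕ} (f : Fin (m + 1) ↪ X.StarCorner e),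
    Spans f → X.OrderedSimplex m
  | 0, f, _ => starVertex he (f 0)
  | _ + 1, f, hf => .star e he f hf

/-- The ordered simplex spanned by some ends of a horizontal edge. -/
def ofHor (e : X.E) (he : e ∉ X.vertical) : ∀ {m : ℕ}, (Fin (m + 1) ↪ Bool) → X.OrderedSimplex m
  | 0, f => .vert (X.ends e (f 0))
  | 1, f => .hor e he (f 0)
  | m + 2, f => absurd (Fintype.card_le_of_embedding f) (by simp)

/-- The ordered pair of two distinct elements. -/
def pairEmb {α : Type*} (x y : α) (h : x ≠ y) : Fin (1 + 1) ↪ α :=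
  ⟨fun j => if j = 0 then x else y, by
    intro a b
    fin_cases a <;> fin_cases b <;> simp [h, h.symm]⟩

theorem pairEmb_zero {α : Type*} (x y : α) (h : x ≠ y) : pairEmb x y h 0 = x := rfl

theorem pairEmb_one {α : Type*} (x y : α) (h : x ≠ y) : pairEmb x y h 1 = y := rfl

/-- The segment that joins `s*` to a corner of `s`, starting at `s*` if `b = true` and at the
corner if `b = false`.  The corner is the one with `i`-th coordinate `a` on the horizontal side
`side s i t`; so it lies on the vertical side `side s (!i) a`. -/
def cornerSegment (s : X.S) (i t : Bool) (h : X.side s i t ∉ X.vertical) (a b : Bool) :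
    X.OrderedSimplex 1 :=
  have he : X.side s (!i) a ∈ X.vertical := by
    by_contra h'
    exact h ((X.alternates s i t a).2 h')
  if b then
    .star (X.side s (!i) a) he
      (pairEmb (.square s (!i) a rfl) (.apex (t ^^ X.reversed s (!i) a)) (by simp))
      (by simp [Spans, Fin.forall_fin_two, pairEmb_zero, pairEmb_one])
  else
    .star (X.side s (!i) a) he
      (pairEmb (.apex (t ^^ X.reversed s (!i) a)) (.square s (!i) a rfl) (by simp))
      (by simp +contextual [Spans, Fin.forall_fin_two, pairEmb_zero, pairEmb_one])

/-- The vertices of the triangle with corner `s*` and opposite side `side s i t`. -/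
def triVertex (s : X.S) (i t : Bool) : Option Bool → X.OrderedSimplex 0
  | none => .square s
  | some a => .vert (X.ends (X.side s i t) (a ^^ X.reversed s i t))

/-- The edges of the triangle with corner `s*` and opposite side `side s i t`, from one corner to
another one (the two corners are always distinct). -/
def triEdge (s : X.S) (i t : Bool) (h : X.side s i t ∉ X.vertical) :
    Option Bool → Option Bool → X.OrderedSimplex 1
  | none, some a => cornerSegment s i t h a true
  | some a, none => cornerSegment s i t h a false
  | some a, some _ => .hor (X.side s i t) h (a ^^ X.reversed s i t)
  | none, none => .hor (X.side s i t) h false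

/-- The ordered simplex spanned by some corners of the triangle with corner `s*` and opposite side
`side s i t`. -/
def ofTri (s : X.S) (i t : Bool) (h : X.side s i t ∉ X.vertical) :
    ∀ {m : ℕ}, (Fin (m + 1) ↪ Option Bool) → X.OrderedSimplex m
  | 0, f => triVertex s i t (f 0)
  | 1, f => triEdge s i t h (f 0) (f 1)
  | 2, f => .tri s i t h f
  | m + 3, f => absurd (Fintype.card_le_of_embedding f) (by simp)

/-- The only face of a vertex is the vertex. -/
def ofPoint (x : X.OrderedSimplex 0) : ∀ {m : ℕ}, (Fin (m + 1) ↪ Fin 1) → X.OrderedSimplex m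
  | 0, _ => x
  | m + 1, f => absurd (Fintype.card_le_of_embedding f) (by simp)

theorem Spans.trans {e : X.E} {m n : ℕ} {f : Fin (n + 1) ↪ X.StarCorner e} (hf : Spans f)
    (θ : Fin (m + 1) ↪ Fin (n + 1)) : Spans (θ.trans f) :=
  fun j k => hf (θ j) (θ k)

/-- The face of an ordered simplex of the simplexification with corners `θ 0, …, θ m`. -/
def simplexFace : ∀ {m n : ℕ}, (Fin (m + 1) ↪ Fin (n + 1)) → X.OrderedSimplex n →
    X.OrderedSimplex m
  | _, _, θ, .vert v => ofPoint (.vert v) θ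
  | _, _, θ, .edge e he => ofPoint (.edge e he) θ
  | _, _, θ, .square s => ofPoint (.square s) θ
  | _, _, θ, .hor e he b => ofHor e he (θ.trans (pairEmb b (!b) (by simp)))
  | _, _, θ, .tri s i t h f => ofTri s i t h (θ.trans f)
  | _, _, θ, .star _ he f hf => ofStar he (θ.trans f) (hf.trans θ)

theorem emb_fin_one {m : ℕ} (θ : Fin (m + 1) ↪ Fin (0 + 1)) : m = 0 := by
  have := Fintype.card_le_of_embedding θ
  simp at this
  exact this

theorem emb_one (θ : Fin (0 + 1) ↪ Fin (0 + 1)) : θ = Function.Embedding.refl _ := by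
  ext1 a
  exact Subsingleton.elim (α := Fin 1) _ _

theorem simplexFace_id {n : ℕ} (x : X.OrderedSimplex n) :
    simplexFace (Function.Embedding.refl _) x = x := by
  cases x <;> rfl

theorem simplexFace_zero {m : ℕ} (θ : Fin (m + 1) ↪ Fin (0 + 1)) (x : X.OrderedSimplex 0) :
    simplexFace θ x = ofPoint x θ := by
  cases x <;> rfl

theorem simplexFace_ofPoint {l m : ℕ} (η : Fin (l + 1) ↪ Fin (m + 1))
    (θ : Fin (m + 1) ↪ Fin 1) (x : X.OrderedSimplex 0) :
    simplexFace η (ofPoint x θ) = ofPoint x (η.trans θ) := by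
  obtain rfl := emb_fin_one θ
  obtain rfl := emb_fin_one η
  exact simplexFace_zero _ _

theorem simplexFace_ofStar {e : X.E} (he : e ∈ X.vertical) {l m : ℕ}
    (η : Fin (l + 1) ↪ Fin (m + 1)) (f : Fin (m + 1) ↪ X.StarCorner e) (hf : Spans f) :
    simplexFace η (ofStar he f hf) = ofStar he (η.trans f) (hf.trans η) := by
  cases m with
  | succ m => rfl
  | zero =>
    obtain rfl := emb_fin_one η
    obtain rfl := emb_one η
    exact simplexFace_zero _ _

theorem simplexFace_ofHor (e : X.E) (he : e ∉ X.vertical) {l m : ℕ}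
    (η : Fin (l + 1) ↪ Fin (m + 1)) (f : Fin (m + 1) ↪ Bool) :
    simplexFace η (ofHor e he f) = ofHor e he (η.trans f) := by
  match m, f with
  | 0, f =>
    obtain rfl := emb_fin_one η
    obtain rfl := emb_one η
    exact simplexFace_zero _ _
  | 1, f =>
    have h : f 0 ≠ f 1 := fun h => by simpa using f.injective h
    have h' : f 1 = !f 0 := by
      cases h0 : f 0 <;> cases h1 : f 1 <;> simp_all
    have h2 : pairEmb (f 0) (!f 0) (by simp) = f := by
      ext1 a
      fin_cases a
      · rfl
      · exact h'.symm
    change ofHor e he (η.trans (pairEmb (f 0) (!f 0) _)) = _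
    rw [h2]
  | m + 2, f => exact absurd (Fintype.card_le_of_embedding f) (by simp)

theorem emb_fin_two (η : Fin (1 + 1) ↪ Fin (1 + 1)) :
    (η 0 = 0 ∧ η 1 = 1) ∨ (η 0 = 1 ∧ η 1 = 0) := by
  have h : η 0 ≠ η 1 := fun h => by simpa using η.injective h
  revert h
  generalize η 0 = a
  generalize η 1 = b
  revert a b
  decide

/-- The two descriptions of the vertex at a corner of a square agree. -/
theorem corner_vertex (s : X.S) (i t a : Bool) :
    X.ends (X.side s (!i) a) (t ^^ X.reversed s (!i) a) =
      X.ends (X.side s i t) (a ^^ X.reversed s i t) := by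
  cases i
  · exact (X.corner_eq s (fun j => if j then t else a)).symm
  · exact X.corner_eq s (fun j => if j then a else t)

theorem triEdge_vertex (s : X.S) (i t : Bool) (h : X.side s i t ∉ X.vertical) (x y : Option Bool)
    (hxy : x ≠ y) (η : Fin (0 + 1) ↪ Fin (1 + 1)) :
    simplexFace η (triEdge s i t h x y) = triVertex s i t (if η 0 = 0 then x else y) := by
  have hη : η 0 = 0 ∨ η 0 = 1 := by
    generalize η 0 = a
    revert a
    decide
  rcases x with _ | a <;> rcases y with _ | b
  · exact absurd rfl hxy
  · rcases hη with h0 | h0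
    · simp [triEdge, cornerSegment, simplexFace, ofStar, h0, pairEmb_zero, starVertex, triVertex]
    · simp [triEdge, cornerSegment, simplexFace, ofStar, h0, pairEmb_one, starVertex, triVertex,
        corner_vertex]
  · rcases hη with h0 | h0
    · simp [triEdge, cornerSegment, simplexFace, ofStar, h0, pairEmb_zero, starVertex, triVertex,
        corner_vertex]
    · simp [triEdge, cornerSegment, simplexFace, ofStar, h0, pairEmb_one, starVertex, triVertex]
  · have hb : b = !a := by
      cases a <;> cases b <;> simp_all
    rcases hη with h0 | h0
    · simp [triEdge, simplexFace, ofHor, h0, pairEmb_zero, triVertex]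
    · simp [triEdge, simplexFace, ofHor, h0, pairEmb_one, triVertex, hb]

theorem triEdge_swap (s : X.S) (i t : Bool) (h : X.side s i t ∉ X.vertical) (x y : Option Bool)
    (hxy : x ≠ y) (η : Fin (1 + 1) ↪ Fin (1 + 1)) (h0 : η 0 = 1) (h1 : η 1 = 0) :
    simplexFace η (triEdge s i t h x y) = triEdge s i t h y x := by
  have hη : ∀ {α : Type u} (p q : α) (hpq : p ≠ q), η.trans (pairEmb p q hpq) =
      pairEmb q p hpq.symm := by
    intro α p q hpq
    ext1 a
    fin_cases a
    · exact congrArg (pairEmb p q hpq) h0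
    · exact congrArg (pairEmb p q hpq) h1
  rcases x with _ | a <;> rcases y with _ | b
  · exact absurd rfl hxy
  · simp [triEdge, cornerSegment, simplexFace, ofStar, hη]
  · simp [triEdge, cornerSegment, simplexFace, ofStar, hη]
  · have hb : b = !a := by
      cases a <;> cases b <;> simp_all
    simp [triEdge, simplexFace, ofHor, h0, pairEmb_one, hb]

theorem simplexFace_ofTri (s : X.S) (i t : Bool) (h : X.side s i t ∉ X.vertical) {l m : ℕ}
    (η : Fin (l + 1) ↪ Fin (m + 1)) (f : Fin (m + 1) ↪ Option Bool) :
    simplexFace η (ofTri s i t h f) = ofTri s i t h (η.trans f) := by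
  match m, f with
  | 0, f =>
    obtain rfl := emb_fin_one η
    obtain rfl := emb_one η
    exact simplexFace_zero _ _
  | 1, f =>
    have hf : f 0 ≠ f 1 := fun h => by simpa using f.injective h
    match l, η with
    | 0, η =>
      refine (triEdge_vertex s i t h _ _ hf η).trans ?_
      have hη : η 0 = 0 ∨ η 0 = 1 := by
        generalize η 0 = a
        revert a
        decide
      change _ = triVertex s i t (f (η 0))
      rcases hη with h0 | h0 <;> simp [h0]
    | 1, η =>
      change _ = triEdge s i t h (f (η 0)) (f (η 1))
      rcases emb_fin_two η with ⟨h0, h1⟩ | ⟨h0, h1⟩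
      · have hr : η = Function.Embedding.refl _ := by
          ext1 a
          fin_cases a
          · exact h0
          · exact h1
        rw [h0, h1, hr]
        exact simplexFace_id _
      · rw [h0, h1]
        exact triEdge_swap s i t h _ _ hf η h0 h1
    | l + 2, η => exact absurd (Fintype.card_le_of_embedding η) (by simp)
  | 2, f => rfl
  | m + 3, f => exact absurd (Fintype.card_le_of_embedding f) (by simp)

theorem simplexFace_comp {l m n : ℕ} (η : Fin (l + 1) ↪ Fin (m + 1))
    (θ : Fin (m + 1) ↪ Fin (n + 1)) (x : X.OrderedSimplex n) :
    simplexFace η (simplexFace θ x) = simplexFace (η.trans θ) x := by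
  cases x with
  | vert v => exact simplexFace_ofPoint _ _ _
  | edge e he => exact simplexFace_ofPoint _ _ _
  | square s => exact simplexFace_ofPoint _ _ _
  | hor e he b => exact simplexFace_ofHor _ _ _ _
  | tri s i t h f => exact simplexFace_ofTri _ _ _ _ _ _
  | star e he f hf => exact simplexFace_ofStar _ _ _ _

theorem simplexFace_free {n : ℕ} (θ : Fin (n + 1) ↪ Fin (n + 1)) (x : X.OrderedSimplex n)
    (hx : simplexFace θ x = x) : θ = Function.Embedding.refl _ := by
  cases x with
  | vert v => exact emb_one θ
  | edge e he => exact emb_one θ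
  | square s => exact emb_one θ
  | hor e he b =>
    have h : pairEmb b (!b) (by simp) (θ 0) = b := by
      injection hx
    rcases emb_fin_two θ with ⟨h0, h1⟩ | ⟨h0, h1⟩
    · ext1 a
      fin_cases a
      · exact h0
      · exact h1
    · rw [h0] at h
      rw [pairEmb_one] at h
      simp at h
  | tri s i t h f =>
    have h : θ.trans f = f := by injection hx
    ext1 a
    exact f.injective (DFunLike.congr_fun h a)
  | star e he f hf =>
    have h : θ.trans f = f := by injection hx
    ext1 a
    exact f.injective (DFunLike.congr_fun h a)

/-- The simplexification of a `VH`-complex. -/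
def simplexification (X : VHComplex.{u}) : GenSimplicialComplex.{u} where
  simplex := X.OrderedSimplex
  face := simplexFace
  face_id := simplexFace_id
  face_comp := simplexFace_comp
  face_free := simplexFace_free

end VHComplex

/-!
The star of `e*` is the union of the two families of simplices attached to a vertical edge `e`. The
subdivided square complex `X` sits in `X*`, and there is a retraction of `X*` onto it which, in each
star, pushes a point with its height above `e*` kept into the adjacent square whose barycentric
coordinate exceeds the sum of those of the other adjacent squares, or onto `e` if there is no such
square. A point of a star and its image lie in a common simplex, so straight lines give a homotopy
from the identity to the retraction. Thus `X*` is dominated by `X`, hence simply connected.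

In the link of a vertex of `X*`, the stars through that vertex contribute pieces that are cliques
or suspensions of cliques, with the two endpoints of a vertical edge as suspension points. All
remaining edges of the link come from triangles with a horizontal side. These never lie inside one
piece and are so rare, as the links of `X` have no double edges, that a cycle without diagonals
which passes through different pieces must have length at least `6`.

A simplex of `X*` arises from a cell of `X`, and only finitely many arise from each cell if the
vertical edges have finitely many adjacent squares. This holds if `X` carries a geometric action,
which therefore induces a geometric action on `X*`.
-/

/-! ### Homotopy domination -/

theorem simplyConnectedSpace_of_homotopy_comp {A B : Type*} [TopologicalSpace A]
    [TopologicalSpace B] [SimplyConnectedSpace A] (i : C(A, B)) (r : C(B, A))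
    (H : (ContinuousMap.id B).Homotopy (i.comp r)) : SimplyConnectedSpace B := by
  obtain ⟨T, hT⟩ : ∃ T : ∀ x : B, Path x (i (r x)), ∀ (x y : B) (p : Path x y),
      (p.trans (T y)).Homotopic ((T x).trans ((p.map r.continuous).map i.continuous)) :=
    ⟨fun x => H.evalAt x, fun x y p => Path.Homotopic.map_trans_evalAt H p⟩
  rw [simply_connected_iff_paths_homotopic']
  constructor
  · obtain ⟨⟨a⟩, hA⟩ := (inferInstance : PathConnectedSpace A)
    exact ⟨⟨i a⟩, fun x y => .trans ⟨T x⟩ (.trans ((hA (r x) (r y)).map i.continuous) ⟨(T y).symm⟩)⟩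
  · intro x y p q
    have himage : ((p.map r.continuous).map i.continuous).Homotopic
        ((q.map r.continuous).map i.continuous) :=
      (SimplyConnectedSpace.paths_homotopic (p.map r.continuous) (q.map r.continuous)).map i
    have htrans : (p.trans (T y)).Homotopic (q.trans (T y)) :=
      (hT x y p).trans (((Path.Homotopic.refl _).hcomp himage).trans (hT x y q).symm)
    rw [← Path.Homotopic.Quotient.eq] at htrans ⊢
    simpa using congrArg (·.trans (Path.Homotopic.Quotient.mk (T y)).symm) htrans

/-! ### Barycentric coordinates -/

theorem exists_univ_map_eq {α : Type*} {s : Finset α} (hs : s.Nonempty) :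
    ∃ (m : ℕ) (f : Fin (m + 1) ↪ α), Finset.univ.map f = s := by
  obtain ⟨m, hm⟩ := Nat.exists_eq_succ_of_ne_zero hs.card_ne_zero
  let e := (s.equivFinOfCardEq hm).symm
  refine ⟨m, e.toEmbedding.trans (.subtype _), Finset.ext fun a => ?_⟩
  simp only [Finset.mem_map, Finset.mem_univ, true_and]
  exact ⟨by rintro ⟨j, rfl⟩; exact (e j).2, fun ha => ⟨e.symm ⟨a, ha⟩, by simp⟩⟩

/-- The embedding of the corner of a vertex with value `a`. -/
def constEmb {α : Type*} (a : α) : Fin (0 + 1) ↪ α :=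
  ⟨fun _ => a, fun _ _ _ => Subsingleton.elim (α := Fin 1) _ _⟩

/-- Finitely supported barycentric coordinates on a set, such that any two elements of the support
are related by `c`: the points of the simplicial complex whose simplices are the finite `c`-cliques
(including the diagonal). -/
structure Weight {α : Type*} (c : α → α → Prop) where
  val : α → ℝ
  nonneg : ∀ a, 0 ≤ val a
  exists_finset : ∃ s : Finset α, (∀ a ∉ s, val a = 0) ∧ ∑ a ∈ s, val a = 1
  compat : ∀ a b, val a ≠ 0 → val b ≠ 0 → c a b

namespace Weight

variable {α : Type*} {c : α → α → Prop}

@[ext] theorem ext {v w : Weight c} (h : ∀ a, v.val a = w.val a) : v = w := by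
  cases v; cases w
  congr
  exact funext h

theorem finite_support (w : Weight c) : {a | w.val a ≠ 0}.Finite := by
  obtain ⟨s, hs, -⟩ := w.exists_finset
  exact s.finite_toSet.subset fun a ha => not_imp_comm.1 (hs a) ha

theorem sum_eq_one (w : Weight c) {s : Finset α} (hs : ∀ a ∉ s, w.val a = 0) :
    ∑ a ∈ s, w.val a = 1 := by
  classical
  obtain ⟨s', hs', hsum⟩ := w.exists_finset
  rw [← hsum, Finset.sum_subset Finset.subset_union_left fun a _ ha => hs a ha,
    Finset.sum_subset Finset.subset_union_right fun a _ ha => hs' a ha]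

theorem sum_le_one (w : Weight c) (s : Finset α) : ∑ a ∈ s, w.val a ≤ 1 := by
  classical
  obtain ⟨s', hs', -⟩ := w.exists_finset
  rw [← w.sum_eq_one (s := s ∪ s') fun a ha => hs' a fun h => ha (Finset.mem_union_right _ h)]
  exact Finset.sum_le_sum_of_subset_of_nonneg Finset.subset_union_left fun a _ _ => w.nonneg a

theorem le_one (w : Weight c) (a : α) : w.val a ≤ 1 := by
  simpa using w.sum_le_one {a}

theorem eq_zero_of_sum_eq_one (w : Weight c) {s : Finset α} (hs : ∑ a ∈ s, w.val a = 1) {b : α}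
    (hb : b ∉ s) : w.val b = 0 := by
  classical
  have h := w.sum_le_one (insert b s)
  rw [Finset.sum_insert hb, hs] at h
  linarith [w.nonneg b]

theorem eq_zero_of_eq_one (w : Weight c) {a b : α} (h : w.val a = 1) (hb : b ≠ a) :
    w.val b = 0 :=
  w.eq_zero_of_sum_eq_one (s := {a}) (by simpa using h) (by simpa using hb)

theorem exists_ne_zero (w : Weight c) : ∃ a, w.val a ≠ 0 := by
  by_contra! h
  obtain ⟨s, -, hsum⟩ := w.exists_finset
  simp [h] at hsum

/-- The barycentric coordinates of a point of a simplex whose corners are labelled by `f`. -/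
noncomputable def push {m : ℕ} (f : Fin (m + 1) ↪ α) (hf : ∀ j k, c (f j) (f k))
    (t : stdSimplex ℝ (Fin (m + 1))) : Weight c where
  val a := by
    classical exact ∑ j, if f j = a then t j else 0
  nonneg a := by
    classical exact Finset.sum_nonneg fun j _ => by split_ifs; exacts [t.2.1 j, le_rfl]
  exists_finset := by
    classical
    refine ⟨Finset.univ.map f, fun a ha => Finset.sum_eq_zero fun j _ => if_neg ?_, ?_⟩
    · rintro rfl
      exact ha (by simp)
    · rw [Finset.sum_map, ← t.2.2]
      exact Finset.sum_congr rfl fun k _ => by simp; rfl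
  compat a b ha hb := by
    classical
    obtain ⟨j, -, hj⟩ := Finset.exists_ne_zero_of_sum_ne_zero ha
    obtain ⟨k, -, hk⟩ := Finset.exists_ne_zero_of_sum_ne_zero hb
    rw [← (ite_ne_right_iff.1 hj).1, ← (ite_ne_right_iff.1 hk).1]
    exact hf j k

section push

variable {m : ℕ} (f : Fin (m + 1) ↪ α) (hf : ∀ j k, c (f j) (f k))
  (t : stdSimplex ℝ (Fin (m + 1)))

theorem push_apply (j : Fin (m + 1)) : (push f hf t).val (f j) = t j := by
  classical simp [push]

theorem push_of_notMem {a : α} (ha : ∀ j, f j ≠ a) : (push f hf t).val a = 0 := by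
  classical simp [push, ha]

theorem sum_push : ∑ j, (push f hf t).val (f j) = 1 := by
  simp only [push_apply]
  exact t.2.2

theorem push_map {l : ℕ} (θ : Fin (l + 1) ↪ Fin (m + 1))
    (hf' : ∀ j k, c (θ.trans f j) (θ.trans f k)) (t : stdSimplex ℝ (Fin (l + 1))) :
    push f hf (stdSimplex.map θ t) = push (θ.trans f) hf' t := by
  classical
  ext a
  by_cases ha : ∃ j, f j = a
  · obtain ⟨j, rfl⟩ := ha
    rw [push_apply]
    simp [push, stdSimplex.map_coe, FunOnFinite.linearMap_apply_apply, Finset.sum_filter]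
  · push Not at ha
    exact (push_of_notMem _ _ _ ha).trans (push_of_notMem _ _ _ fun j => ha (θ j)).symm

theorem continuous_push (a : α) : Continuous fun t => (push f hf t).val a := by
  classical
  change Continuous fun t : stdSimplex ℝ (Fin (m + 1)) => ∑ j, if f j = a then t j else 0
  refine continuous_finsetSum _ fun j _ => ?_
  split_ifs
  · exact (continuous_apply j).comp continuous_subtype_val
  · exact continuous_const

end push

/-- The point of a simplex containing the support of a weight that has this weight. -/
noncomputable def pull (w : Weight c) {m : ℕ} (f : Fin (m + 1) ↪ α)
    (h : ∑ j, w.val (f j) = 1) : stdSimplex ℝ (Fin (m + 1)) :=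
  ⟨fun j => w.val (f j), fun _ => w.nonneg _, h⟩

theorem exists_eq_of_ne_zero (w : Weight c) {m : ℕ} {f : Fin (m + 1) ↪ α}
    (h : ∑ j, w.val (f j) = 1) {a : α} (ha : w.val a ≠ 0) : ∃ j, f j = a := by
  by_contra! hne
  exact ha (w.eq_zero_of_sum_eq_one (s := Finset.univ.map f) (by simpa using h)
    (by simpa using hne))

theorem push_pull (w : Weight c) {m : ℕ} (f : Fin (m + 1) ↪ α) (hf : ∀ j k, c (f j) (f k))
    (h : ∑ j, w.val (f j) = 1) : push f hf (w.pull f h) = w := by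
  ext a
  by_cases ha : ∃ j, f j = a
  · obtain ⟨j, rfl⟩ := ha
    exact push_apply _ _ _ j
  · rw [push_of_notMem _ _ _ (by simpa using ha)]
    by_contra hne
    exact ha (w.exists_eq_of_ne_zero h (Ne.symm hne))

theorem pull_push {m : ℕ} (f : Fin (m + 1) ↪ α) (hf : ∀ j k, c (f j) (f k))
    (t : stdSimplex ℝ (Fin (m + 1))) : (push f hf t).pull f (sum_push f hf t) = t :=
  Subtype.ext (funext (push_apply f hf t))

theorem exists_emb (w : Weight c) : ∃ (m : ℕ) (f : Fin (m + 1) ↪ α),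
    (∀ j, w.val (f j) ≠ 0) ∧ ∑ j, w.val (f j) = 1 := by
  obtain ⟨m, f, hf⟩ := exists_univ_map_eq (w.finite_support.toFinset_nonempty.2 w.exists_ne_zero)
  refine ⟨m, f, fun j => ?_, ?_⟩
  · have : f j ∈ w.finite_support.toFinset := hf ▸ Finset.mem_map_of_mem f (Finset.mem_univ j)
    simpa using this
  · rw [← Finset.sum_map, hf]
    exact w.sum_eq_one (by simp)

/-- The weight concentrated at one element. -/
noncomputable def single (a : α) (ha : c a a) : Weight c where
  val b := by classical exact if b = a then 1 else 0
  nonneg b := by split_ifs <;> norm_num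
  exists_finset := ⟨{a}, fun b hb => if_neg (by simpa using hb), by
    rw [Finset.sum_singleton, if_pos rfl]⟩
  compat b b' hb hb' := by
    classical rwa [(ite_ne_right_iff.1 hb).1, (ite_ne_right_iff.1 hb').1]

theorem single_apply_self (a : α) (ha : c a a) : (single a ha).val a = 1 := if_pos rfl

theorem single_apply_of_ne (a : α) (ha : c a a) {b : α} (h : b ≠ a) :
    (single a ha).val b = 0 := if_neg h

end Weight

namespace GenSimplicialComplex

variable {K : GenSimplicialComplex.{u}}

/-- The point of the realisation with barycentric coordinates `t` in the ordered simplex `x`. -/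
def point {n : ℕ} (x : K.simplex n) (t : stdSimplex ℝ (Fin (n + 1))) : K.Realization :=
  Quot.mk _ ⟨⟨n, x⟩, t⟩

theorem point_face {m n : ℕ} (θ : Fin (m + 1) ↪ Fin (n + 1)) (x : K.simplex n)
    (t : stdSimplex ℝ (Fin (m + 1))) : point (K.face θ x) t = point x (stdSimplex.map θ t) :=
  Quot.sound (.face θ x t)

theorem continuous_point {n : ℕ} (x : K.simplex n) : Continuous (point x) :=
  continuous_quot_mk.comp continuous_sigmaMk

end GenSimplicialComplex

/-- A map to `K` from the simplicial complex whose simplices are the finite cliques of `c`, given by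
the image of each ordered clique. -/
structure Chart (K : GenSimplicialComplex.{u}) (α : Type*) (c : α → α → Prop) where
  simplex : ∀ {m : ℕ} (f : Fin (m + 1) ↪ α), (∀ j k, c (f j) (f k)) → K.simplex m
  face : ∀ {m n : ℕ} (θ : Fin (m + 1) ↪ Fin (n + 1)) (f : Fin (n + 1) ↪ α) (hf)
    (hf' : ∀ j k, c (θ.trans f j) (θ.trans f k)),
    K.face θ (simplex f hf) = simplex (θ.trans f) hf'

namespace Chart

open GenSimplicialComplex

variable {K : GenSimplicialComplex.{u}} {α : Type*} {c : α → α → Prop} (C : Chart K α c)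

/-- The map induced by a chart on realisations. -/
noncomputable def pt (w : Weight c) : K.Realization :=
  point (C.simplex w.exists_emb.choose_spec.choose fun _ _ =>
      w.compat _ _ (w.exists_emb.choose_spec.choose_spec.1 _)
        (w.exists_emb.choose_spec.choose_spec.1 _))
    (w.pull _ w.exists_emb.choose_spec.choose_spec.2)

theorem point_eq_of_ne_zero {m n : ℕ} {g : Fin (m + 1) ↪ α} {f : Fin (n + 1) ↪ α} (w : Weight c)
    (hg hf) (hne : ∀ j, w.val (g j) ≠ 0) (h : ∑ j, w.val (g j) = 1)
    (h' : ∑ j, w.val (f j) = 1) :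
    point (C.simplex g hg) (w.pull g h) = point (C.simplex f hf) (w.pull f h') := by
  choose θ hθ using fun j => w.exists_eq_of_ne_zero h' (hne j)
  obtain ⟨Θ, rfl⟩ : ∃ Θ : Fin (m + 1) ↪ Fin (n + 1), g = Θ.trans f :=
    ⟨⟨θ, fun j k hjk => g.injective (by rw [← hθ, hjk, hθ])⟩, by ext1 j; exact (hθ j).symm⟩
  rw [← C.face Θ f hf hg, point_face, ← Weight.pull_push f hf (stdSimplex.map Θ _)]
  congr 2
  rw [Weight.push_map f hf Θ hg, Weight.push_pull]

theorem point_pull {n : ℕ} (f : Fin (n + 1) ↪ α) (hf) (w : Weight c) (h : ∑ j, w.val (f j) = 1) :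
    point (C.simplex f hf) (w.pull f h) = C.pt w :=
  (C.point_eq_of_ne_zero w _ hf w.exists_emb.choose_spec.choose_spec.1 _ h).symm

theorem point_eq {n : ℕ} (f : Fin (n + 1) ↪ α) (hf) (t : stdSimplex ℝ (Fin (n + 1))) :
    point (C.simplex f hf) t = C.pt (Weight.push f hf t) := by
  rw [← C.point_pull f hf _ (Weight.sum_push f hf t), Weight.pull_push]

theorem apply_pt {Z : Type*} {F : K.Realization → Z} {g : Weight c → Z}
    (h : ∀ {m : ℕ} (f : Fin (m + 1) ↪ α) (hf) (t),
      F (point (C.simplex f hf) t) = g (Weight.push f hf t)) (w : Weight c) :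
    F (C.pt w) = g w := by
  obtain ⟨m, f, hne, hsum⟩ := w.exists_emb
  rw [← C.point_pull f (fun j k => w.compat _ _ (hne j) (hne k)) w hsum, h, Weight.push_pull]

theorem pt_eq_pt {β : Type*} {d : β → β → Prop} (D : Chart K β d) {m : ℕ} {f : Fin (m + 1) ↪ α}
    {g : Fin (m + 1) ↪ β} {hf hg} (hfg : C.simplex f hf = D.simplex g hg) {w : Weight c}
    {v : Weight d} (hwv : ∀ j, w.val (f j) = v.val (g j)) (hw : ∑ j, w.val (f j) = 1) :
    C.pt w = D.pt v := by
  have hv : ∑ j, v.val (g j) = 1 := by simpa only [hwv] using hw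
  rw [← C.point_pull f hf w hw, ← D.point_pull g hg v hv, hfg]
  congr 1
  exact Subtype.ext (funext hwv)

theorem pt_eq_point {w : Weight c} {a : α} (ha : w.val a = 1) (hf) (t) :
    C.pt w = point (C.simplex (constEmb a) hf) t := by
  rw [← C.point_pull (constEmb a) hf w ((Fin.sum_univ_one _).trans ha)]
  congr 1
  exact Subsingleton.elim (α := stdSimplex ℝ (Fin 1)) _ _

theorem continuousOn_pt {P : Type*} [TopologicalSpace P] {F : P → Weight c} {A : Set P} {m : ℕ}
    (f : Fin (m + 1) ↪ α) (hf : ∀ j k, c (f j) (f k))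
    (hF : ∀ j, Continuous fun p => (F p).val (f j))
    (hA : ∀ p ∈ A, ∑ j, (F p).val (f j) = 1) : ContinuousOn (fun p => C.pt (F p)) A := by
  rw [continuousOn_iff_continuous_domRestrict]
  refine Continuous.congr ?_ fun p : A => C.point_pull f hf (F p) (hA p p.2)
  exact (continuous_point _).comp
    (.subtype_mk (continuous_pi fun j => (hF j).comp continuous_subtype_val) _)

-- The closed sets of points with support in a fixed clique form a finite cover.
theorem continuous_pt {P : Type*} [TopologicalSpace P] (F : P → Weight c) (s : Finset α)
    (hs : ∀ p, ∀ a ∉ s, (F p).val a = 0) (hF : ∀ a ∈ s, Continuous fun p => (F p).val a) :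
    Continuous fun p => C.pt (F p) := by
  classical
  let A (s' : {s' : Finset α // s' ⊆ s ∧ ∀ a ∈ s', ∀ b ∈ s', c a b}) : Set P :=
    {p | ∑ a ∈ s'.1, (F p).val a = 1}
  have : Finite {s' : Finset α // s' ⊆ s ∧ ∀ a ∈ s', ∀ b ∈ s', c a b} :=
    (s.powerset.finite_toSet.subset fun s' hs' => Finset.mem_powerset.2 hs'.1).to_subtype
  refine (locallyFinite_of_finite A).continuous (eq_univ_of_forall fun p => mem_iUnion.2 ?_)
    (fun s' => ?_) fun s' => ?_
  · refine ⟨⟨s.filter fun a => (F p).val a ≠ 0, Finset.filter_subset _ _, fun a ha b hb => ?_⟩, ?_⟩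
    · exact (F p).compat a b (Finset.mem_filter.1 ha).2 (Finset.mem_filter.1 hb).2
    · refine (F p).sum_eq_one fun a ha => ?_
      by_contra hne
      exact ha (Finset.mem_filter.2 ⟨not_imp_comm.1 (hs p a) hne, hne⟩)
  · exact isClosed_eq (continuous_finsetSum _ fun a ha => hF a (s'.2.1 ha)) continuous_const
  · obtain ⟨s', hs', hc⟩ := s'
    rcases s'.eq_empty_or_nonempty with rfl | hne
    · simp [A]
    · obtain ⟨m, f, rfl⟩ := exists_univ_map_eq hne
      have hf (j) : f j ∈ Finset.univ.map f := Finset.mem_map_of_mem f (Finset.mem_univ j)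
      exact C.continuousOn_pt f (fun j k => hc _ (hf j) _ (hf k)) (fun j => hF _ (hs' (hf j)))
        fun p hp => by simpa [A] using hp

end Chart

namespace VHComplex

open GenSimplicialComplex

variable {X : VHComplex.{u}}

/-! ### Maps on the simplexification -/

/-- The relation on the corners of the star of `e*` whose cliques are those that span a simplex. -/
def StarCompat {e : X.E} (x y : X.StarCorner e) : Prop := x = .apex false → y ≠ .apex true

theorem starCompat_self {e : X.E} (x : X.StarCorner e) : StarCompat x x := by
  rintro rfl; simp

/-- The relation on the corners of an edge or a triangle, all of which span simplices together. -/
def AllCompat {α : Type*} (_ _ : α) : Prop := True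

/-- The star of `e*`. -/
def starChart (e : X.E) (he : e ∈ X.vertical) :
    Chart X.simplexification (X.StarCorner e) StarCompat where
  simplex f hf := ofStar he f hf
  face θ f hf _ := simplexFace_ofStar he θ f hf

/-- A horizontal edge. -/
def horChart (e : X.E) (he : e ∉ X.vertical) : Chart X.simplexification Bool AllCompat where
  simplex f _ := ofHor e he f
  face θ f _ _ := simplexFace_ofHor e he θ f

/-- The triangle with horizontal side `side s i t` and opposite corner `s*`. -/
def triChart (s : X.S) (i t : Bool) (h : X.side s i t ∉ X.vertical) :
    Chart X.simplexification (Option Bool) AllCompat where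
  simplex f _ := ofTri s i t h f
  face θ f _ _ := simplexFace_ofTri s i t h θ f

theorem side_mem_vertical {s : X.S} {i t : Bool} (h : X.side s i t ∉ X.vertical) (a : Bool) :
    X.side s (!i) a ∈ X.vertical := by
  by_contra h'
  exact h ((X.alternates s i t a).2 h')

theorem exists_vertical_side (s : X.S) : ∃ i, ∀ t, X.side s i t ∈ X.vertical := by
  by_cases h : X.side s true false ∈ X.vertical
  · refine ⟨true, fun t => ?_⟩
    by_contra ht
    exact (X.alternates s true false false).1 h (side_mem_vertical ht false)
  · exact ⟨false, side_mem_vertical h⟩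

theorem apply_zero_ne_apply_one {α : Type*} (f : Fin (1 + 1) ↪ α) : f 0 ≠ f 1 := fun h => by
  simpa using f.injective h

theorem pairEmb_eta {α : Type*} (f : Fin (1 + 1) ↪ α) (h : f 0 ≠ f 1) :
    pairEmb (f 0) (f 1) h = f := by
  ext1 a
  fin_cases a <;> rfl

section pairEmb

variable {α : Type*} {c : α → α → Prop} {x y : α} (h : x ≠ y)
  (hc : ∀ j k, c (pairEmb x y h j) (pairEmb x y h k)) (p : stdSimplex ℝ (Fin (1 + 1)))

theorem push_pairEmb_left : (Weight.push (pairEmb x y h) hc p).val x = p 0 :=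
  Weight.push_apply (pairEmb x y h) hc p 0

theorem push_pairEmb_right : (Weight.push (pairEmb x y h) hc p).val y = p 1 :=
  Weight.push_apply (pairEmb x y h) hc p 1

theorem push_pairEmb_of_ne {z : α} (hx : x ≠ z) (hy : y ≠ z) :
    (Weight.push (pairEmb x y h) hc p).val z = 0 :=
  Weight.push_of_notMem _ _ _ (Fin.forall_fin_two.2 ⟨hx, hy⟩)

end pairEmb

theorem push_apply_zero {α : Type*} {c : α → α → Prop} (f : Fin (0 + 1) ↪ α) (hf)
    (p : stdSimplex ℝ (Fin (0 + 1))) : (Weight.push (c := c) f hf p).val (f 0) = 1 := by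
  rw [Weight.push_apply]
  simp

/-- Compatible continuous maps from the vertices and charts of the simplexification to a space. -/
structure ChartMaps (X : VHComplex.{u}) (Z : Type*) [TopologicalSpace Z] where
  onVert : X.V → Z
  onEdge : ∀ e ∈ X.vertical, Z
  onSquare : X.S → Z
  onHor : ∀ e ∉ X.vertical, Weight (AllCompat (α := Bool)) → Z
  onTri : ∀ (s : X.S) (i t : Bool), X.side s i t ∉ X.vertical →
    Weight (AllCompat (α := Option Bool)) → Z
  onStar : ∀ e ∈ X.vertical, Weight (StarCompat (X := X) (e := e)) → Z
  continuous_onHor : ∀ e he {m : ℕ} (f : Fin (m + 1) ↪ Bool) (hf),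
    Continuous fun p => onHor e he (Weight.push f hf p)
  continuous_onTri : ∀ s i t h {m : ℕ} (f : Fin (m + 1) ↪ Option Bool) (hf),
    Continuous fun p => onTri s i t h (Weight.push f hf p)
  continuous_onStar : ∀ e he {m : ℕ} (f : Fin (m + 1) ↪ X.StarCorner e) (hf),
    Continuous fun p => onStar e he (Weight.push f hf p)
  onHor_vert : ∀ e he w b, w.val b = 1 → onHor e he w = onVert (X.ends e b)
  onStar_apex : ∀ e he w b, w.val (.apex b) = 1 → onStar e he w = onVert (X.ends e b)
  onStar_center : ∀ e he w, w.val .center = 1 → onStar e he w = onEdge e he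
  onStar_square : ∀ e he w s i t h, w.val (.square s i t h) = 1 → onStar e he w = onSquare s
  onTri_star : ∀ s i t h a (w : Weight _) (w' : Weight _), w.val (some (!a)) = 0 →
    w'.val (.apex (t ^^ X.reversed s (!i) a)) = w.val (some a) →
    w'.val (.square s (!i) a rfl) = w.val none →
    onTri s i t h w = onStar (X.side s (!i) a) (side_mem_vertical h a) w'
  onTri_hor : ∀ s i t h (w : Weight _) (w' : Weight _), w.val none = 0 →
    (∀ a, w'.val (a ^^ X.reversed s i t) = w.val (some a)) →
    onTri s i t h w = onHor (X.side s i t) h w'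

namespace ChartMaps

variable {Z : Type*} [TopologicalSpace Z] (φ : ChartMaps X Z)

theorem onTri_none (s i t h) (w : Weight _) (hw : w.val none = 1) :
    φ.onTri s i t h w = φ.onSquare s := by
  rw [φ.onTri_star s i t h false w
    (Weight.single (.square s (!i) false rfl) (starCompat_self _))
    (w.eq_zero_of_eq_one hw (by simp)), φ.onStar_square _ _ _ s (!i) false rfl]
  · exact Weight.single_apply_self _ _
  · rw [Weight.single_apply_of_ne _ _ (by simp), w.eq_zero_of_eq_one hw (by simp)]
  · rw [Weight.single_apply_self, hw]

theorem onTri_some (s i t h) (w : Weight _) (a : Bool) (hw : w.val (some a) = 1) :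
    φ.onTri s i t h w = φ.onVert (X.ends (X.side s i t) (a ^^ X.reversed s i t)) := by
  rw [φ.onTri_star s i t h a w
    (Weight.single (.apex (t ^^ X.reversed s (!i) a)) (starCompat_self _))
    (w.eq_zero_of_eq_one hw (by simp)), φ.onStar_apex, corner_vertex]
  · exact Weight.single_apply_self _ _
  · rw [Weight.single_apply_self, hw]
  · rw [Weight.single_apply_of_ne _ _ (by simp), w.eq_zero_of_eq_one hw (by simp)]

/-- The map on a single ordered simplex. -/
noncomputable def onSimplex : ∀ {n : ℕ}, X.OrderedSimplex n → stdSimplex ℝ (Fin (n + 1)) → Z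
  | _, .vert v, _ => φ.onVert v
  | _, .edge e he, _ => φ.onEdge e he
  | _, .square s, _ => φ.onSquare s
  | _, .hor e he b, p =>
    φ.onHor e he (Weight.push (pairEmb b (!b) (by simp)) (fun _ _ => trivial) p)
  | _, .tri s i t h f, p => φ.onTri s i t h (Weight.push f (fun _ _ => trivial) p)
  | _, .star e he f hf, p => φ.onStar e he (Weight.push f hf p)

theorem onSimplex_ofStar {e : X.E} (he : e ∈ X.vertical) {m : ℕ}
    (f : Fin (m + 1) ↪ X.StarCorner e) (hf : ∀ j k, StarCompat (f j) (f k)) (p) :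
    φ.onSimplex (ofStar he f hf) p = φ.onStar e he (Weight.push f hf p) := by
  cases m with
  | succ m => rfl
  | zero =>
    have h1 := push_apply_zero f hf p
    change φ.onSimplex (starVertex he (f 0)) p = _
    cases h : f 0 with
    | apex b => exact (φ.onStar_apex e he _ b (h ▸ h1)).symm
    | center => exact (φ.onStar_center e he _ (h ▸ h1)).symm
    | square s i t h' => exact (φ.onStar_square e he _ s i t h' (h ▸ h1)).symm

theorem onSimplex_ofHor (e : X.E) (he : e ∉ X.vertical) {m : ℕ} (f : Fin (m + 1) ↪ Bool) (p) :
    φ.onSimplex (ofHor e he f) p = φ.onHor e he (Weight.push f (fun _ _ => trivial) p) := by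
  match m, f with
  | 0, f => exact (φ.onHor_vert e he _ _ (push_apply_zero f _ p)).symm
  | 1, f =>
    have h : pairEmb (f 0) (!f 0) (by simp) = f := by
      have h1 : f 1 = !f 0 := Bool.eq_not.2 (apply_zero_ne_apply_one f).symm
      simpa only [h1] using pairEmb_eta f (apply_zero_ne_apply_one f)
    change φ.onHor e he (Weight.push (pairEmb (f 0) (!f 0) _) _ p) = _
    congr 2
  | m + 2, f => exact absurd (Fintype.card_le_of_embedding f) (by simp)

theorem onSimplex_triEdge (s : X.S) (i t : Bool) (h : X.side s i t ∉ X.vertical)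
    {x y : Option Bool} (hxy : x ≠ y) (p) :
    φ.onSimplex (triEdge s i t h x y) p =
      φ.onTri s i t h (Weight.push (pairEmb x y hxy) (fun _ _ => trivial) p) := by
  match x, y with
  | none, none => exact absurd rfl hxy
  | none, some a =>
    refine (φ.onTri_star s i t h a _ _ (push_pairEmb_of_ne _ _ _ (by simp) (by simp)) ?_ ?_).symm
    · exact (push_pairEmb_right _ _ p).trans (push_pairEmb_right _ _ p).symm
    · exact (push_pairEmb_left _ _ p).trans (push_pairEmb_left _ _ p).symm
  | some a, none =>
    refine (φ.onTri_star s i t h a _ _ (push_pairEmb_of_ne _ _ _ (by simp) (by simp)) ?_ ?_).symm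
    · exact (push_pairEmb_left _ _ p).trans (push_pairEmb_left _ _ p).symm
    · exact (push_pairEmb_right _ _ p).trans (push_pairEmb_right _ _ p).symm
  | some a, some b =>
    obtain rfl : b = !a := Bool.eq_not.2 fun hba => hxy (congrArg some hba.symm)
    refine (φ.onTri_hor s i t h _ _ (push_pairEmb_of_ne _ _ _ (by simp) (by simp))
      fun b => ?_).symm
    rcases Bool.eq_or_eq_not b a with rfl | rfl
    · exact (push_pairEmb_left _ _ p).trans (push_pairEmb_left _ _ p).symm
    · rw [Bool.not_xor]
      exact (push_pairEmb_right _ _ p).trans (push_pairEmb_right _ _ p).symm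

theorem onSimplex_ofTri (s : X.S) (i t : Bool) (h : X.side s i t ∉ X.vertical) {m : ℕ}
    (f : Fin (m + 1) ↪ Option Bool) (p) :
    φ.onSimplex (ofTri s i t h f) p = φ.onTri s i t h (Weight.push f (fun _ _ => trivial) p) := by
  match m, f with
  | 0, f =>
    have h1 := push_apply_zero (c := AllCompat) f (fun _ _ => trivial) p
    change φ.onSimplex (triVertex s i t (f 0)) p = _
    cases h0 : f 0 with
    | none => exact (φ.onTri_none s i t h _ (h0 ▸ h1)).symm
    | some a => exact (φ.onTri_some s i t h _ a (h0 ▸ h1)).symm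
  | 1, f =>
    have hf := apply_zero_ne_apply_one f
    exact (φ.onSimplex_triEdge s i t h hf p).trans (by simp only [pairEmb_eta])
  | 2, f => rfl
  | m + 3, f => exact absurd (Fintype.card_le_of_embedding f) (by simp)

theorem onSimplex_face {m n : ℕ} (θ : Fin (m + 1) ↪ Fin (n + 1)) (x : X.OrderedSimplex n) (p) :
    φ.onSimplex (simplexFace θ x) p = φ.onSimplex x (stdSimplex.map θ p) := by
  cases x with
  | vert v => obtain rfl := emb_fin_one θ; rfl
  | edge e he => obtain rfl := emb_fin_one θ; rfl
  | square s => obtain rfl := emb_fin_one θ; rfl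
  | hor e he b =>
    refine (φ.onSimplex_ofHor e he _ p).trans ?_
    exact congrArg (φ.onHor e he) (Weight.push_map _ _ _ _ _).symm
  | tri s i t h f =>
    refine (φ.onSimplex_ofTri s i t h _ p).trans ?_
    exact congrArg (φ.onTri s i t h) (Weight.push_map _ _ _ _ _).symm
  | star e he f hf =>
    refine (φ.onSimplex_ofStar he _ _ p).trans ?_
    exact congrArg (φ.onStar e he) (Weight.push_map _ _ _ _ _).symm

/-- The induced continuous map on the realisation of the simplexification. -/
noncomputable def toContinuousMap : C(X.simplexification.Realization, Z) where
  toFun := Quot.lift (fun p => φ.onSimplex p.1.2 p.2) (by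
    rintro _ _ ⟨θ, x, p⟩
    exact φ.onSimplex_face θ x p)
  continuous_toFun := by
    refine continuous_quot_lift _ (continuous_sigma ?_)
    rintro ⟨n, x⟩
    cases x with
    | vert v => exact continuous_const
    | edge e he => exact continuous_const
    | square s => exact continuous_const
    | hor e he b => exact φ.continuous_onHor e he _ _
    | tri s i t h f => exact φ.continuous_onTri s i t h _ _
    | star e he f hf => exact φ.continuous_onStar e he _ _

theorem toContinuousMap_hor (e he w) :
    φ.toContinuousMap ((horChart e he).pt w) = φ.onHor e he w :=
  (horChart e he).apply_pt (fun f _ p => φ.onSimplex_ofHor e he f p) w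

theorem toContinuousMap_tri (s i t h w) :
    φ.toContinuousMap ((triChart s i t h).pt w) = φ.onTri s i t h w :=
  (triChart s i t h).apply_pt (fun f _ p => φ.onSimplex_ofTri s i t h f p) w

theorem toContinuousMap_star (e he w) :
    φ.toContinuousMap ((starChart e he).pt w) = φ.onStar e he w :=
  (starChart e he).apply_pt (fun f hf p => φ.onSimplex_ofStar he f hf p) w

end ChartMaps

/-- The point `v*` of the realisation. -/
noncomputable def vertPoint (v : X.V) : X.simplexification.Realization :=
  point (K := X.simplexification) (.vert v) (stdSimplex.vertex 0)

theorem starChart_pt_of_eq_one {e : X.E} (he : e ∈ X.vertical) {w : Weight (StarCompat (e := e))}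
    {c : X.StarCorner e} (hc : w.val c = 1) (p) :
    (starChart e he).pt w = point (K := X.simplexification) (starVertex he c) p :=
  (starChart e he).pt_eq_point hc (fun _ _ => starCompat_self c) p

theorem starChart_pt_apex {e : X.E} (he : e ∈ X.vertical) {w : Weight (StarCompat (e := e))}
    {b : Bool} (hb : w.val (.apex b) = 1) : (starChart e he).pt w = vertPoint (X.ends e b) :=
  starChart_pt_of_eq_one he hb _

theorem horChart_pt_of_eq_one {e : X.E} (he : e ∉ X.vertical) {w : Weight AllCompat} {b : Bool}
    (hb : w.val b = 1) : (horChart e he).pt w = vertPoint (X.ends e b) :=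
  (horChart e he).pt_eq_point hb (fun _ _ => trivial) _

theorem triChart_pt_eq_starChart_pt (s : X.S) (i t : Bool) (h : X.side s i t ∉ X.vertical)
    (a : Bool) (w : Weight AllCompat) (w' : Weight StarCompat) (h0 : w.val (some (!a)) = 0)
    (hapex : w'.val (.apex (t ^^ X.reversed s (!i) a)) = w.val (some a))
    (hsquare : w'.val (.square s (!i) a rfl) = w.val none) :
    (triChart s i t h).pt w = (starChart (X.side s (!i) a) (side_mem_vertical h a)).pt w' := by
  refine (triChart s i t h).pt_eq_pt (starChart _ (side_mem_vertical h a))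
    (f := pairEmb none (some a) (by simp))
    (g := pairEmb (.square s (!i) a rfl) (.apex (t ^^ X.reversed s (!i) a)) (by simp))
    (hf := fun _ _ => trivial)
    (hg := by simp [StarCompat, Fin.forall_fin_two, pairEmb_zero, pairEmb_one])
    rfl (Fin.forall_fin_two.2 ⟨hsquare.symm, hapex.symm⟩) ?_
  have hsum : ∑ x, w.val x = 1 := w.sum_eq_one (by simp)
  rw [Fintype.sum_option, Fintype.sum_bool] at hsum
  rw [Fin.sum_univ_two, pairEmb_zero, pairEmb_one]
  cases a <;> simp only [Bool.not_false, Bool.not_true] at h0 <;> linarith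

theorem triChart_pt_eq_horChart_pt (s : X.S) (i t : Bool) (h : X.side s i t ∉ X.vertical)
    (w : Weight AllCompat) (w' : Weight AllCompat) (h0 : w.val none = 0)
    (hends : ∀ a, w'.val (a ^^ X.reversed s i t) = w.val (some a)) :
    (triChart s i t h).pt w = (horChart (X.side s i t) h).pt w' := by
  refine (triChart s i t h).pt_eq_pt (horChart _ h)
    (f := pairEmb (some false) (some true) (by simp))
    (g := pairEmb (false ^^ X.reversed s i t) (true ^^ X.reversed s i t) (by simp))
    (hf := fun _ _ => trivial) (hg := fun _ _ => trivial)
    rfl (Fin.forall_fin_two.2 ⟨(hends false).symm, (hends true).symm⟩) ?_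
  have hsum : ∑ x, w.val x = 1 := w.sum_eq_one (by simp)
  rw [Fintype.sum_option, Fintype.sum_bool, h0] at hsum
  rw [Fin.sum_univ_two, pairEmb_zero, pairEmb_one]
  linarith

@[elab_as_elim]
theorem realization_induction {motive : X.simplexification.Realization → Prop}
    (vert : ∀ v, motive (vertPoint v)) (hor : ∀ e he w, motive ((horChart e he).pt w))
    (tri : ∀ s i t h w, motive ((triChart s i t h).pt w))
    (star : ∀ e he w, motive ((starChart e he).pt w)) (p) : motive p := by
  obtain ⟨⟨⟨n, x⟩, p⟩, rfl⟩ := Quot.exists_rep p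
  change motive (point (K := X.simplexification) x p)
  have hstar {e : X.E} (he : e ∈ X.vertical) (c : X.StarCorner e) (p) :
      motive (point (K := X.simplexification) (starVertex he c) p) :=
    starChart_pt_of_eq_one he (Weight.single_apply_self c (starCompat_self c)) p ▸ star e he _
  cases x with
  | vert v =>
    rw [Subsingleton.elim (α := stdSimplex ℝ (Fin 1)) p (stdSimplex.vertex 0)]
    exact vert v
  | edge e he => exact hstar he .center p
  | square s =>
    obtain ⟨i, hi⟩ := exists_vertical_side s
    exact hstar (hi false) (.square s i false rfl) p
  | hor e he b =>
    exact (horChart e he).point_eq (pairEmb b (!b) (by simp)) (fun _ _ => trivial) p ▸ hor e he _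
  | tri s i t h f => exact (triChart s i t h).point_eq f (fun _ _ => trivial) p ▸ tri s i t h _
  | star e he f hf => exact (starChart e he).point_eq f hf p ▸ star e he _

end VHComplex

namespace Weight

variable {α : Type*} {c : α → α → Prop}

theorem val_eq_one_sub [DecidableEq α] (w : Weight c) {s : Finset α} (hs : ∀ b ∉ s, w.val b = 0)
    {a : α} (ha : a ∈ s) : w.val a = 1 - ∑ b ∈ s.erase a, w.val b := by
  rw [eq_sub_iff_add_eq, Finset.add_sum_erase _ _ ha, w.sum_eq_one hs]

theorem ext_of_ne (a₀ : α) {v w : Weight c} (h : ∀ a, a ≠ a₀ → v.val a = w.val a) : v = w := by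
  classical
  ext a
  rcases eq_or_ne a a₀ with rfl | ha
  · let s := v.finite_support.toFinset ∪ w.finite_support.toFinset ∪ {a}
    have has : a ∈ s := by simp [s]
    rw [v.val_eq_one_sub (s := s) (by simp +contextual [s]) has,
      w.val_eq_one_sub (s := s) (by simp +contextual [s]) has,
      Finset.sum_congr rfl fun b hb => h b (Finset.ne_of_mem_erase hb)]
  · exact h a ha

/-- The segment between two weights with compatible supports. -/
noncomputable def mix (v w : Weight c)
    (h : ∀ a b, v.val a ≠ 0 ∨ w.val a ≠ 0 → v.val b ≠ 0 ∨ w.val b ≠ 0 → c a b) (s : I) :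
    Weight c where
  val a := (1 - s) * v.val a + s * w.val a
  nonneg a := add_nonneg (mul_nonneg (sub_nonneg.2 s.2.2) (v.nonneg a))
    (mul_nonneg s.2.1 (w.nonneg a))
  exists_finset := by
    classical
    refine ⟨v.finite_support.toFinset ∪ w.finite_support.toFinset, fun a ha => ?_, ?_⟩
    · simp only [Finset.mem_union, Finite.mem_toFinset, mem_ofPred_eq, not_or, not_not] at ha
      simp [ha.1, ha.2]
    · rw [Finset.sum_add_distrib, ← Finset.mul_sum, ← Finset.mul_sum,
        v.sum_eq_one (by simp +contextual), w.sum_eq_one (by simp +contextual)]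
      ring
  compat a b ha hb := by
    refine h a b ?_ ?_ <;> by_contra! h
    · simp [h.1, h.2] at ha
    · simp [h.1, h.2] at hb

end Weight

theorem Chart.continuous_pt_of_ne {K : GenSimplicialComplex.{u}} {α : Type*} {c : α → α → Prop}
    (C : Chart K α c) {P : Type*} [TopologicalSpace P] (F : P → Weight c) (s : Finset α) (a₀ : α)
    (hs : ∀ p, ∀ a ∉ s, (F p).val a = 0)
    (hF : ∀ a ∈ s, a ≠ a₀ → Continuous fun p => (F p).val a) :
    Continuous fun p => C.pt (F p) := by
  classical
  refine C.continuous_pt F s hs fun a ha => ?_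
  rcases eq_or_ne a a₀ with rfl | h
  · simp only [fun p => (F p).val_eq_one_sub (hs p) ha]
    exact continuous_const.sub (continuous_finsetSum _ fun b hb =>
      hF b (Finset.mem_of_mem_erase hb) (Finset.ne_of_mem_erase hb))
  · exact hF a ha h

/-- The number of `[-r, r]` nearest to `x`. -/
noncomputable def clamp (x r : ℝ) : ℝ := max (-r) (min x r)

theorem clamp_eq {x r : ℝ} (h : |x| ≤ r) : clamp x r = x := by
  rw [abs_le] at h
  rw [clamp, min_eq_left h.2, max_eq_right h.1]

theorem abs_clamp_le (x : ℝ) {r : ℝ} (h : 0 ≤ r) : |clamp x r| ≤ r := by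
  rw [abs_le, clamp]
  exact ⟨le_max_left _ _, max_le (by linarith) (min_le_right _ _)⟩

theorem continuous_clamp {P : Type*} [TopologicalSpace P] {f g : P → ℝ} (hf : Continuous f)
    (hg : Continuous g) : Continuous fun p => clamp (f p) (g p) :=
  hg.neg.max (hf.min hg)

/-- The number of the unit interval nearest to `x`. -/
noncomputable abbrev toUnit (x : ℝ) : I := projIcc 0 1 zero_le_one x

theorem coe_toUnit {x : ℝ} (h0 : 0 ≤ x) (h1 : x ≤ 1) : (toUnit x : ℝ) = x := by
  rw [toUnit, projIcc_of_mem zero_le_one ⟨h0, h1⟩]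

theorem continuous_coe_toUnit {P : Type*} [TopologicalSpace P] {f : P → ℝ} (hf : Continuous f) :
    Continuous fun p => (toUnit (f p) : ℝ) :=
  continuous_subtype_val.comp (continuous_projIcc.comp hf)

/-- The sign `±1` that a truth value stands for. -/
def sgn (b : Bool) : ℝ := if b then 1 else -1

theorem sgn_true : sgn true = 1 := rfl

theorem sgn_false : sgn false = -1 := rfl

theorem abs_sgn (b : Bool) : |sgn b| = 1 := by cases b <;> simp [sgn]

theorem abs_sgn_mul (b : Bool) (x : ℝ) : |sgn b * x| = |x| := by rw [abs_mul, abs_sgn, one_mul]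

theorem exists_eq_sgn_mul_abs (x : ℝ) : ∃ ε, x = sgn ε * |x| := by
  rcases le_total 0 x with h | h
  · exact ⟨true, by rw [sgn_true, one_mul, abs_of_nonneg h]⟩
  · exact ⟨false, by rw [sgn_false, neg_one_mul, abs_of_nonpos h, neg_neg]⟩

theorem ite_nonneg_eq_of_eq_sgn_mul_abs {Z : Type*} {f : Bool → Z} {x : ℝ} {ε : Bool}
    (hx : x = sgn ε * |x|) (h0 : x = 0 → f true = f false) :
    (if 0 ≤ x then f true else f false) = f ε := by
  split_ifs with h <;> cases ε
  · rw [abs_of_nonneg h, sgn_false] at hx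
    exact h0 (by linarith)
  · rfl
  · rfl
  · rw [sgn_true, one_mul] at hx
    exact absurd (hx ▸ abs_nonneg x) h

namespace VHComplex

open GenSimplicialComplex

variable {X : VHComplex.{u}}

section barWeight

variable {e : X.E}

/-- A corner of the star of `e*` that is not an endpoint of `e`. -/
def NonApex (c : X.StarCorner e) : Prop := ∀ b, c ≠ .apex b

theorem nonApex_square (s : X.S) (i t : Bool) (h : X.side s i t = e) :
    NonApex (.square s i t h) := fun _ => nofun

theorem nonApex_center : NonApex (.center : X.StarCorner e) := fun _ => nofun

/-- The point of the union of the triangles with corners `c`, `e*` and an endpoint of `e` with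
height `y` above `e*` and distance `b` from `c`, where `|y| ≤ b ≤ 1` (other values are clamped). -/
noncomputable def barWeight (c : X.StarCorner e) (hc : NonApex c) (y b : ℝ) :
    Weight (StarCompat (e := e)) where
  val x := by
    classical
    exact (if x = .apex true then max (clamp y (toUnit b)) 0 else 0) +
      (if x = .apex false then max (-clamp y (toUnit b)) 0 else 0) +
      (if x = c then 1 - (toUnit b : ℝ) else 0) +
      (if x = .center then (toUnit b : ℝ) - |clamp y (toUnit b)| else 0)
  nonneg x := by
    have h1 := (toUnit b).2.2
    have h2 := abs_clamp_le y (toUnit b).2.1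
    refine add_nonneg (add_nonneg (add_nonneg ?_ ?_) ?_) ?_ <;> split_ifs <;>
      first | exact le_rfl | exact le_max_right _ _ | linarith
  exists_finset := by
    classical
    refine ⟨{.apex true, .apex false, c, .center}, fun x hx => ?_, ?_⟩
    · simp only [Finset.mem_insert, Finset.mem_singleton, not_or] at hx
      simp [hx]
    · simp only [Finset.sum_add_distrib, Finset.sum_ite_eq', Finset.mem_insert,
        Finset.mem_singleton, true_or, or_true, if_true]
      have habs : max (clamp y (toUnit b)) 0 + max (-clamp y (toUnit b)) 0 =
          |clamp y (toUnit b)| := posPart_add_negPart _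
      linarith
  compat x x' hx hx' := by
    rintro rfl rfl
    simp only [(hc _).symm, reduceCtorEq, if_true, if_false, add_zero, zero_add,
      StarCorner.apex.injEq] at hx hx'
    rcases le_total 0 (clamp y (toUnit b)) with h | h
    · exact hx (max_eq_right (by linarith))
    · exact hx' (max_eq_right (by linarith))

variable (c : X.StarCorner e) (hc : NonApex c) {y b : ℝ}

theorem barWeight_apex (hy : |y| ≤ b) (hb : b ≤ 1) (β : Bool) :
    (barWeight c hc y b).val (.apex β) = max (sgn β * y) 0 := by
  have hB := coe_toUnit ((abs_nonneg y).trans hy) hb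
  cases β <;> simp [barWeight, (hc _).symm, hB, clamp_eq hy, sgn]

theorem barWeight_self (hc' : c ≠ .center) (hb0 : 0 ≤ b) (hb : b ≤ 1) :
    (barWeight c hc y b).val c = 1 - b := by
  simp [barWeight, hc _, coe_toUnit hb0 hb, hc']

theorem barWeight_of_ne {x : X.StarCorner e} (hx : NonApex x) (hx' : x ≠ .center) (hne : x ≠ c) :
    (barWeight c hc y b).val x = 0 := by
  simp [barWeight, hx _, hx', hne]

theorem continuous_barWeight {P : Type*} [TopologicalSpace P] (he : e ∈ X.vertical)
    {y b : P → ℝ} (hy : Continuous y) (hb : Continuous b) :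
    Continuous fun p => (starChart e he).pt (barWeight c hc (y p) (b p)) := by
  classical
  have hB := continuous_coe_toUnit hb
  have hz := continuous_clamp hy hB
  refine (starChart e he).continuous_pt _ {.apex true, .apex false, c, .center}
    (fun p x hx => ?_) fun a _ => ?_
  · simp only [Finset.mem_insert, Finset.mem_singleton, not_or] at hx
    simp [barWeight, hx]
  · refine .add (.add (.add ?_ ?_) ?_) ?_
    · exact continuous_if_const _ (fun _ => hz.max continuous_const) fun _ => continuous_const
    · exact continuous_if_const _ (fun _ => hz.neg.max continuous_const) fun _ => continuous_const
    · exact continuous_if_const _ (fun _ => continuous_const.sub hB) fun _ => continuous_const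
    · exact continuous_if_const _ (fun _ => hB.sub hz.abs) fun _ => continuous_const

theorem barWeight_square_one (s i t h) (hy : |y| ≤ 1) :
    barWeight (.square s i t h : X.StarCorner e) (nonApex_square _ _ _ _) y 1 =
      barWeight .center nonApex_center y 1 := by
  refine Weight.ext_of_ne .center fun x hx => ?_
  cases x with
  | apex β => rw [barWeight_apex _ _ hy le_rfl, barWeight_apex _ _ hy le_rfl]
  | center => exact absurd rfl hx
  | square s' i' t' h' =>
    rw [barWeight_of_ne .center _ (nonApex_square _ _ _ _) hx hx]
    by_cases h : (.square s' i' t' h' : X.StarCorner e) = .square s i t h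
    · rw [h, barWeight_self _ _ (by simp) zero_le_one le_rfl, sub_self]
    · exact barWeight_of_ne _ _ (nonApex_square _ _ _ _) hx h

end barWeight

/-- The point of a triangle at distance `a` from its corner `s*`, with horizontal position `b`,
where `|b| ≤ a ≤ 1` (other values are clamped). -/
noncomputable def triWeight (a b : ℝ) : Weight (AllCompat (α := Option Bool)) where
  val
    | none => 1 - toUnit a
    | some τ => (toUnit a + sgn τ * clamp b (toUnit a)) / 2
  nonneg
    | none => sub_nonneg.2 (toUnit a).2.2
    | some τ => by
      have h := abs_clamp_le b (toUnit a).2.1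
      rw [← abs_sgn_mul τ, abs_le] at h
      linarith
  exists_finset := ⟨Finset.univ, by simp, by
    simp only [Fintype.sum_option, Fintype.sum_bool, sgn_true, sgn_false]
    ring⟩
  compat _ _ _ _ := trivial

theorem triWeight_none {a b : ℝ} (h0 : 0 ≤ a) (h1 : a ≤ 1) : (triWeight a b).val none = 1 - a := by
  simp only [triWeight, coe_toUnit h0 h1]

theorem triWeight_some {a b : ℝ} (hb : |b| ≤ a) (h1 : a ≤ 1) (τ : Bool) :
    (triWeight a b).val (some τ) = (a + sgn τ * b) / 2 := by
  simp only [triWeight, coe_toUnit ((abs_nonneg _).trans hb) h1, clamp_eq hb]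

theorem continuous_triWeight {P : Type*} [TopologicalSpace P] (s : X.S) (i t : Bool)
    (h : X.side s i t ∉ X.vertical) {a b : P → ℝ} (ha : Continuous a) (hb : Continuous b) :
    Continuous fun p => (triChart s i t h).pt (triWeight (a p) (b p)) := by
  have hA := continuous_coe_toUnit ha
  refine (triChart s i t h).continuous_pt _ Finset.univ (by simp) fun x _ => ?_
  cases x with
  | none => exact continuous_const.sub hA
  | some τ => exact (hA.add (continuous_const.mul (continuous_clamp hb hA))).div_const 2

/-- The point of a horizontal edge with coordinate `x`. -/
noncomputable def horWeight (x : I) : Weight (AllCompat (α := Bool)) where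
  val b := if b then x else 1 - x
  nonneg b := by
    split_ifs
    exacts [x.2.1, sub_nonneg.2 x.2.2]
  exists_finset := ⟨Finset.univ, by simp, by simp⟩
  compat _ _ _ _ := trivial

theorem continuous_horWeight (e : X.E) (he : e ∉ X.vertical) :
    Continuous fun x => (horChart e he).pt (horWeight x) :=
  (horChart e he).continuous_pt _ Finset.univ (by simp) fun b _ =>
    continuous_if_const (b = true) (fun _ => continuous_subtype_val) fun _ =>
      continuous_const.sub continuous_subtype_val

/-! ### The triangulation of the square complex -/

theorem exists_horizontal_direction (s : X.S) : ∃ i, ∀ t, X.side s i t ∉ X.vertical := by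
  obtain ⟨i, hi⟩ := exists_vertical_side s
  exact ⟨!i, fun t => (X.alternates s i false t).1 (hi false)⟩

/-- The direction of the horizontal sides of a square. -/
noncomputable def hdir (s : X.S) : Bool := (exists_horizontal_direction s).choose

theorem side_hdir_notMem (s : X.S) (t : Bool) : X.side s (hdir s) t ∉ X.vertical :=
  (exists_horizontal_direction s).choose_spec t

theorem side_not_hdir_mem (s : X.S) (t : Bool) : X.side s (!hdir s) t ∈ X.vertical :=
  side_mem_vertical (side_hdir_notMem s t) t

theorem eq_hdir {s : X.S} {i t : Bool} (h : X.side s i t ∉ X.vertical) : i = hdir s :=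
  (Bool.eq_or_eq_not i (hdir s)).resolve_right fun hi => h (hi ▸ side_not_hdir_mem s t)

theorem eq_not_hdir {s : X.S} {i t : Bool} (h : X.side s i t ∈ X.vertical) : i = !hdir s :=
  (Bool.eq_or_eq_not i (hdir s)).resolve_left fun hi => side_hdir_notMem s t (hi ▸ h)

/-- The part of a square (with vertical and horizontal coordinates `a`, `b` in `[-1, 1]`) near its
horizontal side on the side `ε`. -/
noncomputable def triPart (s : X.S) (ε : Bool) (a b : ℝ) : X.simplexification.Realization :=
  (triChart s (hdir s) ε (side_hdir_notMem s ε)).pt (triWeight |a| b)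

/-- The part of a square (with vertical and horizontal coordinates `a`, `b` in `[-1, 1]`) near its
vertical side on the side `τ`. -/
noncomputable def starPart (s : X.S) (τ : Bool) (a b : ℝ) : X.simplexification.Realization :=
  (starChart _ (side_not_hdir_mem s τ)).pt (barWeight (.square s (!hdir s) τ rfl)
    (nonApex_square _ _ _ _) (sgn (!X.reversed s (!hdir s) τ) * a) |b|)

/-- The point `s*` of the realisation. -/
noncomputable def squarePoint (s : X.S) : X.simplexification.Realization :=
  point (K := X.simplexification) (.square s) (stdSimplex.vertex 0)

theorem starChart_pt_square {e : X.E} (he : e ∈ X.vertical) {w : Weight (StarCompat (e := e))}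
    {s i t h} (hw : w.val (.square s i t h) = 1) : (starChart e he).pt w = squarePoint s :=
  starChart_pt_of_eq_one he hw _

theorem triChart_pt_none (s : X.S) (i t : Bool) (h : X.side s i t ∉ X.vertical)
    {w : Weight AllCompat} (hw : w.val none = 1) : (triChart s i t h).pt w = squarePoint s := by
  rw [triChart_pt_eq_starChart_pt s i t h false w
    (Weight.single (.square s (!i) false rfl) (starCompat_self _))
    (w.eq_zero_of_eq_one hw (by simp))]
  · exact starChart_pt_square _ (Weight.single_apply_self _ _)
  · rw [Weight.single_apply_of_ne _ _ (by simp), w.eq_zero_of_eq_one hw (by simp)]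
  · rw [Weight.single_apply_self, hw]

theorem triPart_zero (s : X.S) (ε : Bool) (b : ℝ) : triPart s ε 0 b = squarePoint s :=
  triChart_pt_none _ _ _ _ (by rw [abs_zero, triWeight_none le_rfl zero_le_one, sub_zero])

theorem starPart_zero (s : X.S) (τ : Bool) (a : ℝ) : starPart s τ a 0 = squarePoint s :=
  starChart_pt_square _
    (by rw [abs_zero, barWeight_self _ _ (by simp) le_rfl zero_le_one, sub_zero])

theorem triPart_eq_starPart (s : X.S) {ε τ : Bool} {a b : ℝ} (h : |b| = |a|) (ha : |a| ≤ 1)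
    (hε : a = sgn ε * |a|) (hτ : b = sgn τ * |b|) : triPart s ε a b = starPart s τ a b := by
  have hb : |b| ≤ 1 := h.le.trans ha
  have hy : |sgn (!X.reversed s (!hdir s) τ) * a| ≤ |b| := by rw [abs_sgn_mul, h]
  refine triChart_pt_eq_starChart_pt _ _ _ _ τ _ _ ?_ ?_ ?_
  · rw [triWeight_some h.le ha, hτ, h]
    cases τ <;> simp [sgn]
  · rw [triWeight_some h.le ha, barWeight_apex _ _ hy hb, hε, hτ, h]
    cases X.reversed s (!hdir s) τ <;> cases ε <;> cases τ <;> simp [sgn]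
  · rw [triWeight_none (abs_nonneg a) ha, barWeight_self _ _ (by simp) (abs_nonneg b) hb, h]

/-- The map from a square, with vertical and horizontal coordinates in `[-1, 1]`, to the
simplexification. -/
noncomputable def squareMap (s : X.S) (a b : ℝ) : X.simplexification.Realization :=
  if |b| ≤ |a| then (if 0 ≤ a then triPart s true a b else triPart s false a b)
  else (if 0 ≤ b then starPart s true a b else starPart s false a b)

theorem ite_triPart (s : X.S) {ε : Bool} {a b : ℝ} (h : a = sgn ε * |a|) :
    (if 0 ≤ a then triPart s true a b else triPart s false a b) = triPart s ε a b :=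
  ite_nonneg_eq_of_eq_sgn_mul_abs (f := fun ε => triPart s ε a b) h fun h0 => by
    simp only [h0, triPart_zero]

theorem ite_starPart (s : X.S) {τ : Bool} {a b : ℝ} (h : b = sgn τ * |b|) :
    (if 0 ≤ b then starPart s true a b else starPart s false a b) = starPart s τ a b :=
  ite_nonneg_eq_of_eq_sgn_mul_abs (f := fun τ => starPart s τ a b) h fun h0 => by
    simp only [h0, starPart_zero]

theorem squareMap_of_le (s : X.S) {ε : Bool} {a b : ℝ} (h : |b| ≤ |a|) (hε : a = sgn ε * |a|) :
    squareMap s a b = triPart s ε a b := by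
  rw [squareMap, if_pos h, ite_triPart s hε]

theorem squareMap_of_ge (s : X.S) {τ : Bool} {a b : ℝ} (h : |a| ≤ |b|) (hb : |b| ≤ 1)
    (hτ : b = sgn τ * |b|) : squareMap s a b = starPart s τ a b := by
  by_cases h' : |b| ≤ |a|
  · obtain ⟨ε, hε⟩ := exists_eq_sgn_mul_abs a
    rw [squareMap_of_le s h' hε, triPart_eq_starPart s (h'.antisymm h) (h.trans hb) hε hτ]
  · rw [squareMap, if_neg h', ite_starPart s hτ]

theorem continuous_squareMap {P : Type*} [TopologicalSpace P] (s : X.S) {a b : P → ℝ}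
    (ha : Continuous a) (hb : Continuous b) (ha1 : ∀ p, |a p| ≤ 1) :
    Continuous fun p => squareMap s (a p) (b p) := by
  have htri (ε) : Continuous fun p => triPart s ε (a p) (b p) :=
    continuous_triWeight s _ ε _ ha.abs hb
  have hstar (τ) : Continuous fun p => starPart s τ (a p) (b p) :=
    continuous_barWeight _ _ _ (continuous_const.mul ha) hb.abs
  refine Continuous.if_le ?_ ?_ hb.abs ha.abs fun p hp => ?_
  · refine Continuous.if_le (htri _) (htri _) continuous_const ha fun p hp => ?_
    rw [← hp, triPart_zero, triPart_zero]
  · refine Continuous.if_le (hstar _) (hstar _) continuous_const hb fun p hp => ?_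
    rw [← hp, starPart_zero, starPart_zero]
  · obtain ⟨ε, hε⟩ := exists_eq_sgn_mul_abs (a p)
    obtain ⟨τ, hτ⟩ := exists_eq_sgn_mul_abs (b p)
    rw [ite_triPart s hε, ite_starPart s hτ]
    exact triPart_eq_starPart s hp (ha1 p) hε hτ

/-- The map from an edge to the simplexification. -/
noncomputable def edgeMap (e : X.E) (x : I) : X.simplexification.Realization := by
  classical
  exact if he : e ∈ X.vertical then
      (starChart e he).pt (barWeight .center nonApex_center (2 * x - 1) 1)
    else (horChart e he).pt (horWeight x)

theorem continuous_edgeMap (e : X.E) : Continuous (edgeMap e) := by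
  unfold edgeMap
  split_ifs with he
  · exact continuous_barWeight _ _ he (by fun_prop) continuous_const
  · exact continuous_horWeight e he

theorem abs_two_mul_sub_one_le (x : I) : |2 * (x : ℝ) - 1| ≤ 1 := by
  rw [abs_le]
  constructor <;> linarith [x.2.1, x.2.2]

theorem two_mul_endPt_sub_one (b : Bool) : 2 * (SquareComplex.endPt b : ℝ) - 1 = sgn b := by
  cases b <;> simp only [SquareComplex.endPt, sgn, Icc.coe_zero, Icc.coe_one, if_true,
    Bool.false_eq_true, if_false] <;> norm_num

/-- The map from the disjoint union of the cells of the square complex to the simplexification. -/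
noncomputable def cellMap : X.toSquareComplex.Cells → X.simplexification.Realization
  | .inl ⟨v, _⟩ => vertPoint v
  | .inr (.inl ⟨e, x⟩) => edgeMap e x
  | .inr (.inr ⟨s, x⟩) => squareMap s (2 * x (!hdir s) - 1) (2 * x (hdir s) - 1)

theorem edgeMap_endPt (e : X.E) (b : Bool) :
    edgeMap e (SquareComplex.endPt b) = vertPoint (X.ends e b) := by
  rw [edgeMap]
  split_ifs with he
  · refine starChart_pt_apex he (b := b) ?_
    rw [barWeight_apex _ _ (abs_two_mul_sub_one_le _) le_rfl, two_mul_endPt_sub_one]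
    cases b <;> simp [sgn]
  · refine horChart_pt_of_eq_one he (b := b) ?_
    cases b <;> simp [horWeight, SquareComplex.endPt]

theorem squareMap_vertical_side (s : X.S) (t : Bool) (x : I) :
    squareMap s (2 * x - 1) (sgn t) = edgeMap (X.side s (!hdir s) t)
      (if X.reversed s (!hdir s) t then unitInterval.symm x else x) := by
  have hx := abs_two_mul_sub_one_le x
  rw [squareMap_of_ge s (by rwa [abs_sgn]) (abs_sgn t).le (by rw [abs_sgn, mul_one]), starPart,
    edgeMap, dif_pos (side_not_hdir_mem s t), abs_sgn,
    barWeight_square_one _ _ _ _ (by rwa [abs_sgn_mul])]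
  congr 2
  cases X.reversed s (!hdir s) t
  · simp [sgn]
  · simp only [Bool.not_true, sgn_false, if_true, unitInterval.coe_symm_eq]
    ring

theorem squareMap_horizontal_side (s : X.S) (t : Bool) (x : I) :
    squareMap s (sgn t) (2 * x - 1) = edgeMap (X.side s (hdir s) t)
      (if X.reversed s (hdir s) t then unitInterval.symm x else x) := by
  have hx := abs_two_mul_sub_one_le x
  rw [squareMap_of_le s (by rwa [abs_sgn]) (by rw [abs_sgn, mul_one]), triPart, edgeMap,
    dif_neg (side_hdir_notMem s t), abs_sgn]
  refine triChart_pt_eq_horChart_pt _ _ _ _ _ _ ?_ fun a => ?_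
  · rw [triWeight_none zero_le_one le_rfl, sub_self]
  · rw [triWeight_some hx le_rfl]
    cases X.reversed s (hdir s) t <;> cases a <;> simp [horWeight, sgn] <;> ring

theorem cellMap_glue {p q : X.toSquareComplex.Cells} (h : X.toSquareComplex.Glue p q) :
    cellMap p = cellMap q := by
  cases h with
  | ends e b => exact edgeMap_endPt e b
  | side s i t x =>
    change squareMap s _ _ = edgeMap _ _
    by_cases hi : X.side s i t ∈ X.vertical
    · obtain rfl := eq_not_hdir hi
      simp only [if_true, Bool.eq_not_self, if_false, two_mul_endPt_sub_one]
      exact squareMap_vertical_side s t x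
    · obtain rfl := eq_hdir hi
      simp only [if_true, Bool.not_eq_self, if_false, two_mul_endPt_sub_one]
      exact squareMap_horizontal_side s t x

/-- The map from a `VH`-complex to its simplexification that subdivides the vertical edges and the
squares. -/
noncomputable def subdivide : C(X.toSquareComplex.Realization, X.simplexification.Realization) where
  toFun := Quot.lift cellMap fun _ _ h => cellMap_glue h
  continuous_toFun := by
    refine continuous_quot_lift _ (continuous_sum_dom.2 ⟨continuous_sigma fun v => continuous_const,
      continuous_sum_dom.2 ⟨continuous_sigma continuous_edgeMap, continuous_sigma fun s => ?_⟩⟩)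
    exact continuous_squareMap s (by fun_prop) (by fun_prop) fun x => abs_two_mul_sub_one_le _

/-! ### The retraction of the simplexification -/

section retract

variable {e : X.E} (w : Weight (StarCompat (e := e)))

/-- The total weight of the squares adjacent to `e`. -/
noncomputable def squareSum : ℝ :=
  1 - w.val .center - w.val (.apex false) - w.val (.apex true)

/-- The height of a point of the star of `e*` above `e*`, which is `±1` at the endpoints of `e`. -/
noncomputable def height : ℝ := w.val (.apex true) - w.val (.apex false)

/-- The amount by which the weight of a square exceeds that of all other squares together; it is
set to `0` for the other corners of the star. -/
noncomputable def excess (c : X.StarCorner e) : ℝ :=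
  match c with
  | .square _ _ _ _ => 2 * w.val c - squareSum w
  | _ => 0

theorem excess_square (s i t h) :
    excess w (.square s i t h) = 2 * w.val (.square s i t h) - squareSum w := rfl

theorem squareSum_nonneg : 0 ≤ squareSum w := by
  classical
  have := w.sum_le_one {.center, .apex false, .apex true}
  rw [Finset.sum_insert (by simp), Finset.sum_pair (by simp)] at this
  rw [squareSum]
  linarith

theorem val_le_squareSum (s i t h) : w.val (.square s i t h) ≤ squareSum w := by
  classical
  have := w.sum_le_one {.square s i t h, .center, .apex false, .apex true}
  rw [Finset.sum_insert (by simp), Finset.sum_insert (by simp), Finset.sum_pair (by simp)] at this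
  rw [squareSum]
  linarith

theorem val_add_val_le_squareSum {s i t h s' i' t' h'}
    (hne : (.square s i t h : X.StarCorner e) ≠ .square s' i' t' h') :
    w.val (.square s i t h) + w.val (.square s' i' t' h') ≤ squareSum w := by
  classical
  have := w.sum_le_one {.square s i t h, .square s' i' t' h', .center, .apex false, .apex true}
  rw [Finset.sum_insert (by simpa using hne), Finset.sum_insert (by simp),
    Finset.sum_insert (by simp), Finset.sum_pair (by simp)] at this
  rw [squareSum]
  linarith

theorem excess_square_eq_val {s i t h}
    (hw : ∀ s' i' t' h', (.square s' i' t' h' : X.StarCorner e) ≠ .square s i t h →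
      w.val (.square s' i' t' h') = 0) :
    excess w (.square s i t h) = w.val (.square s i t h) := by
  classical
  have hsum := w.sum_eq_one (s := {.square s i t h, .center, .apex false, .apex true}) (by
    rintro (b | _ | ⟨s', i', t', h'⟩) hd
    · cases b <;> simp at hd
    · simp at hd
    · exact hw _ _ _ _ fun hd' => hd (by simp [hd']))
  rw [Finset.sum_insert (by simp), Finset.sum_insert (by simp), Finset.sum_pair (by simp)] at hsum
  rw [excess_square, squareSum]
  linarith

theorem excess_le_val (c : X.StarCorner e) : excess w c ≤ w.val c := by
  cases c with
  | apex b => exact w.nonneg _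
  | center => exact w.nonneg _
  | square s i t h =>
    rw [excess_square]
    linarith [val_le_squareSum w s i t h]

theorem height_eq_sgn_mul {β : Bool} (h : w.val (.apex (!β)) = 0) :
    height w = sgn β * w.val (.apex β) := by
  cases β <;> simp_all [height, sgn]

theorem exists_val_apex_eq_zero : ∃ β, w.val (.apex (!β)) = 0 := by
  by_contra! h
  exact w.compat _ _ (h true) (h false) rfl rfl

theorem max_sgn_mul_height (β : Bool) : max (sgn β * height w) 0 = w.val (.apex β) := by
  have hn := w.nonneg (.apex β)
  obtain ⟨β', h⟩ := exists_val_apex_eq_zero w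
  rw [height_eq_sgn_mul w h]
  rcases Bool.eq_or_eq_not β β' with rfl | rfl
  · cases β <;> simpa [sgn] using hn
  · have hn' := w.nonneg (.apex β')
    rw [h]
    cases β' <;> simpa [sgn] using hn'

theorem abs_height : |height w| = w.val (.apex false) + w.val (.apex true) := by
  obtain ⟨β, h⟩ := exists_val_apex_eq_zero w
  rw [height_eq_sgn_mul w h, abs_sgn_mul, abs_of_nonneg (w.nonneg _)]
  cases β <;> simp_all

theorem abs_height_le (c : X.StarCorner e) : |height w| ≤ 1 - excess w c := by
  have hS := squareSum_nonneg w
  have hC := w.nonneg .center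
  have hsum : |height w| + squareSum w ≤ 1 := by
    rw [abs_height, squareSum]
    linarith
  cases c with
  | apex b => exact (by linarith : |height w| ≤ 1 - 0)
  | center => exact (by linarith : |height w| ≤ 1 - 0)
  | square s i t h =>
    rw [excess_square]
    linarith [val_le_squareSum w s i t h]

theorem abs_height_le_one : |height w| ≤ 1 := by
  simpa [excess] using abs_height_le w .center

theorem excess_nonpos_of_ne {s i t h} (h0 : 0 ≤ excess w (.square s i t h)) {d : X.StarCorner e}
    (hd : d ≠ .square s i t h) : excess w d ≤ 0 := by
  cases d with
  | apex b => exact le_rfl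
  | center => exact le_rfl
  | square s' i' t' h' =>
    have := val_add_val_le_squareSum w hd
    rw [excess_square] at h0 ⊢
    linarith

/-- The square of positive excess, or `e*` if there is none. -/
noncomputable def dominant : X.StarCorner e := by
  classical
  exact if h : ∃ c, 0 < excess w c then h.choose else .center

theorem dominant_eq_center_or_excess_pos :
    (dominant w = .center ∧ ∀ c, excess w c ≤ 0) ∨ 0 < excess w (dominant w) := by
  unfold dominant
  split_ifs with h
  · exact .inr h.choose_spec
  · exact .inl ⟨rfl, by simpa using h⟩

theorem excess_dominant_nonneg : 0 ≤ excess w (dominant w) := by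
  rcases dominant_eq_center_or_excess_pos w with ⟨h, -⟩ | h
  · rw [h]
    rfl
  · exact h.le

theorem excess_nonpos_of_ne_dominant {c : X.StarCorner e} (hc : c ≠ dominant w) :
    excess w c ≤ 0 := by
  rcases dominant_eq_center_or_excess_pos w with ⟨-, h⟩ | h
  · exact h c
  · cases hd : dominant w with
    | square s i t h' =>
      rw [hd] at h hc
      exact excess_nonpos_of_ne w h.le hc
    | _ => exact absurd h (by rw [hd]; exact lt_irrefl _)

theorem dominant_eq_of_excess_pos {c : X.StarCorner e} (hc : 0 < excess w c) : dominant w = c := by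
  by_contra h
  exact absurd hc (excess_nonpos_of_ne_dominant w (Ne.symm h)).not_gt

theorem nonApex_dominant : NonApex (dominant w) := by
  rcases dominant_eq_center_or_excess_pos w with ⟨h, -⟩ | h
  · exact h ▸ nonApex_center
  · rintro b hb
    rw [hb] at h
    exact lt_irrefl _ h

/-- The retraction of the star of `e*` onto the union of the triangles in it that come from the
squares. It keeps the height of a point. -/
noncomputable def retract : Weight (StarCompat (e := e)) :=
  barWeight (dominant w) (nonApex_dominant w) (height w) (1 - excess w (dominant w))

theorem retract_apex (b : Bool) : (retract w).val (.apex b) = w.val (.apex b) := by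
  rw [retract, barWeight_apex _ _ (abs_height_le w _) (by linarith [excess_dominant_nonneg w]),
    max_sgn_mul_height]

theorem retract_square (s i t h) :
    (retract w).val (.square s i t h) = max 0 (excess w (.square s i t h)) := by
  by_cases hd : .square s i t h = dominant w
  · have hself := barWeight_self (dominant w) (nonApex_dominant w) (y := height w)
      (by simp [← hd])
      ((abs_nonneg _).trans (abs_height_le w (dominant w)))
      (by linarith [excess_dominant_nonneg w])
    rw [← retract, sub_sub_cancel] at hself
    rw [hd, hself, max_eq_right (excess_dominant_nonneg w)]
  · rw [retract, barWeight_of_ne _ _ (nonApex_square _ _ _ _) (by simp) hd,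
      max_eq_left (excess_nonpos_of_ne_dominant w hd)]

theorem retract_eq_self (c : X.StarCorner e)
    (hw : ∀ s i t h, .square s i t h ≠ c → w.val (.square s i t h) = 0) : retract w = w := by
  refine Weight.ext_of_ne .center fun d hd => ?_
  cases d with
  | apex b => exact retract_apex w b
  | center => exact absurd rfl hd
  | square s i t h =>
    rw [retract_square]
    by_cases hdc : .square s i t h = c
    · rw [excess_square_eq_val w (hdc ▸ hw), max_eq_right (w.nonneg _)]
    · rw [hw _ _ _ _ hdc]
      exact max_eq_left ((excess_le_val w _).trans_eq (hw _ _ _ _ hdc))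

theorem retract_eq_self_of_eq_one {c : X.StarCorner e} (hc : w.val c = 1) : retract w = w :=
  retract_eq_self w c fun _ _ _ _ hd => w.eq_zero_of_eq_one hc hd

theorem retract_eq_zero {c : X.StarCorner e} (hc : c ≠ .center) (hw : w.val c = 0) :
    (retract w).val c = 0 := by
  cases c with
  | apex b => rw [retract_apex, hw]
  | center => exact absurd rfl hc
  | square s i t h => rw [retract_square, max_eq_left (hw ▸ excess_le_val w _)]

theorem retract_compat (a b : X.StarCorner e) (ha : w.val a ≠ 0 ∨ (retract w).val a ≠ 0)
    (hb : w.val b ≠ 0 ∨ (retract w).val b ≠ 0) : StarCompat a b := by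
  rintro rfl rfl
  simp only [retract_apex, or_self] at ha hb
  exact w.compat _ _ ha hb rfl rfl

end retract

section continuity

variable {e : X.E} {P : Type*} [TopologicalSpace P] {F : P → Weight (StarCompat (e := e))}
  (hF : ∀ c, Continuous fun p => (F p).val c)
include hF

theorem continuous_height : Continuous fun p => height (F p) := (hF _).sub (hF _)

theorem continuous_excess (c : X.StarCorner e) : Continuous fun p => excess (F p) c := by
  cases c with
  | square s i t h =>
    exact (continuous_const.mul (hF _)).sub
      (((continuous_const.sub (hF _)).sub (hF _)).sub (hF _))
  | _ => exact continuous_const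

theorem continuous_val_retract {c : X.StarCorner e} (hc : c ≠ .center) :
    Continuous fun p => (retract (F p)).val c := by
  cases c with
  | apex b => simpa only [retract_apex] using hF _
  | center => exact absurd rfl hc
  | square s i t h =>
    simp only [retract_square]
    exact continuous_const.max (continuous_excess hF _)

end continuity

/-- A point of an edge, in the realisation. -/
noncomputable def edgePoint (e : X.E) (x : I) : X.toSquareComplex.Realization :=
  Quot.mk _ (X.edgePt e x)

/-- A point of a square, in the realisation. -/
noncomputable def sqPoint (s : X.S) (x : Bool → I) : X.toSquareComplex.Realization :=
  Quot.mk _ (X.squarePt s x)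

theorem edgePoint_endPt (e : X.E) (b : Bool) :
    edgePoint e (SquareComplex.endPt b) = Quot.mk _ (.inl ⟨X.ends e b, ()⟩) :=
  Quot.sound (.ends e b)

theorem sqPoint_side (s : X.S) (i t : Bool) (x : I) :
    sqPoint s (fun j => if j = i then x else SquareComplex.endPt t) =
      edgePoint (X.side s i t) (if X.reversed s i t then unitInterval.symm x else x) :=
  Quot.sound (.side s i t x)

theorem continuous_edgePoint (e : X.E) : Continuous (edgePoint e) :=
  continuous_quot_mk.comp (continuous_inr.comp (continuous_inl.comp continuous_sigmaMk))

theorem continuous_sqPoint (s : X.S) : Continuous (sqPoint s) :=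
  continuous_quot_mk.comp (continuous_inr.comp (continuous_inr.comp continuous_sigmaMk))

/-- The point of a vertical edge at height `y`, or of an adjacent square at height `y` and at
distance `b` from the vertical middle line. -/
noncomputable def cornerPoint {e : X.E} (c : X.StarCorner e) (y b : ℝ) :
    X.toSquareComplex.Realization :=
  match c with
  | .square s i t _ => sqPoint s fun j =>
      if j = i then toUnit ((1 + if X.reversed s i t then -y else y) / 2)
      else toUnit ((1 + sgn t * b) / 2)
  | _ => edgePoint e (toUnit ((1 + y) / 2))

theorem toUnit_sgn (t : Bool) : toUnit ((1 + sgn t) / 2) = SquareComplex.endPt t := by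
  ext
  rw [coe_toUnit] <;> cases t <;> norm_num [sgn, SquareComplex.endPt]

theorem symm_toUnit {y : ℝ} (hy : |y| ≤ 1) :
    unitInterval.symm (toUnit ((1 + y) / 2)) = toUnit ((1 - y) / 2) := by
  rw [abs_le] at hy
  ext
  rw [unitInterval.coe_symm_eq, coe_toUnit, coe_toUnit] <;> linarith

theorem two_mul_toUnit_sub_one {z : ℝ} (hz : |z| ≤ 1) : 2 * (toUnit ((1 + z) / 2) : ℝ) - 1 = z := by
  rw [abs_le] at hz
  rw [coe_toUnit (by linarith) (by linarith)]
  ring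

theorem cornerPoint_square {e : X.E} (s i t) (h : X.side s i t = e) (y b : ℝ) :
    cornerPoint (.square s i t h) y b = sqPoint s fun j =>
      if j = i then toUnit ((1 + if X.reversed s i t then -y else y) / 2)
      else toUnit ((1 + sgn t * b) / 2) := rfl

theorem cornerPoint_one {e : X.E} (c : X.StarCorner e) {y : ℝ} (hy : |y| ≤ 1) :
    cornerPoint c y 1 = edgePoint e (toUnit ((1 + y) / 2)) := by
  cases c with
  | apex b => rfl
  | center => rfl
  | square s i t h =>
    rw [cornerPoint_square, mul_one, toUnit_sgn, sqPoint_side, h]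
    congr 1
    split_ifs
    · rw [symm_toUnit (by rwa [abs_neg]), sub_neg_eq_add]
    · rfl

theorem continuous_toUnit : Continuous toUnit := continuous_projIcc

theorem continuous_cornerPoint {e : X.E} (c : X.StarCorner e) {P : Type*} [TopologicalSpace P]
    {y b : P → ℝ} (hy : Continuous y) (hb : Continuous b) :
    Continuous fun p => cornerPoint c (y p) (b p) := by
  cases c with
  | square s i t h =>
    refine (continuous_sqPoint s).comp (continuous_pi fun j => ?_)
    split_ifs
    · exact continuous_toUnit.comp ((continuous_const.add hy.neg).div_const 2)
    · exact continuous_toUnit.comp ((continuous_const.add hy).div_const 2)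
    · exact continuous_toUnit.comp ((continuous_const.add (continuous_const.mul hb)).div_const 2)
  | _ =>
    exact (continuous_edgePoint e).comp
      (continuous_toUnit.comp ((continuous_const.add hy).div_const 2))

/-- The map from the star of `e*` to the square complex, which sends a point to the square that is
dominant at it. -/
noncomputable def starRetract {e : X.E} (w : Weight (StarCompat (e := e))) :
    X.toSquareComplex.Realization :=
  cornerPoint (dominant w) (height w) (1 - excess w (dominant w))

theorem starRetract_eq_cornerPoint {e : X.E} (w : Weight (StarCompat (e := e)))
    (c : X.StarCorner e) (h : ∀ d, d ≠ c → excess w d ≤ 0) :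
    starRetract w = cornerPoint c (height w) (1 - max 0 (excess w c)) := by
  rcases lt_or_ge 0 (excess w c) with hc | hc
  · rw [starRetract, dominant_eq_of_excess_pos w hc, max_eq_right hc.le]
  · have hdom : excess w (dominant w) = 0 := by
      refine le_antisymm ?_ (excess_dominant_nonneg w)
      rcases eq_or_ne (dominant w) c with hd | hd
      exacts [hd ▸ hc, h _ hd]
    rw [starRetract, hdom, max_eq_left hc, sub_zero, cornerPoint_one _ (abs_height_le_one w),
      cornerPoint_one _ (abs_height_le_one w)]

theorem starRetract_of_square_eq_zero {e : X.E} (w : Weight (StarCompat (e := e)))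
    (hw : ∀ s i t h, w.val (.square s i t h) = 0) :
    starRetract w = edgePoint e (toUnit ((1 + height w) / 2)) := by
  refine starRetract_eq_cornerPoint w .center fun d _ => ?_
  cases d with
  | square s i t h => exact (excess_le_val w _).trans_eq (hw s i t h)
  | _ => exact le_rfl

theorem starRetract_of_nonneg {e : X.E} (w : Weight (StarCompat (e := e))) {s i t h}
    (h0 : 0 ≤ excess w (.square s i t h)) :
    starRetract w = cornerPoint (.square s i t h) (height w) (1 - excess w (.square s i t h)) := by
  rw [starRetract_eq_cornerPoint w _ fun _ => excess_nonpos_of_ne w h0, max_eq_right h0]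

-- The dominant corner is locally constant away from the points of zero excess, so the set where a
-- given corner may be used in its place is closed, and finitely many of these sets suffice.
theorem continuous_starRetract {e : X.E} {P : Type*} [TopologicalSpace P]
    {F : P → Weight (StarCompat (e := e))} (s : Finset (X.StarCorner e))
    (hs : ∀ p, ∀ a ∉ s, (F p).val a = 0) (hF : ∀ c, Continuous fun p => (F p).val c) :
    Continuous fun p => starRetract (F p) := by
  classical
  refine (locallyFinite_of_finite fun c : (insert .center s : Finset (X.StarCorner e)) =>
    {p | ∀ d, d ≠ c.1 → excess (F p) d ≤ 0}).continuous ?_ (fun c => ?_) fun c => ?_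
  · refine iUnion_eq_univ_iff.2 fun p => ⟨⟨dominant (F p), ?_⟩, fun d =>
      excess_nonpos_of_ne_dominant _⟩
    rcases dominant_eq_center_or_excess_pos (F p) with ⟨h, -⟩ | h
    · exact h ▸ Finset.mem_insert_self _ _
    · refine Finset.mem_insert_of_mem (by_contra fun hd => ?_)
      exact (h.trans_le (excess_le_val _ _)).ne' (hs p _ hd)
  · simp only [ofPred_forall]
    exact isClosed_iInter fun d => isClosed_iInter fun _ =>
      isClosed_le (continuous_excess hF d) continuous_const
  · exact ContinuousOn.congr (continuous_cornerPoint c.1 (continuous_height hF)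
      (continuous_const.sub (continuous_const.max (continuous_excess hF c.1)))).continuousOn
      fun p hp => starRetract_eq_cornerPoint _ _ hp

theorem starRetract_of_apex_eq_one {e : X.E} {w : Weight (StarCompat (e := e))} {b : Bool}
    (hw : w.val (.apex b) = 1) : starRetract w = Quot.mk _ (.inl ⟨X.ends e b, ()⟩) := by
  rw [starRetract_of_square_eq_zero w fun _ _ _ _ => w.eq_zero_of_eq_one hw (by simp),
    height_eq_sgn_mul w (β := b) (w.eq_zero_of_eq_one hw (by simp)), hw, mul_one, toUnit_sgn,
    edgePoint_endPt]

theorem starRetract_of_center_eq_one {e : X.E} {w : Weight (StarCompat (e := e))}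
    (hw : w.val .center = 1) : starRetract w = edgePoint e (toUnit (1 / 2)) := by
  rw [starRetract_of_square_eq_zero w fun _ _ _ _ => w.eq_zero_of_eq_one hw (by simp), height,
    w.eq_zero_of_eq_one hw (by simp), w.eq_zero_of_eq_one hw (by simp), sub_zero, add_zero]

theorem starRetract_of_square_eq_one {e : X.E} {w : Weight (StarCompat (e := e))} {s i t h}
    (hw : w.val (.square s i t h) = 1) : starRetract w = sqPoint s fun _ => toUnit (1 / 2) := by
  have hE : excess w (.square s i t h) = 1 := by
    rw [excess_square_eq_val w fun _ _ _ _ => w.eq_zero_of_eq_one hw, hw]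
  have hY : height w = 0 := by
    rw [height, w.eq_zero_of_eq_one hw (by simp), w.eq_zero_of_eq_one hw (by simp), sub_zero]
  rw [starRetract_of_nonneg w (hE ▸ zero_le_one), hE, hY]
  simp [cornerPoint_square]

section triangle

variable (w : Weight (AllCompat (α := Option Bool)))

theorem val_none_add_val_some : w.val none + w.val (some false) + w.val (some true) = 1 := by
  have := w.sum_eq_one (s := Finset.univ) (by simp)
  rw [Fintype.sum_option, Fintype.sum_bool] at this
  linarith

theorem val_none_add_val_some_of_eq_zero {a : Bool} (h0 : w.val (some (!a)) = 0) :
    w.val none + w.val (some a) = 1 := by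
  have := val_none_add_val_some w
  cases a <;> simp only [Bool.not_false, Bool.not_true] at h0 <;> linarith

theorem abs_val_some_sub_val_some_le :
    |w.val (some true) - w.val (some false)| ≤ 1 - w.val none := by
  have := val_none_add_val_some w
  rw [abs_le]
  constructor <;> linarith [w.nonneg (some true), w.nonneg (some false)]

theorem triWeight_eq_self :
    triWeight (1 - w.val none) (w.val (some true) - w.val (some false)) = w := by
  have hsum := val_none_add_val_some w
  have hle := sub_le_self 1 (w.nonneg none)
  have hb := abs_val_some_sub_val_some_le w
  ext x
  rcases x with _ | _ | _
  · rw [triWeight_none ((abs_nonneg _).trans hb) hle, sub_sub_cancel]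
  · rw [triWeight_some hb hle, sgn_false]
    linarith
  · rw [triWeight_some hb hle, sgn_true]
    linarith

/-- The point of a square with given barycentric coordinates in the triangle with corner `s*` and
opposite side `side s i t`. -/
noncomputable def trianglePoint (s : X.S) (i t : Bool) : X.toSquareComplex.Realization :=
  sqPoint s fun j =>
    if j = i then toUnit ((1 + (w.val (some true) - w.val (some false))) / 2)
    else toUnit ((1 + sgn t * (1 - w.val none)) / 2)

theorem trianglePoint_eq_edgePoint (s : X.S) (i t : Bool) (w' : Weight (AllCompat (α := Bool)))
    (h0 : w.val none = 0) (hends : ∀ a, w'.val (a ^^ X.reversed s i t) = w.val (some a)) :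
    trianglePoint w s i t = edgePoint (X.side s i t) (toUnit (w'.val true)) := by
  have hsum := val_none_add_val_some w
  have hhalf : (1 + (w.val (some true) - w.val (some false))) / 2 = w.val (some true) := by linarith
  rw [trianglePoint, h0, sub_zero, mul_one, toUnit_sgn, hhalf, sqPoint_side]
  congr 1
  split_ifs with hr
  · have hf := hends false
    rw [hr, Bool.false_xor] at hf
    ext
    rw [hf, unitInterval.coe_symm_eq, coe_toUnit (w.nonneg _) (w.le_one _),
      coe_toUnit (w.nonneg _) (w.le_one _)]
    linarith
  · have ht := hends true
    rw [Bool.eq_false_of_not_eq_true hr, Bool.xor_false] at ht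
    rw [ht]

variable {w} {s : X.S} {i t a : Bool} {w' : Weight (StarCompat (X := X) (e := X.side s (!i) a))}
  (h0 : w.val (some (!a)) = 0)
  (hapex : w'.val (.apex (t ^^ X.reversed s (!i) a)) = w.val (some a))
  (hsquare : w'.val (.square s (!i) a rfl) = w.val none)
include h0 hapex hsquare

theorem val_eq_zero_of_triangle {d : X.StarCorner (X.side s (!i) a)} (hd : d ≠ .square s (!i) a rfl)
    (hd' : d ≠ .apex (t ^^ X.reversed s (!i) a)) : w'.val d = 0 := by
  classical
  refine w'.eq_zero_of_sum_eq_one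
    (s := {.square s (!i) a rfl, .apex (t ^^ X.reversed s (!i) a)}) ?_ (by simp [hd, hd'])
  rw [Finset.sum_pair (by simp), hapex, hsquare, val_none_add_val_some_of_eq_zero w h0]

theorem retract_eq_self_of_triangle : retract w' = w' :=
  retract_eq_self w' _ fun _ _ _ _ hd => val_eq_zero_of_triangle h0 hapex hsquare hd (by simp)

theorem starRetract_eq_trianglePoint : starRetract w' = trianglePoint w s i t := by
  have hE : excess w' (.square s (!i) a rfl) = w.val none := by
    rw [excess_square_eq_val w' fun _ _ _ _ hd =>
      val_eq_zero_of_triangle h0 hapex hsquare hd (by simp), hsquare]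
  have hY : height w' = sgn (t ^^ X.reversed s (!i) a) * w.val (some a) := by
    rw [← hapex]
    exact height_eq_sgn_mul w' (val_eq_zero_of_triangle h0 hapex hsquare (by simp) (by simp))
  rw [starRetract_of_nonneg w' (hE ▸ w.nonneg _), hE, hY, cornerPoint_square, trianglePoint,
    ← val_none_add_val_some_of_eq_zero w h0, add_sub_cancel_left]
  congr 1
  funext j
  rcases Bool.eq_or_eq_not j i with rfl | rfl
  · have hb : sgn a * w.val (some a) = w.val (some true) - w.val (some false) := by
      cases a <;> simp_all [sgn]
    simp only [Bool.eq_not_self, if_true, if_false, hb,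
      val_none_add_val_some_of_eq_zero w h0]
  · simp only [if_true, Bool.not_eq_self, if_false, val_none_add_val_some_of_eq_zero w h0]
    cases X.reversed s (!i) a <;> cases t <;> simp [sgn]

end triangle

/-- The retraction of the simplexification to the square complex, on the charts. -/
noncomputable def retractMaps (X : VHComplex.{u}) : ChartMaps X X.toSquareComplex.Realization where
  onVert v := Quot.mk _ (.inl ⟨v, ()⟩)
  onEdge e _ := edgePoint e (toUnit (1 / 2))
  onSquare s := sqPoint s fun _ => toUnit (1 / 2)
  onHor e _ w := edgePoint e (toUnit (w.val true))
  onTri s i t _ w := trianglePoint w s i t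
  onStar _ _ w := starRetract w
  continuous_onHor e _ _ f hf :=
    (continuous_edgePoint e).comp (continuous_toUnit.comp (Weight.continuous_push f hf true))
  continuous_onTri s i t _ _ f hf := by
    have hp := Weight.continuous_push (c := AllCompat) f hf
    refine (continuous_sqPoint s).comp (continuous_pi fun j => ?_)
    split_ifs
    · exact continuous_toUnit.comp
        ((continuous_const.add ((hp (some true)).sub (hp (some false)))).div_const 2)
    · exact continuous_toUnit.comp ((continuous_const.add
        (continuous_const.mul (continuous_const.sub (hp none)))).div_const 2)
  continuous_onStar _ _ _ f hf := continuous_starRetract (Finset.univ.map f)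
    (fun t _ ha => Weight.push_of_notMem f hf t (by simpa using ha)) (Weight.continuous_push f hf)
  onHor_vert e _ w b hb := by
    have hw : w.val true = (SquareComplex.endPt b : ℝ) := by
      cases b
      · rw [w.eq_zero_of_eq_one hb (by simp)]
        rfl
      · rw [hb]
        rfl
    rw [← edgePoint_endPt, hw, toUnit, projIcc_val]
  onStar_apex _ _ _ _ hw := starRetract_of_apex_eq_one hw
  onStar_center _ _ _ hw := starRetract_of_center_eq_one hw
  onStar_square _ _ _ _ _ _ _ hw := starRetract_of_square_eq_one hw
  onTri_star _ _ _ _ _ _ _ h0 hapex hsquare := (starRetract_eq_trianglePoint h0 hapex hsquare).symm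
  onTri_hor s i t _ w w' h0 hends := trianglePoint_eq_edgePoint w s i t w' h0 hends

/-! ### The homotopy -/

/-- The straight line from a point of the star of `e*` to its retraction. -/
noncomputable def retractPath {e : X.E} (he : e ∈ X.vertical) (w : Weight (StarCompat (e := e))) :
    C(I, X.simplexification.Realization) where
  toFun s := (starChart e he).pt (w.mix (retract w) (retract_compat w) s)
  continuous_toFun := by
    classical
    refine (starChart e he).continuous_pt _
      (w.finite_support.toFinset ∪ (retract w).finite_support.toFinset) ?_ ?_
    · intro s a ha
      simp only [Finset.mem_union, Finite.mem_toFinset, mem_ofPred_eq, not_or, not_not] at ha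
      simp [Weight.mix, ha.1, ha.2]
    · intro a _
      simp only [Weight.mix]
      fun_prop

theorem retractPath_of_eq {e : X.E} (he : e ∈ X.vertical) {w : Weight (StarCompat (e := e))}
    (h : retract w = w) : retractPath he w = ContinuousMap.const I ((starChart e he).pt w) := by
  ext s
  refine congrArg (starChart e he).pt ?_
  ext a
  simp only [Weight.mix, h]
  ring

theorem continuous_retractPath {e : X.E} (he : e ∈ X.vertical) {P : Type*} [TopologicalSpace P]
    {F : P → Weight (StarCompat (e := e))} (s : Finset (X.StarCorner e))
    (hs : ∀ p, ∀ a ∉ s, (F p).val a = 0) (hF : ∀ c, Continuous fun p => (F p).val c) :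
    Continuous fun p => retractPath he (F p) := by
  classical
  refine ContinuousMap.continuous_of_continuous_uncurry _ ?_
  refine (starChart e he).continuous_pt_of_ne
    (fun q : P × I => (F q.1).mix _ (retract_compat _) q.2) (insert .center s) .center ?_ ?_
  · rintro ⟨p, t⟩ a ha
    simp only [Finset.mem_insert, not_or] at ha
    simp [Weight.mix, hs p a ha.2, retract_eq_zero (F p) ha.1 (hs p a ha.2)]
  · intro a _ ha
    have ht : Continuous fun q : P × I => (q.2 : ℝ) := continuous_subtype_val.comp continuous_snd
    exact ((continuous_const.sub ht).mul ((hF a).comp continuous_fst)).add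
      (ht.mul ((continuous_val_retract hF ha).comp continuous_fst))

/-- The homotopy from the identity of the simplexification to the composition of the retraction and
the subdivision, on the charts. -/
noncomputable def homotopyMaps (X : VHComplex.{u}) :
    ChartMaps X C(I, X.simplexification.Realization) where
  onVert v := .const I (vertPoint v)
  onEdge e he := .const I (point (K := X.simplexification) (.edge e he) (stdSimplex.vertex 0))
  onSquare s := .const I (squarePoint s)
  onHor e he w := .const I ((horChart e he).pt w)
  onTri s i t h w := .const I ((triChart s i t h).pt w)
  onStar _ he w := retractPath he w
  continuous_onHor e he _ f hf := ContinuousMap.continuous_const'.comp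
    ((horChart e he).continuous_pt _ Finset.univ (by simp) fun a _ => Weight.continuous_push f hf a)
  continuous_onTri s i t h _ f hf := ContinuousMap.continuous_const'.comp
    ((triChart s i t h).continuous_pt _ Finset.univ (by simp)
      fun a _ => Weight.continuous_push f hf a)
  continuous_onStar _ he _ f hf := continuous_retractPath he (Finset.univ.map f)
    (fun t _ ha => Weight.push_of_notMem f hf t (by simpa using ha)) (Weight.continuous_push f hf)
  onHor_vert _ he _ _ hw := by rw [horChart_pt_of_eq_one he hw]
  onStar_apex _ he w _ hw := by
    rw [retractPath_of_eq he (retract_eq_self_of_eq_one w hw), starChart_pt_apex he hw]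
  onStar_center _ he w hw := by
    rw [retractPath_of_eq he (retract_eq_self_of_eq_one w hw)]
    exact congrArg _ (starChart_pt_of_eq_one he hw _)
  onStar_square _ he w _ _ _ _ hw := by
    rw [retractPath_of_eq he (retract_eq_self_of_eq_one w hw), starChart_pt_square he hw]
  onTri_star s i t h a w w' h0 hapex hsquare := by
    rw [retractPath_of_eq _ (retract_eq_self_of_triangle h0 hapex hsquare),
      triChart_pt_eq_starChart_pt s i t h a w w' h0 hapex hsquare]
  onTri_hor s i t h w w' h0 hends := by rw [triChart_pt_eq_horChart_pt s i t h w w' h0 hends]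

theorem homotopyMaps_zero (p : X.simplexification.Realization) :
    (homotopyMaps X).toContinuousMap p 0 = p := by
  induction p using realization_induction with
  | vert v => rfl
  | hor e he w => rw [ChartMaps.toContinuousMap_hor]; rfl
  | tri s i t h w => rw [ChartMaps.toContinuousMap_tri]; rfl
  | star e he w =>
    rw [ChartMaps.toContinuousMap_star]
    refine congrArg (starChart e he).pt ?_
    ext a
    simp [Weight.mix]

theorem subdivide_edgePoint_of_notMem {e : X.E} (he : e ∉ X.vertical)
    (w : Weight (AllCompat (α := Bool))) :
    subdivide (edgePoint e (toUnit (w.val true))) = (horChart e he).pt w := by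
  change edgeMap e _ = _
  rw [edgeMap, dif_neg he]
  congr 1
  have hsum := w.sum_eq_one (s := Finset.univ) (by simp)
  rw [Fintype.sum_bool] at hsum
  ext b
  simp only [horWeight, coe_toUnit (w.nonneg _) (w.le_one _)]
  cases b
  · exact (eq_sub_of_add_eq' hsum).symm
  · rfl

theorem subdivide_trianglePoint (s : X.S) {i t : Bool} (h : X.side s i t ∉ X.vertical)
    (w : Weight (AllCompat (α := Option Bool))) :
    subdivide (trianglePoint w s i t) = (triChart s i t h).pt w := by
  obtain rfl := eq_hdir h
  change squareMap s _ _ = _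
  have hb := abs_val_some_sub_val_some_le w
  have hle := sub_le_self 1 (w.nonneg none)
  have ha : |sgn t * (1 - w.val none)| = 1 - w.val none := by
    rw [abs_sgn_mul, abs_of_nonneg ((abs_nonneg _).trans hb)]
  simp only [if_true, Bool.not_eq_self, if_false]
  rw [two_mul_toUnit_sub_one (ha.trans_le hle), two_mul_toUnit_sub_one (hb.trans hle),
    squareMap_of_le s (by rwa [ha]) (by rw [ha]), triPart, ha, triWeight_eq_self]

theorem subdivide_cornerPoint {e : X.E} (he : e ∈ X.vertical) (c : X.StarCorner e) (hc : NonApex c)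
    {y b : ℝ} (hy : |y| ≤ b) (hb : b ≤ 1) (hcenter : c = .center → b = 1) :
    subdivide (cornerPoint c y b) = (starChart e he).pt (barWeight c hc y b) := by
  cases c with
  | apex β => exact absurd rfl (hc β)
  | center =>
    obtain rfl := hcenter rfl
    change edgeMap e _ = _
    rw [edgeMap, dif_pos he, two_mul_toUnit_sub_one hy]
  | square s i t h =>
    cases h
    obtain rfl := eq_not_hdir he
    change squareMap s _ _ = _
    have hsb : |sgn t * b| = b := by rw [abs_sgn_mul, abs_of_nonneg ((abs_nonneg _).trans hy)]
    have hr : |if X.reversed s (!hdir s) t then -y else y| = |y| := by split_ifs <;> simp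
    simp only [if_true, Bool.eq_not_self, if_false]
    rw [two_mul_toUnit_sub_one (hr.trans_le (hy.trans hb)),
      two_mul_toUnit_sub_one (hsb.trans_le hb),
      squareMap_of_ge s (by rwa [hr, hsb]) (by rwa [hsb]) (by rw [hsb]), starPart, hsb]
    congr 2
    cases X.reversed s (!hdir s) t <;> simp [sgn]

theorem subdivide_starRetract {e : X.E} (he : e ∈ X.vertical) (w : Weight (StarCompat (e := e))) :
    subdivide (starRetract w) = (starChart e he).pt (retract w) :=
  subdivide_cornerPoint he _ (nonApex_dominant w) (abs_height_le w _)
    (sub_le_self 1 (excess_dominant_nonneg w)) fun h => by rw [h]; exact sub_zero 1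

theorem homotopyMaps_one (p : X.simplexification.Realization) :
    (homotopyMaps X).toContinuousMap p 1 = subdivide ((retractMaps X).toContinuousMap p) := by
  induction p using realization_induction with
  | vert v => rfl
  | hor e he w =>
    rw [ChartMaps.toContinuousMap_hor, ChartMaps.toContinuousMap_hor]
    exact (subdivide_edgePoint_of_notMem he w).symm
  | tri s i t h w =>
    rw [ChartMaps.toContinuousMap_tri, ChartMaps.toContinuousMap_tri]
    exact (subdivide_trianglePoint s h w).symm
  | star e he w =>
    rw [ChartMaps.toContinuousMap_star, ChartMaps.toContinuousMap_star]
    refine Eq.trans (congrArg (starChart e he).pt ?_) (subdivide_starRetract he w).symm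
    ext a
    simp [Weight.mix]

theorem simplyConnectedSpace_simplexification [SimplyConnectedSpace X.toSquareComplex.Realization] :
    SimplyConnectedSpace X.simplexification.Realization :=
  simplyConnectedSpace_of_homotopy_comp subdivide (retractMaps X).toContinuousMap
    { toFun := fun p => (homotopyMaps X).toContinuousMap p.2 p.1
      continuous_toFun := (ContinuousMap.continuous_uncurry_of_continuous
        (homotopyMaps X).toContinuousMap).comp continuous_swap
      map_zero_left := homotopyMaps_zero
      map_one_left := homotopyMaps_one }

end VHComplex

/-! ### Flag complexes -/

namespace GenSimplicialComplex

variable {K : GenSimplicialComplex.{u}}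

theorem emb_eq_pointEmb {n : ℕ} (θ : Fin (0 + 1) ↪ Fin (n + 1)) : θ = pointEmb (θ 0) := by
  ext1 j
  exact congrArg θ (Subsingleton.elim (α := Fin 1) _ _)

theorem vertex_face {m n : ℕ} (θ : Fin (m + 1) ↪ Fin (n + 1)) (x : K.simplex n) (j : Fin (m + 1)) :
    K.vertex (K.face θ x) j = K.vertex x (θ j) := by
  rw [vertex, vertex, K.face_comp]
  rfl

theorem isFlag_of_vertex (hinj : ∀ n (x : K.simplex n), Function.Injective (K.vertex x))
    (hext : ∀ n (x y : K.simplex n), (∀ j, K.vertex x j = K.vertex y j) → x = y)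
    (hspan : ∀ (n : ℕ) (p : Fin (n + 1) → K.simplex 0), Function.Injective p →
      (∀ i j, i ≠ j → K.Adj (p i) (p j)) → ∃ x : K.simplex n, ∀ i, K.vertex x i = p i) :
    K.IsFlag := by
  refine ⟨⟨fun x hx => absurd (hinj 1 x hx) (by decide), fun n hn x y hxy => ?_⟩, hspan⟩
  have corner_mem : ∀ j, ∃ k, K.vertex x k = K.vertex y j := by
    intro j
    obtain ⟨θ, hθ⟩ := (hxy 0 hn (K.vertex y j)).2 ⟨pointEmb j, rfl⟩
    refine ⟨θ 0, ?_⟩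
    rw [← hθ, vertex, ← emb_eq_pointEmb]
  choose k hk using corner_mem
  refine ⟨⟨k, fun a b hab => hinj n y ?_⟩, hext _ _ _ fun j => ?_⟩
  · rw [← hk, ← hk, hab]
  · rw [vertex_face]
    exact hk j

end GenSimplicialComplex

/-! ### Cluster graphs -/

/-- Adjacency inside a cluster: distinct vertices with the same base are adjacent unless they are
opposite. -/
def ClusterAdj {L B : Type*} (base : L → Option B) (opp : L → L → Prop) (a b : L) : Prop :=
  base a ≠ none ∧ base a = base b ∧ a ≠ b ∧ ¬ opp a b

theorem ClusterAdj.symm {L B : Type*} {base : L → Option B} {opp : L → L → Prop} {a b : L}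
    (hopp : ∀ a b, opp a b → opp b a) (hab : ClusterAdj base opp a b) : ClusterAdj base opp b a :=
  ⟨hab.2.1 ▸ hab.1, hab.2.1.symm, hab.2.2.1.symm, fun ho => hab.2.2.2 (hopp _ _ ho)⟩

/-- A cluster graph: some vertices are grouped into clusters, namely the fibres of `base` over
`some _`, each of which is a clique or the suspension of one, the two suspension points being
opposite. The other edges are those of `cross`. A vertex link of the simplexification is of this
kind, with one cluster for each corner of a star at the vertex. -/
structure IsClusterGraph {L B : Type*} (base : L → Option B) (opp cross : L → L → Prop) :
    Prop where
  opp_symm : ∀ a b, opp a b → opp b a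
  cross_symm : ∀ a b, cross a b → cross b a
  cross_unique : ∀ a b c, base a ≠ none → cross a b → cross a c → b = c
  cross_unique_of_none : ∀ a b c, base a = none → cross a b → cross a c → base b = base c → b = c
  base_ne : ∀ a b, cross a b → base a ≠ base b
  eq_or_opp_of_cross : ∀ a a' b b', base a ≠ none → base a = base b → cross a a' → cross b b' →
    base b' ≠ none → a = b ∨ opp a b
  eq_or_eq_of_opp : ∀ a b c d, base a = base c → opp a b → opp c d → a = c ∨ a = d

namespace IsClusterGraph

variable {L B : Type*} {base : L → Option B} {opp cross : L → L → Prop}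

/-- Adjacency in the cluster graph given by `base`, `opp` and `cross`. -/
def Adj (base : L → Option B) (opp cross : L → L → Prop) (a b : L) : Prop :=
  ClusterAdj base opp a b ∨ cross a b

theorem cross_of_base_eq_none {a b : L} (ha : base a = none) (hab : Adj base opp cross a b) :
    cross a b :=
  hab.resolve_left fun hab => hab.1 ha

theorem opp_of_not_clusterAdj {a b c : L} (hab : ClusterAdj base opp a b)
    (hbc : ClusterAdj base opp b c) (hac : a ≠ c) (hnot : ¬ ClusterAdj base opp a c) :
    opp a c := by
  by_contra hopp
  exact hnot ⟨hab.1, hab.2.1.trans hbc.2.1, hac, hopp⟩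

variable (h : IsClusterGraph base opp cross)

include h

theorem clusterAdj_symm {a b : L} (hab : ClusterAdj base opp a b) : ClusterAdj base opp b a :=
  hab.symm h.opp_symm

theorem adj_symm {a b : L} (hab : Adj base opp cross a b) : Adj base opp cross b a :=
  hab.imp h.clusterAdj_symm (h.cross_symm a b)

theorem base_ne_none_of_cross {a b : L} (hab : cross a b) (ha : base a = none) : base b ≠ none :=
  fun hb => h.base_ne a b hab (ha.trans hb.symm)

theorem clusterAdj_of_cross {a b c : L} (hab : cross a b) (hb : base b ≠ none) (hac : a ≠ c)
    (hbc : Adj base opp cross b c) : ClusterAdj base opp b c :=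
  hbc.resolve_right fun hbc => hac (h.cross_unique b a c hb (h.cross_symm _ _ hab) hbc)

theorem base_eq_none_of_clusterAdj {a b a' b' : L} (hab : ClusterAdj base opp a b)
    (ha : cross a a') (hb : cross b b') : base b' = none := by
  by_contra hne
  exact (h.eq_or_opp_of_cross a a' b b' hab.1 hab.2.1 ha hb hne).elim hab.2.2.1 hab.2.2.2

theorem not_triangle_of_base_ne_none {a b c : L} (hb : base b ≠ none) (hab : cross a b)
    (hac : a ≠ c) (hbc : b ≠ c) (hac' : Adj base opp cross a c)
    (hbc' : Adj base opp cross b c) : False := by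
  have hbc_cluster := h.clusterAdj_of_cross hab hb hac hbc'
  by_cases ha : base a = none
  · exact hbc (h.cross_unique_of_none a b c ha hab (cross_of_base_eq_none ha hac') hbc_cluster.2.1)
  · have hac_cluster := h.clusterAdj_of_cross (h.cross_symm _ _ hab) ha hbc hac'
    exact h.base_ne a b hab (hac_cluster.2.1.trans hbc_cluster.2.1.symm)

theorem not_cross_of_triangle {a b c : L} (hac : a ≠ c) (hbc : b ≠ c)
    (hac' : Adj base opp cross a c) (hbc' : Adj base opp cross b c) : ¬ cross a b := by
  intro hab
  by_cases ha : base a = none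
  · exact h.not_triangle_of_base_ne_none (h.base_ne_none_of_cross hab ha) hab hac hbc hac' hbc'
  · exact h.not_triangle_of_base_ne_none ha (h.cross_symm _ _ hab) hbc hac hbc' hac'

theorem not_square_of_base_ne_none {a b c d : L} (hb : base b ≠ none) (hab : cross a b)
    (hbc : Adj base opp cross b c) (hcd : Adj base opp cross c d) (hda : Adj base opp cross d a)
    (hac : a ≠ c) (hbd : b ≠ d) : False := by
  have hbc_cluster := h.clusterAdj_of_cross hab hb hac hbc
  by_cases ha : base a = none
  · have had := cross_of_base_eq_none ha (h.adj_symm hda)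
    have hdc := h.clusterAdj_of_cross had (h.base_ne_none_of_cross had ha) hac (h.adj_symm hcd)
    exact hbd (h.cross_unique_of_none a b d ha hab had (hbc_cluster.2.1.trans hdc.2.1.symm))
  · have had := h.clusterAdj_of_cross (h.cross_symm _ _ hab) ha hbd (h.adj_symm hda)
    rcases hcd with hcd | hcd
    · exact h.base_ne a b hab (had.2.1.trans (hcd.2.1.symm.trans hbc_cluster.2.1.symm))
    · exact ha (h.base_eq_none_of_clusterAdj (h.clusterAdj_symm hbc_cluster) hcd
        (h.cross_symm _ _ hab))

theorem not_cross_of_square {a b c d : L} (hbc : Adj base opp cross b c)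
    (hcd : Adj base opp cross c d) (hda : Adj base opp cross d a) (hac : a ≠ c) (hbd : b ≠ d) :
    ¬ cross a b := by
  intro hab
  by_cases ha : base a = none
  · exact h.not_square_of_base_ne_none (h.base_ne_none_of_cross hab ha) hab hbc hcd hda hac hbd
  · exact h.not_square_of_base_ne_none ha (h.cross_symm _ _ hab) (h.adj_symm hda) (h.adj_symm hcd)
      (h.adj_symm hbc) hbd hac

theorem not_pentagon_of_base_ne_none {a b c d e : L} (hb : base b ≠ none) (hab : cross a b)
    (hbc : Adj base opp cross b c) (hcd : Adj base opp cross c d) (hde : Adj base opp cross d e)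
    (hea : Adj base opp cross e a) (hac : a ≠ c) (hbe : b ≠ e) (had : a ≠ d) : False := by
  have hbc_cluster := h.clusterAdj_of_cross hab hb hac hbc
  have hcb_cluster := h.clusterAdj_symm hbc_cluster
  by_cases ha : base a = none
  · have hae := cross_of_base_eq_none ha (h.adj_symm hea)
    have hed := h.clusterAdj_of_cross hae (h.base_ne_none_of_cross hae ha) had (h.adj_symm hde)
    rcases hcd with hcd | hcd
    · exact hbe (h.cross_unique_of_none a b e ha hab hae
        (hbc_cluster.2.1.trans (hcd.2.1.trans hed.2.1.symm)))
    · exact (h.clusterAdj_symm hed).1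
        (h.base_eq_none_of_clusterAdj hbc_cluster (h.cross_symm _ _ hab) hcd)
  · have hae := h.clusterAdj_of_cross (h.cross_symm _ _ hab) ha hbe (h.adj_symm hea)
    rcases hcd with hcd | hcd
    · rcases hde with hde | hde
      · exact h.base_ne a b hab (hae.2.1.trans
          (hde.2.1.symm.trans (hcd.2.1.symm.trans hbc_cluster.2.1.symm)))
      · exact hb (h.base_eq_none_of_clusterAdj (h.clusterAdj_symm hae) (h.cross_symm _ _ hde) hab)
    · exact ha (h.base_eq_none_of_clusterAdj hcb_cluster hcd (h.cross_symm _ _ hab))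

theorem not_cross_of_pentagon {a b c d e : L} (hbc : Adj base opp cross b c)
    (hcd : Adj base opp cross c d) (hde : Adj base opp cross d e) (hea : Adj base opp cross e a)
    (hac : a ≠ c) (hbe : b ≠ e) (had : a ≠ d) (hbd : b ≠ d) : ¬ cross a b := by
  intro hab
  by_cases ha : base a = none
  · exact h.not_pentagon_of_base_ne_none (h.base_ne_none_of_cross hab ha) hab hbc hcd hde hea
      hac hbe had
  · exact h.not_pentagon_of_base_ne_none ha (h.cross_symm _ _ hab) (h.adj_symm hea)
      (h.adj_symm hde) (h.adj_symm hcd) (h.adj_symm hbc) hbe hac hbd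

theorem not_square {a b c d : L} (hab : Adj base opp cross a b) (hbc : Adj base opp cross b c)
    (hcd : Adj base opp cross c d) (hda : Adj base opp cross d a) (hac : a ≠ c) (hbd : b ≠ d)
    (hac' : ¬ ClusterAdj base opp a c) (hbd' : ¬ ClusterAdj base opp b d) : False := by
  have hab' := hab.resolve_right (h.not_cross_of_square hbc hcd hda hac hbd)
  have hbc' := hbc.resolve_right (h.not_cross_of_square hcd hda hab hbd hac.symm)
  have hcd' := hcd.resolve_right (h.not_cross_of_square hda hab hbc hac.symm hbd.symm)
  have hda' := hda.resolve_right (h.not_cross_of_square hab hbc hcd hbd.symm hac)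
  exact (h.eq_or_eq_of_opp a c b d hab'.2.1 (opp_of_not_clusterAdj hab' hbc' hac hac')
    (opp_of_not_clusterAdj hbc' hcd' hbd hbd')).elim hab'.2.2.1 hda'.2.2.1.symm

theorem not_pentagon {a b c d e : L} (hab : Adj base opp cross a b)
    (hbc : Adj base opp cross b c) (hcd : Adj base opp cross c d) (hde : Adj base opp cross d e)
    (hea : Adj base opp cross e a) (hac : a ≠ c) (hbd : b ≠ d) (hce : c ≠ e) (hda : d ≠ a)
    (heb : e ≠ b) (hac' : ¬ ClusterAdj base opp a c) (hbd' : ¬ ClusterAdj base opp b d) :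
    False := by
  have hab' := hab.resolve_right
    (h.not_cross_of_pentagon hbc hcd hde hea hac heb.symm hda.symm hbd)
  have hbc' := hbc.resolve_right
    (h.not_cross_of_pentagon hcd hde hea hab hbd hac.symm heb.symm hce)
  have hcd' := hcd.resolve_right
    (h.not_cross_of_pentagon hde hea hab hbc hce hbd.symm hac.symm hda)
  exact (h.eq_or_eq_of_opp a c b d hab'.2.1 (opp_of_not_clusterAdj hab' hbc' hac hac')
    (opp_of_not_clusterAdj hbc' hcd' hbd hbd')).elim hab'.2.2.1 hda.symm

end IsClusterGraph

/-! ### Corners and double edges of links in a square complex -/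

namespace SquareComplex

variable {Y : SquareComplex.{u}}

theorem joins_cornerEdge (q : Y.Corner) (i : Bool) :
    Y.Joins q (Y.cornerEdge q i) (Y.cornerEdge q (!i)) := by
  cases i
  · exact .inl ⟨rfl, rfl⟩
  · exact .inr ⟨rfl, rfl⟩

theorem linkHasCycle_two {d d' : Y.OrientedEdge} {q q' : Y.Corner} (hd : d ≠ d') (hq : q ≠ q')
    (ho : Y.origin d = Y.origin d') (hj : Y.Joins q d d') (hj' : Y.Joins q' d d') :
    Y.LinkHasCycle (Y.origin d) 2 := by
  have injective_cons {α : Type u} {x y : α} (hxy : x ≠ y) :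
      Function.Injective (![x, y] : Fin 2 → α) := by
    intro j k hjk
    fin_cases j <;> fin_cases k
    exacts [rfl, (hxy hjk).elim, (hxy hjk.symm).elim, rfl]
  exact ⟨(![d, d'] : Fin 2 → _), (![q, q'] : Fin 2 → _), Fin.forall_fin_two.2 ⟨rfl, ho.symm⟩,
    injective_cons hd, injective_cons hq, Fin.forall_fin_two.2 ⟨hj, hj'.symm⟩⟩

theorem IsNonpositivelyCurved.eq_of_joins (hY : Y.IsNonpositivelyCurved) {d d' : Y.OrientedEdge}
    {q q' : Y.Corner} (hd : d ≠ d') (ho : Y.origin d = Y.origin d') (hj : Y.Joins q d d')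
    (hj' : Y.Joins q' d d') : q = q' := by
  by_contra hq
  exact hY _ 2 (by norm_num) (by norm_num) (linkHasCycle_two hd hq ho hj hj')

end SquareComplex

namespace VHComplex

open GenSimplicialComplex

variable {X : VHComplex.{u}}

/-- The corner of a square with horizontal coordinate `a` and vertical coordinate `t`. -/
noncomputable def corner (s : X.S) (a t : Bool) : X.Corner :=
  (s, fun k => if k = hdir s then a else t)

theorem corner_injective {s s' : X.S} {a a' t t' : Bool} (h : corner s a t = corner s' a' t') :
    s = s' ∧ a = a' ∧ t = t' := by
  obtain rfl : s = s' := congrArg Prod.fst h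
  have hcoord := congrFun (congrArg Prod.snd h)
  exact ⟨rfl, by simpa [corner] using hcoord (hdir s), by simpa [corner] using hcoord (!hdir s)⟩

theorem cornerEdge_hdir (s : X.S) (a t : Bool) : X.cornerEdge (corner s a t) (hdir s) =
    (X.side s (hdir s) t, a ^^ X.reversed s (hdir s) t) := by
  simp [SquareComplex.cornerEdge, corner]

theorem cornerEdge_not_hdir (s : X.S) (a t : Bool) : X.cornerEdge (corner s a t) (!hdir s) =
    (X.side s (!hdir s) a, t ^^ X.reversed s (!hdir s) a) := by
  simp [SquareComplex.cornerEdge, corner]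

theorem joins_corner (s : X.S) (a t : Bool) : X.Joins (corner s a t)
    (X.side s (hdir s) t, a ^^ X.reversed s (hdir s) t)
    (X.side s (!hdir s) a, t ^^ X.reversed s (!hdir s) a) := by
  rw [← cornerEdge_hdir, ← cornerEdge_not_hdir]
  exact SquareComplex.joins_cornerEdge (Y := X.toSquareComplex) _ _

theorem corner_eq_of_edges_eq (hX : X.toSquareComplex.IsNonpositivelyCurved) {s s' : X.S}
    {a a' t t' : Bool}
    (hhor : X.cornerEdge (corner s a t) (hdir s) = X.cornerEdge (corner s' a' t') (hdir s'))
    (hver : X.cornerEdge (corner s a t) (!hdir s) = X.cornerEdge (corner s' a' t') (!hdir s')) :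
    corner s a t = corner s' a' t' := by
  rw [cornerEdge_hdir, cornerEdge_hdir] at hhor
  rw [cornerEdge_not_hdir, cornerEdge_not_hdir] at hver
  have hside : X.side s (hdir s) t ≠ X.side s (!hdir s) a := fun h =>
    side_hdir_notMem s t (h ▸ side_not_hdir_mem s a)
  refine hX.eq_of_joins (d := (X.side s (hdir s) t, a ^^ X.reversed s (hdir s) t))
    (d' := (X.side s (!hdir s) a, t ^^ X.reversed s (!hdir s) a))
    (fun h => hside (congrArg Prod.fst h)) (corner_vertex s (hdir s) t a).symm
    (joins_corner s a t) ?_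
  rw [hhor, hver]
  exact joins_corner s' a' t'

/-! ### The edges of the simplexification -/

/-- The corners of all stars, `StarCorner` without the dependence on a vertical edge. -/
inductive StarCode (X : VHComplex.{u}) : Type u
  | apex (b : Bool)
  | center
  | square (s : X.S) (i t : Bool)

/-- The code of a corner of a star. -/
def StarCorner.code {e : X.E} : X.StarCorner e → StarCode X
  | .apex b => .apex b
  | .center => .center
  | .square s i t _ => .square s i t

theorem StarCorner.code_injective {e : X.E} :
    Function.Injective (StarCorner.code : X.StarCorner e → StarCode X) := by
  intro x y h
  cases x <;> cases y <;> simp_all [StarCorner.code]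

theorem star_eq_iff {n : ℕ} {e e' : X.E} {he : e ∈ X.vertical} {he' : e' ∈ X.vertical}
    {f : Fin (n + 2) ↪ X.StarCorner e} {f' : Fin (n + 2) ↪ X.StarCorner e'} {hf : Spans f}
    {hf' : Spans f'} : OrderedSimplex.star e he f hf = .star e' he' f' hf' ↔
      e = e' ∧ ∀ j, (f j).code = (f' j).code := by
  constructor
  · intro h
    cases h
    exact ⟨rfl, fun _ => rfl⟩
  · rintro ⟨rfl, h⟩
    obtain rfl : f = f' := by
      ext1 j
      exact StarCorner.code_injective (h j)
    rfl

/-- A description of an oriented edge of the simplexification that involves no proofs and no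
dependent types: a horizontal edge with its first end, or the segment between two corners of the
star of `e*`. -/
inductive EdgeLabel (X : VHComplex.{u}) : Type u
  | hor (e : X.E) (b : Bool)
  | seg (e : X.E) (c c' : StarCode X)

/-- The label of an edge of the simplexification. -/
def edgeLabel : X.OrderedSimplex 1 → EdgeLabel X
  | .hor e _ b => .hor e b
  | .star e _ f _ => .seg e (f 0).code (f 1).code

theorem edgeLabel_injective :
    Function.Injective (edgeLabel : X.OrderedSimplex 1 → EdgeLabel X) := by
  intro x y h
  cases x <;> cases y <;> simp only [edgeLabel, EdgeLabel.hor.injEq, EdgeLabel.seg.injEq,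
    reduceCtorEq] at h
  · obtain ⟨rfl, rfl⟩ := h
    rfl
  · exact star_eq_iff.2 ⟨h.1, Fin.forall_fin_two.2 h.2⟩

/-- The segment from `s*` to the corner of `s` on the sides `side s i t` and `side s (!i) a`. -/
def outLabel (s : X.S) (i t a : Bool) : EdgeLabel X :=
  .seg (X.side s (!i) a) (.square s (!i) a) (.apex (t ^^ X.reversed s (!i) a))

/-- The segment to `s*` from the corner of `s` on the sides `side s i t` and `side s (!i) a`. -/
def inLabel (s : X.S) (i t a : Bool) : EdgeLabel X :=
  .seg (X.side s (!i) a) (.apex (t ^^ X.reversed s (!i) a)) (.square s (!i) a)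

/-- The side `side s i t`, oriented so that it starts on `side s (!i) a`. -/
def horLabel (s : X.S) (i t a : Bool) : EdgeLabel X :=
  .hor (X.side s i t) (a ^^ X.reversed s i t)

theorem edgeLabel_triEdge_none_some (s : X.S) (i t : Bool) (h : X.side s i t ∉ X.vertical)
    (a : Bool) : edgeLabel (triEdge s i t h none (some a)) = outLabel s i t a := rfl

theorem edgeLabel_triEdge_some_none (s : X.S) (i t : Bool) (h : X.side s i t ∉ X.vertical)
    (a : Bool) : edgeLabel (triEdge s i t h (some a) none) = inLabel s i t a := rfl

theorem edgeLabel_triEdge_some_some (s : X.S) (i t : Bool) (h : X.side s i t ∉ X.vertical)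
    (a b : Bool) : edgeLabel (triEdge s i t h (some a) (some b)) = horLabel s i t a := rfl

theorem outLabel_injective {s s' : X.S} {i i' t t' a a' : Bool}
    (h : outLabel s i t a = outLabel s' i' t' a') : s = s' ∧ i = i' ∧ t = t' ∧ a = a' := by
  simp only [outLabel, EdgeLabel.seg.injEq, StarCode.square.injEq, StarCode.apex.injEq] at h
  obtain ⟨-, ⟨rfl, hi, rfl⟩, ht⟩ := h
  obtain rfl := Bool.not_inj hi
  exact ⟨rfl, rfl, by simpa using ht, rfl⟩

theorem inLabel_injective {s s' : X.S} {i i' t t' a a' : Bool}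
    (h : inLabel s i t a = inLabel s' i' t' a') : s = s' ∧ i = i' ∧ t = t' ∧ a = a' := by
  simp only [inLabel, EdgeLabel.seg.injEq, StarCode.square.injEq, StarCode.apex.injEq] at h
  obtain ⟨-, ht, rfl, hi, rfl⟩ := h
  obtain rfl := Bool.not_inj hi
  exact ⟨rfl, rfl, by simpa using ht, rfl⟩

/-- The star that contains an edge, together with the corner of the star at which the edge starts:
the base of the edge in the cluster graph of edges. -/
def EdgeLabel.cluster : EdgeLabel X → Option (X.E × StarCode X)
  | .hor _ _ => none
  | .seg e c _ => some (e, c)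

/-- Edges with the same start that lead to the two endpoints of a vertical edge. -/
def EdgeLabel.Opposite (l l' : EdgeLabel X) : Prop :=
  ∃ e c b, l = .seg e c (.apex b) ∧ l' = .seg e c (.apex !b)

theorem EdgeLabel.Opposite.symm {l l' : EdgeLabel X} (h : l.Opposite l') : l'.Opposite l := by
  obtain ⟨e, c, b, rfl, rfl⟩ := h
  exact ⟨e, c, !b, rfl, by rw [Bool.not_not]⟩

/-- Two edges with the same start are sides of a triangle with a horizontal side. -/
inductive TriAdj : EdgeLabel X → EdgeLabel X → Prop
  | out (s : X.S) (i t a : Bool) (h : X.side s i t ∉ X.vertical) :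
      TriAdj (outLabel s i t a) (outLabel s i t !a)
  | inHor (s : X.S) (i t a : Bool) (h : X.side s i t ∉ X.vertical) :
      TriAdj (inLabel s i t a) (horLabel s i t a)
  | horIn (s : X.S) (i t a : Bool) (h : X.side s i t ∉ X.vertical) :
      TriAdj (horLabel s i t a) (inLabel s i t a)

namespace TriAdj

variable {l l₁ l₂ m m₁ : EdgeLabel X}

theorem symm (h : TriAdj l m) : TriAdj m l := by
  cases h with
  | out s i t a h => simpa only [Bool.not_not] using TriAdj.out s i t (!a) h
  | inHor s i t a h => exact .horIn s i t a h
  | horIn s i t a h => exact .inHor s i t a h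

theorem cluster_ne (h : TriAdj l m) : l.cluster ≠ m.cluster := by
  intro hlm
  cases h <;> simp [EdgeLabel.cluster, outLabel, inLabel, horLabel] at hlm

theorem unique (hl : l.cluster ≠ none) (h₁ : TriAdj l l₁) (h₂ : TriAdj l l₂) : l₁ = l₂ := by
  cases h₁ with
  | out s i t a h =>
    generalize hm : outLabel s i t a = m at h₂
    cases h₂ with
    | out s' i' t' a' h' =>
      obtain ⟨rfl, rfl, rfl, rfl⟩ := outLabel_injective hm
      rfl
    | inHor s' i' t' a' h' => simp [outLabel, inLabel] at hm
    | horIn s' i' t' a' h' => simp [outLabel, horLabel] at hm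
  | inHor s i t a h =>
    generalize hm : inLabel s i t a = m at h₂
    cases h₂ with
    | out s' i' t' a' h' => simp [outLabel, inLabel] at hm
    | inHor s' i' t' a' h' =>
      obtain ⟨rfl, rfl, rfl, rfl⟩ := inLabel_injective hm
      rfl
    | horIn s' i' t' a' h' => simp [inLabel, horLabel] at hm
  | horIn s i t a h => exact absurd rfl hl

theorem unique_of_cluster_eq_none (hX : X.toSquareComplex.IsNonpositivelyCurved)
    (hl : l.cluster = none) (h₁ : TriAdj l l₁) (h₂ : TriAdj l l₂)
    (h₁₂ : l₁.cluster = l₂.cluster) : l₁ = l₂ := by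
  cases h₁ with
  | out s i t a h => simp [EdgeLabel.cluster, outLabel] at hl
  | inHor s i t a h => simp [EdgeLabel.cluster, inLabel] at hl
  | horIn s i t a h =>
    generalize hm : horLabel s i t a = m at h₂
    cases h₂ with
    | out s' i' t' a' h' => simp [outLabel, horLabel] at hm
    | inHor s' i' t' a' h' => simp [inLabel, horLabel] at hm
    | horIn s' i' t' a' h' =>
      obtain rfl := eq_hdir h
      obtain rfl := eq_hdir h'
      have hcorner : corner s a t = corner s' a' t' := by
        apply corner_eq_of_edges_eq hX
        · rw [cornerEdge_hdir, cornerEdge_hdir]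
          simpa [horLabel] using hm
        · rw [cornerEdge_not_hdir, cornerEdge_not_hdir]
          simpa [EdgeLabel.cluster, inLabel] using h₁₂
      obtain ⟨rfl, rfl, rfl⟩ := corner_injective hcorner
      rfl

theorem eq_or_opposite (hl : l.cluster ≠ none) (hlm : l.cluster = m.cluster) (h : TriAdj l l₁)
    (h' : TriAdj m m₁) (hm₁ : m₁.cluster ≠ none) : l = m ∨ l.Opposite m := by
  cases h' with
  | out s i t a =>
    cases h with
    | out s' i' t' a' =>
      simp only [EdgeLabel.cluster, outLabel, Option.some.injEq, Prod.mk.injEq,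
        StarCode.square.injEq] at hlm
      obtain ⟨-, rfl, hi, rfl⟩ := hlm
      obtain rfl := Bool.not_inj hi
      rcases Bool.eq_or_eq_not t t' with rfl | rfl
      · exact .inl rfl
      · exact .inr ⟨_, _, _, rfl, by rw [outLabel, Bool.not_xor]⟩
    | inHor => simp [EdgeLabel.cluster, outLabel, inLabel] at hlm
    | horIn => exact absurd rfl hl
  | inHor => exact absurd rfl hm₁
  | horIn => exact absurd hlm hl

end TriAdj

theorem isClusterGraph_edgeLabel (hX : X.toSquareComplex.IsNonpositivelyCurved) :
    IsClusterGraph (EdgeLabel.cluster (X := X)) EdgeLabel.Opposite TriAdj where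
  opp_symm _ _ := EdgeLabel.Opposite.symm
  cross_symm _ _ := TriAdj.symm
  cross_unique _ _ _ := TriAdj.unique
  cross_unique_of_none _ _ _ := TriAdj.unique_of_cluster_eq_none hX
  base_ne _ _ := TriAdj.cluster_ne
  eq_or_opp_of_cross _ _ _ _ := TriAdj.eq_or_opposite
  eq_or_eq_of_opp := by
    rintro _ _ _ _ hac ⟨e, c, b, rfl, rfl⟩ ⟨e', c', b', rfl, rfl⟩
    simp only [EdgeLabel.cluster, Option.some.injEq, Prod.mk.injEq] at hac
    obtain ⟨rfl, rfl⟩ := hac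
    cases b <;> cases b' <;> simp

/-- Adjacency of edges with the same start in the link of that start. -/
abbrev LabelAdj : EdgeLabel X → EdgeLabel X → Prop :=
  IsClusterGraph.Adj EdgeLabel.cluster EdgeLabel.Opposite TriAdj

/-! ### Vertex links of the simplexification -/

/-- The edge of a simplex from its first corner to another one. -/
def edgeFrom {n : ℕ} (x : X.OrderedSimplex (n + 1)) (j : Fin (n + 1)) : X.OrderedSimplex 1 :=
  simplexFace (consEmb (pointEmb j)) x

theorem edgeFrom_zero (x : X.OrderedSimplex 1) (j : Fin (0 + 1)) : edgeFrom x j = x := by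
  have h : consEmb (pointEmb j) = Function.Embedding.refl (Fin (1 + 1)) := by
    ext1 a
    fin_cases a
    · rfl
    · exact congrArg Fin.succ (Subsingleton.elim (α := Fin 1) j 0)
  rw [edgeFrom, h, simplexFace_id]

theorem vertex_edgeFrom {n : ℕ} (x : X.OrderedSimplex (n + 1)) (j : Fin (n + 1)) :
    X.simplexification.vertex (edgeFrom x j) 0 = X.simplexification.vertex (n := n + 1) x 0 :=
  vertex_face (K := X.simplexification) (consEmb (pointEmb j)) x 0

theorem edgeLabel_edgeFrom_star {n : ℕ} (e : X.E) (he : e ∈ X.vertical)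
    (f : Fin (n + 2) ↪ X.StarCorner e) (hf : Spans f) (j : Fin (n + 1)) :
    edgeLabel (edgeFrom (.star e he f hf) j) = .seg e (f 0).code (f j.succ).code := rfl

theorem edgeFrom_tri (s : X.S) (i t : Bool) (h : X.side s i t ∉ X.vertical)
    (f : Fin 3 ↪ Option Bool) (j : Fin 2) :
    edgeFrom (.tri s i t h f) j = triEdge s i t h (f 0) (f j.succ) := rfl

theorem triAdj_triEdge (s : X.S) (i t : Bool) (h : X.side s i t ∉ X.vertical)
    {x y z : Option Bool} (hxy : x ≠ y) (hxz : x ≠ z) (hyz : y ≠ z) :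
    TriAdj (edgeLabel (triEdge s i t h x y)) (edgeLabel (triEdge s i t h x z)) := by
  rcases x with _ | a <;> rcases y with _ | b <;> rcases z with _ | c
  · exact absurd rfl hxy
  · exact absurd rfl hxy
  · exact absurd rfl hxz
  · obtain rfl : c = !b := Bool.eq_not_of_ne fun hcb => hyz (congrArg some hcb.symm)
    exact .out s i t b h
  · exact absurd rfl hyz
  · exact .inHor s i t a h
  · exact .horIn s i t a h
  · cases a <;> cases b <;> cases c <;> simp_all

theorem clusterAdj_edgeFrom_star {n : ℕ} {e : X.E} (he : e ∈ X.vertical)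
    (f : Fin (n + 2) ↪ X.StarCorner e) (hf : Spans f) {j k : Fin (n + 1)} (hjk : j ≠ k) :
    ClusterAdj EdgeLabel.cluster EdgeLabel.Opposite (edgeLabel (edgeFrom (.star e he f hf) j))
      (edgeLabel (edgeFrom (.star e he f hf) k)) := by
  rw [edgeLabel_edgeFrom_star, edgeLabel_edgeFrom_star]
  refine ⟨by simp [EdgeLabel.cluster], rfl, fun h => ?_, ?_⟩
  · simp only [EdgeLabel.seg.injEq, true_and] at h
    exact hjk (Fin.succ_injective _ (f.injective (StarCorner.code_injective h)))
  · rintro ⟨e', c, b, hj, hk⟩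
    simp only [EdgeLabel.seg.injEq] at hj hk
    have hj' : f j.succ = .apex b := StarCorner.code_injective hj.2.2
    have hk' : f k.succ = .apex !b := StarCorner.code_injective hk.2.2
    cases b
    · exact hf _ _ hj' hk'
    · exact hf _ _ hk' hj'

theorem labelAdj_edgeFrom {n : ℕ} (x : X.OrderedSimplex (n + 1)) {j k : Fin (n + 1)}
    (hjk : j ≠ k) : LabelAdj (edgeLabel (edgeFrom x j)) (edgeLabel (edgeFrom x k)) := by
  cases x with
  | hor e he b => exact absurd (Subsingleton.elim (α := Fin 1) j k) hjk
  | tri s i t h f =>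
    exact .inr (triAdj_triEdge s i t h (f.injective.ne (Fin.succ_ne_zero j).symm)
      (f.injective.ne (Fin.succ_ne_zero k).symm)
      (f.injective.ne ((Fin.succ_injective _).ne hjk)))
  | star e he f hf => exact .inl (clusterAdj_edgeFrom_star he f hf hjk)

theorem edgeFrom_injective {n : ℕ} (x : X.OrderedSimplex (n + 1)) :
    Function.Injective (edgeFrom x) := by
  intro j k h
  by_contra hjk
  rcases labelAdj_edgeFrom x hjk with hadj | hadj
  · exact hadj.2.2.1 (by rw [h])
  · exact hadj.cluster_ne (by rw [h])

theorem cases_emb_option_bool (f : Fin 3 ↪ Option Bool) :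
    (∃ a, f 0 = none ∧ f 1 = some a ∧ f 2 = some !a) ∨
      (∃ a, f 0 = some a ∧ f 1 = none ∧ f 2 = some !a) ∨
      ∃ a, f 0 = some a ∧ f 1 = some (!a) ∧ f 2 = none := by
  have cases_of_ne : ∀ x y z : Option Bool, x ≠ y → x ≠ z → y ≠ z →
      (∃ a, x = none ∧ y = some a ∧ z = some !a) ∨
      (∃ a, x = some a ∧ y = none ∧ z = some !a) ∨
      ∃ a, x = some a ∧ y = some (!a) ∧ z = none := by decide
  exact cases_of_ne _ _ _ (f.injective.ne (by decide)) (f.injective.ne (by decide))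
    (f.injective.ne (by decide))

theorem tri_eq_of_edgeFrom_eq {s s' : X.S} {i i' t t' : Bool} {h : X.side s i t ∉ X.vertical}
    {h' : X.side s' i' t' ∉ X.vertical} {f f' : Fin 3 ↪ Option Bool}
    (hedge : ∀ j, edgeFrom (.tri s i t h f) j = edgeFrom (.tri s' i' t' h' f') j) :
    OrderedSimplex.tri s i t h f = .tri s' i' t' h' f' := by
  have h0 := congrArg edgeLabel (hedge 0)
  have h1 := congrArg edgeLabel (hedge 1)
  rw [edgeFrom_tri, edgeFrom_tri] at h0 h1
  suffices s = s' ∧ i = i' ∧ t = t' ∧ f 0 = f' 0 ∧ f 1 = f' 1 ∧ f 2 = f' 2 by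
    obtain ⟨rfl, rfl, rfl, hf⟩ := this
    obtain rfl : f = f' := DFunLike.ext f f' (by simpa [Fin.forall_fin_succ] using hf)
    rfl
  rcases cases_emb_option_bool f with ⟨a, hf⟩ | ⟨a, hf⟩ | ⟨a, hf⟩ <;>
    rcases cases_emb_option_bool f' with ⟨b, hf'⟩ | ⟨b, hf'⟩ | ⟨b, hf'⟩ <;>
    simp only [Fin.succ_zero_eq_one, Fin.succ_one_eq_two, hf, hf', edgeLabel_triEdge_none_some,
      edgeLabel_triEdge_some_none, edgeLabel_triEdge_some_some] at h0 h1 ⊢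
  · obtain ⟨rfl, rfl, rfl, rfl⟩ := outLabel_injective h0
    simp only [and_self]
  · simp [outLabel, inLabel] at h0
  · simp [outLabel, horLabel] at h0
  · simp [outLabel, inLabel] at h0
  · obtain ⟨rfl, rfl, rfl, rfl⟩ := inLabel_injective h0
    simp only [and_self]
  · simp [inLabel, horLabel] at h0
  · simp [outLabel, horLabel] at h0
  · simp [inLabel, horLabel] at h0
  · obtain ⟨rfl, rfl, rfl, rfl⟩ := inLabel_injective h1
    simp only [and_self]

theorem not_star_edgeFrom_eq_tri {e : X.E} {he : e ∈ X.vertical} {f : Fin 3 ↪ X.StarCorner e}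
    {hf : Spans f} {s : X.S} {i t : Bool} {h : X.side s i t ∉ X.vertical}
    {f' : Fin 3 ↪ Option Bool} :
    ¬ ∀ j : Fin 2, edgeFrom (.star e he f hf) j = edgeFrom (.tri s i t h f') j := by
  intro hedge
  have htri := triAdj_triEdge s i t h (f'.injective.ne (show (0 : Fin 3) ≠ 1 by decide))
    (f'.injective.ne (show (0 : Fin 3) ≠ 2 by decide))
    (f'.injective.ne (show (1 : Fin 3) ≠ 2 by decide))
  refine htri.cluster_ne ?_
  change (edgeLabel (edgeFrom (.tri s i t h f') 0)).cluster =
    (edgeLabel (edgeFrom (.tri s i t h f') 1)).cluster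
  rw [← hedge, ← hedge]
  rfl

theorem eq_of_edgeFrom_eq {n : ℕ} (x y : X.OrderedSimplex (n + 1))
    (h : ∀ j, edgeFrom x j = edgeFrom y j) : x = y := by
  cases n with
  | zero => rw [← edgeFrom_zero x 0, ← edgeFrom_zero y 0, h]
  | succ n =>
    cases x with
    | tri =>
      cases y with
      | star => exact (not_star_edgeFrom_eq_tri fun j => (h j).symm).elim
      | tri => exact tri_eq_of_edgeFrom_eq h
    | star e he f hf =>
      cases y with
      | tri => exact (not_star_edgeFrom_eq_tri h).elim
      | star e' he' f' hf' =>
        have hlabel := fun j => congrArg edgeLabel (h j)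
        simp only [edgeLabel_edgeFrom_star, EdgeLabel.seg.injEq] at hlabel
        exact star_eq_iff.2 ⟨(hlabel 0).1, Fin.cases (hlabel 0).2.1 fun j => (hlabel j).2.2⟩

theorem exists_star_of_cluster_eq {d : X.OrderedSimplex 1} {e : X.E} {c : StarCode X}
    (hd : (edgeLabel d).cluster = some (e, c)) :
    ∃ (he : e ∈ X.vertical) (f : Fin 2 ↪ X.StarCorner e) (hf : Spans f),
      d = .star e he f hf ∧ (f 0).code = c := by
  cases d with
  | hor e he b => simp [edgeLabel, EdgeLabel.cluster] at hd
  | star e' he f hf =>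
    simp only [EdgeLabel.cluster, edgeLabel, Option.some.injEq, Prod.mk.injEq] at hd
    obtain ⟨rfl, hc⟩ := hd
    exact ⟨he, f, hf, rfl, hc⟩

theorem spans_iff_of_ne {n : ℕ} {e : X.E} {f : Fin (n + 1) ↪ X.StarCorner e} :
    Spans f ↔ ∀ j k, j ≠ k → f j = .apex false → f k ≠ .apex true := by
  refine ⟨fun hf j k _ => hf j k, fun hf j k hj hk => ?_⟩
  by_cases hjk : j = k
  · rw [hjk, hk] at hj
    simp at hj
  · exact hf j k hjk hj hk

theorem exists_simplex_of_clusterAdj {n : ℕ} (d : Fin (n + 2) → X.OrderedSimplex 1)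
    (h : ∀ j k, j ≠ k →
      ClusterAdj EdgeLabel.cluster EdgeLabel.Opposite (edgeLabel (d j)) (edgeLabel (d k))) :
    ∃ x : X.OrderedSimplex (n + 2), ∀ j, edgeFrom x j = d j := by
  obtain ⟨⟨e, c⟩, hec⟩ := Option.ne_none_iff_exists'.1 (h 0 1 (by simp)).1
  have hcluster : ∀ j, (edgeLabel (d j)).cluster = some (e, c) := fun j => by
    by_cases hj : j = 0
    · rw [hj, hec]
    · rw [(h j 0 hj).2.1, hec]
  choose he f hf hd hc using fun j => exists_star_of_cluster_eq (hcluster j)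
  have hfirst : ∀ j, f j 0 = f 0 0 := fun j => StarCorner.code_injective ((hc j).trans (hc 0).symm)
  have hlabel : ∀ j, edgeLabel (d j) = .seg e c (f j 1).code := fun j => by
    rw [hd, ← hc j]
    rfl
  let g : Fin (n + 2) ↪ X.StarCorner e := ⟨fun j => f j 1, fun j k (hjk : f j 1 = f k 1) => by
    by_contra hne
    exact (h j k hne).2.2.1 (by rw [hlabel, hlabel, hjk])⟩
  have hg : f 0 0 ∉ range g := by
    rintro ⟨j, hj⟩
    exact (f j).injective.ne (show (1 : Fin 2) ≠ 0 by decide) (hj.trans (hfirst j).symm)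
  have hspans : Spans (Fin.Embedding.cons g hg) := by
    refine spans_iff_of_ne.2 fun j k hjk => ?_
    induction j using Fin.cases <;> induction k using Fin.cases
    · exact absurd rfl hjk
    · rw [Fin.Embedding.coe_cons, Fin.cons_zero, Fin.cons_succ, ← hfirst]
      exact hf _ 0 1
    · rw [Fin.Embedding.coe_cons, Fin.cons_zero, Fin.cons_succ, ← hfirst]
      exact hf _ 1 0
    · intro hj hk
      refine (h _ _ (ne_of_apply_ne Fin.succ hjk)).2.2.2 ⟨e, c, false, ?_, ?_⟩
      · exact (hlabel _).trans (congrArg _ (congrArg StarCorner.code hj))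
      · exact (hlabel _).trans (congrArg _ (congrArg StarCorner.code hk))
  refine ⟨.star e (he 0) (Fin.Embedding.cons g hg) hspans, fun j => edgeLabel_injective ?_⟩
  rw [hlabel, ← hc 0]
  rfl

theorem link_adj_iff {v : X.OrderedSimplex 0} (p q : (X.simplexification.link v).simplex 0) :
    (X.simplexification.link v).Adj p q ↔
      ∃ x : X.OrderedSimplex 2, edgeFrom x 0 = p.1 ∧ edgeFrom x 1 = q.1 := by
  constructor
  · rintro ⟨x, rfl, rfl⟩
    exact ⟨x.1, rfl, rfl⟩
  · rintro ⟨x, h0, h1⟩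
    refine ⟨⟨x, ?_⟩, Subtype.ext h0, Subtype.ext h1⟩
    rw [← p.2, ← h0]
    exact (vertex_edgeFrom x 0).symm

theorem labelAdj_of_adj {v : X.OrderedSimplex 0} {p q : (X.simplexification.link v).simplex 0}
    (h : (X.simplexification.link v).Adj p q) : LabelAdj (edgeLabel p.1) (edgeLabel q.1) := by
  obtain ⟨x, h0, h1⟩ := (link_adj_iff p q).1 h
  rw [← h0, ← h1]
  exact labelAdj_edgeFrom x (by decide)

theorem adj_of_clusterAdj {v : X.OrderedSimplex 0} {p q : (X.simplexification.link v).simplex 0}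
    (h : ClusterAdj EdgeLabel.cluster EdgeLabel.Opposite (edgeLabel p.1) (edgeLabel q.1)) :
    (X.simplexification.link v).Adj p q := by
  obtain ⟨x, hx⟩ := exists_simplex_of_clusterAdj (n := 0) ![p.1, q.1] (by
    intro j k hjk
    fin_cases j <;> fin_cases k
    · exact absurd rfl hjk
    · exact h
    · exact h.symm fun _ _ => EdgeLabel.Opposite.symm
    · exact absurd rfl hjk)
  exact (link_adj_iff p q).2 ⟨x, hx 0, hx 1⟩

theorem edgeLabel_link_ne {v : X.OrderedSimplex 0} {p q : (X.simplexification.link v).simplex 0}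
    (h : p ≠ q) : edgeLabel p.1 ≠ edgeLabel q.1 :=
  edgeLabel_injective.ne (Subtype.val_injective.ne h)

theorem exists_simplex_of_adj (hX : X.toSquareComplex.IsNonpositivelyCurved)
    {v : X.OrderedSimplex 0} {n : ℕ} {p : Fin (n + 1) → (X.simplexification.link v).simplex 0}
    (hp : Function.Injective p)
    (hadj : ∀ j k, j ≠ k → (X.simplexification.link v).Adj (p j) (p k)) :
    ∃ x : X.OrderedSimplex (n + 1), ∀ j, edgeFrom x j = (p j).1 := by
  match n, p with
  | 0, p =>
    refine ⟨(p 0).1, fun j => (edgeFrom_zero _ j).trans ?_⟩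
    rw [Subsingleton.elim (α := Fin 1) j 0]
  | 1, p =>
    obtain ⟨x, hx⟩ := (link_adj_iff _ _).1 (hadj 0 1 (by decide))
    exact ⟨x, Fin.forall_fin_two.2 hx⟩
  | n + 2, p =>
    refine exists_simplex_of_clusterAdj _ fun j k hjk => ?_
    obtain ⟨l, hlj, hlk⟩ := Fin.exists_ne_and_ne_of_two_lt j k (show 2 < n + 3 by lia)
    exact (labelAdj_of_adj (hadj j k hjk)).resolve_right <|
      (isClusterGraph_edgeLabel hX).not_cross_of_triangle (edgeLabel_link_ne (hp.ne hlj.symm))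
        (edgeLabel_link_ne (hp.ne hlk.symm)) (labelAdj_of_adj (hadj j l hlj.symm))
        (labelAdj_of_adj (hadj k l hlk.symm))

theorem isFlag_link (hX : X.toSquareComplex.IsNonpositivelyCurved) (v : X.OrderedSimplex 0) :
    (X.simplexification.link v).IsFlag := by
  refine isFlag_of_vertex (fun n x j k h => ?_) (fun n x y h => ?_) fun n p hp hadj => ?_
  · exact edgeFrom_injective x.1 (congrArg Subtype.val h)
  · exact Subtype.ext (eq_of_edgeFrom_eq x.1 y.1 fun j => congrArg Subtype.val (h j))
  · obtain ⟨x, hx⟩ := exists_simplex_of_adj hX hp hadj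
    refine ⟨⟨x, ?_⟩, fun j => Subtype.ext (hx j)⟩
    rw [← (p 0).2, ← hx 0]
    exact (vertex_edgeFrom x 0).symm

theorem exists_labelAdj_cycle {v : X.OrderedSimplex 0} {k : ℕ}
    (h : (X.simplexification.link v).HasCycleWithoutDiagonals k) :
    ∃ l : ZMod k → EdgeLabel X, Function.Injective l ∧ (∀ i, LabelAdj (l i) (l (i + 1))) ∧
      ∀ i j, i ≠ j → j ≠ i + 1 → i ≠ j + 1 →
        ¬ ClusterAdj EdgeLabel.cluster EdgeLabel.Opposite (l i) (l j) := by
  obtain ⟨p, hp, hadj, hdiag⟩ := h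
  exact ⟨fun i => edgeLabel (p i).1,
    edgeLabel_injective.comp (Subtype.val_injective.comp hp),
    fun i => labelAdj_of_adj (hadj i), fun i j hij hj hi hcluster =>
      (hdiag i j hij (adj_of_clusterAdj hcluster)).elim hj hi⟩

theorem isLocallySixLarge_simplexification (hX : X.toSquareComplex.IsNonpositivelyCurved) :
    X.simplexification.IsLocallySixLarge := by
  have hC := isClusterGraph_edgeLabel hX
  refine fun v => ⟨isFlag_link hX v, fun hcycle => ?_, fun hcycle => ?_⟩
  · obtain ⟨l, hl, hadj, hdiag⟩ := exists_labelAdj_cycle hcycle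
    exact hC.not_square (hadj 0) (hadj 1) (hadj 2) (hadj 3) (hl.ne (by decide))
      (hl.ne (by decide)) (hdiag 0 2 (by decide) (by decide) (by decide))
      (hdiag 1 3 (by decide) (by decide) (by decide))
  · obtain ⟨l, hl, hadj, hdiag⟩ := exists_labelAdj_cycle hcycle
    exact hC.not_pentagon (hadj 0) (hadj 1) (hadj 2) (hadj 3) (hadj 4) (hl.ne (by decide))
      (hl.ne (by decide)) (hl.ne (by decide)) (hl.ne (by decide)) (hl.ne (by decide))
      (hdiag 0 2 (by decide) (by decide) (by decide))
      (hdiag 1 3 (by decide) (by decide) (by decide))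

end VHComplex

/-! ### Actions on square complexes -/

namespace SquareComplex.Action

variable {Y : SquareComplex.{u}} {G : Type*} [Group G] (ρ : Y.Action G)

/-- The induced map from the ends of an edge to those of its image. -/
def endMap (g : G) (e : Y.E) (b : Bool) : Bool := (ρ.onEdge g (e, b)).2

theorem onEdge_eq (g : G) (e : Y.E) (b : Bool) :
    ρ.onEdge g (e, b) = (ρ.edgeMap g e, ρ.endMap g e b) := by
  cases b with
  | false => rfl
  | true =>
    have h := congrArg Prod.fst (ρ.rev_eq g (e, false))
    exact Prod.ext h rfl

theorem endMap_not (g : G) (e : Y.E) (b : Bool) : ρ.endMap g e (!b) = !ρ.endMap g e b :=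
  congrArg Prod.snd (ρ.rev_eq g (e, b))

theorem endMap_injective (g : G) (e : Y.E) : Function.Injective (ρ.endMap g e) := by
  intro a b h
  by_contra hne
  rw [Bool.eq_not_of_ne hne, endMap_not] at h
  simp at h

theorem onEdge_mul (g h : G) (e : Y.E) (b : Bool) :
    (ρ.edgeMap (g * h) e, ρ.endMap (g * h) e b) =
      (ρ.edgeMap g (ρ.edgeMap h e), ρ.endMap g (ρ.edgeMap h e) (ρ.endMap h e b)) := by
  rw [← onEdge_eq, ← onEdge_eq, ← onEdge_eq, map_mul, Equiv.Perm.mul_apply]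

theorem edgeMap_mul (g h : G) (e : Y.E) : ρ.edgeMap (g * h) e = ρ.edgeMap g (ρ.edgeMap h e) :=
  (Prod.mk.inj (ρ.onEdge_mul g h e false)).1

theorem endMap_mul (g h : G) (e : Y.E) (b : Bool) :
    ρ.endMap (g * h) e b = ρ.endMap g (ρ.edgeMap h e) (ρ.endMap h e b) :=
  (Prod.mk.inj (ρ.onEdge_mul g h e b)).2

theorem edgeMap_one (e : Y.E) : ρ.edgeMap 1 e = e := by
  rw [edgeMap, map_one, Equiv.Perm.one_apply]

theorem endMap_one (e : Y.E) (b : Bool) : ρ.endMap 1 e b = b := by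
  rw [endMap, map_one, Equiv.Perm.one_apply]

theorem onVertex_ends (g : G) (e : Y.E) (b : Bool) :
    ρ.onVertex g (Y.ends e b) = Y.ends (ρ.edgeMap g e) (ρ.endMap g e b) := by
  have h := ρ.origin_eq g (e, b)
  rw [onEdge_eq] at h
  exact h.symm

theorem onCorner_fst (g : G) (q : Y.Corner) : (ρ.onCorner g q).1 = ρ.squareMap g q.1 := by
  have onCorner_nextCorner (q : Y.Corner) (i : Bool) :
      (ρ.onCorner g (Y.nextCorner q i)).1 = (ρ.onCorner g q).1 := by
    obtain ⟨π, hπ⟩ := ρ.corner_eq g q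
    have h := congrArg Prod.fst (hπ i).2
    exact h
  have onCorner_update (q : Y.Corner) (i : Bool) :
      (ρ.onCorner g (q.1, Function.update q.2 i false)).1 = (ρ.onCorner g q).1 := by
    cases hi : q.2 i with
    | false => rw [← hi, Function.update_eq_self]
    | true => simpa only [nextCorner, hi, Bool.not_true] using onCorner_nextCorner q i
  have hzero : Function.update (Function.update q.2 false false) true false = fun _ => false := by
    funext k
    cases k <;> rfl
  rw [← onCorner_update q false, ← onCorner_update (q.1, Function.update q.2 false false) true,
    hzero]
  rfl

theorem squareMap_mul (g h : G) (s : Y.S) :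
    ρ.squareMap (g * h) s = ρ.squareMap g (ρ.squareMap h s) := by
  rw [← onCorner_fst ρ h (s, fun _ => false), ← onCorner_fst, ← Equiv.Perm.mul_apply, ← map_mul,
    onCorner_fst]

theorem squareMap_one (s : Y.S) : ρ.squareMap 1 s = s := by
  rw [squareMap, map_one, Equiv.Perm.one_apply]

/-- The action on the cells of all dimensions. -/
def cellMap (g : G) : Y.V ⊕ Y.E ⊕ Y.S → Y.V ⊕ Y.E ⊕ Y.S :=
  Sum.map (ρ.onVertex g) (Sum.map (ρ.edgeMap g) (ρ.squareMap g))

theorem cellMap_inv_cellMap (g : G) (c : Y.V ⊕ Y.E ⊕ Y.S) :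
    ρ.cellMap g⁻¹ (ρ.cellMap g c) = c := by
  rcases c with v | e | s
  · simp [cellMap]
  · simp [cellMap, ← edgeMap_mul, edgeMap_one]
  · simp [cellMap, ← squareMap_mul, squareMap_one]

theorem squareMap_injective (g : G) : Function.Injective (ρ.squareMap g) :=
  Function.LeftInverse.injective (g := ρ.squareMap g⁻¹) fun s => by
    rw [← squareMap_mul, inv_mul_cancel, squareMap_one]

variable {ρ}

theorem IsGeometric.finite_edgeMap_eq (hρ : ρ.IsGeometric) (e e' : Y.E) :
    {g : G | ρ.edgeMap g e = e'}.Finite := by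
  rcases Set.eq_empty_or_nonempty {g : G | ρ.edgeMap g e = e'} with hempty | ⟨g₀, rfl⟩
  · exact hempty ▸ finite_empty
  refine ((hρ.1.2.1 e).image fun k => g₀ * k).subset fun g hg => ⟨g₀⁻¹ * g, ?_, by simp⟩
  change ρ.edgeMap g e = ρ.edgeMap g₀ e at hg
  change ρ.edgeMap (g₀⁻¹ * g) e = e
  rw [edgeMap_mul, hg, ← edgeMap_mul, inv_mul_cancel, edgeMap_one]

theorem IsGeometric.finite_cellMap_eq_self (hρ : ρ.IsGeometric) (c : Y.V ⊕ Y.E ⊕ Y.S) :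
    {g : G | ρ.cellMap g c = c}.Finite := by
  rcases c with v | e | s
  · exact (hρ.1.1 v).subset fun g hg => Sum.inl.inj hg
  · exact (hρ.1.2.1 e).subset fun g hg => Sum.inl.inj (Sum.inr.inj hg)
  · exact (hρ.1.2.2 s).subset fun g hg => Sum.inr.inj (Sum.inr.inj hg)

theorem IsGeometric.exists_finite_cells (hρ : ρ.IsGeometric) :
    ∃ D : Set (Y.V ⊕ Y.E ⊕ Y.S), D.Finite ∧ ∀ c, ∃ g, ∃ d ∈ D, ρ.cellMap g d = c := by
  obtain ⟨-, ⟨A, hA, hA'⟩, ⟨B, hB, hB'⟩, ⟨C, hC, hC'⟩⟩ := hρ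
  refine ⟨Sum.inl '' A ∪ Sum.inr '' (Sum.inl '' B ∪ Sum.inr '' C),
    (hA.image _).union (((hB.image _).union (hC.image _)).image _), ?_⟩
  rintro (v | e | s)
  · obtain ⟨g, w, hw, rfl⟩ := hA' v
    exact ⟨g, .inl w, .inl ⟨w, hw, rfl⟩, rfl⟩
  · obtain ⟨g, f, hf, rfl⟩ := hB' e
    exact ⟨g, .inr (.inl f), .inr ⟨_, .inl ⟨f, hf, rfl⟩, rfl⟩, rfl⟩
  · obtain ⟨g, r, hr, rfl⟩ := hC' s
    exact ⟨g, .inr (.inr r), .inr ⟨_, .inr ⟨r, hr, rfl⟩, rfl⟩, rfl⟩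

end SquareComplex.Action

namespace VHComplex

open GenSimplicialComplex

variable {X : VHComplex.{u}}

theorem corner_self (q : X.Corner) : corner q.1 (q.2 (hdir q.1)) (q.2 (!hdir q.1)) = q := by
  refine Prod.ext rfl (funext fun k => ?_)
  rcases Bool.eq_or_eq_not k (hdir q.1) with rfl | rfl <;> simp [corner]

theorem nextCorner_hdir (s : X.S) (a t : Bool) :
    X.nextCorner (corner s a t) (hdir s) = corner s (!a) t := by
  refine Prod.ext rfl (funext fun k => ?_)
  rcases Bool.eq_or_eq_not k (hdir s) with rfl | rfl <;> simp [corner, SquareComplex.nextCorner]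

theorem nextCorner_not_hdir (s : X.S) (a t : Bool) :
    X.nextCorner (corner s a t) (!hdir s) = corner s a (!t) := by
  refine Prod.ext rfl (funext fun k => ?_)
  rcases Bool.eq_or_eq_not k (hdir s) with rfl | rfl <;> simp [corner, SquareComplex.nextCorner]

variable {G : Type*} [Group G] (ρ : X.toSquareComplex.Action G)

/-- Whether `g` reverses the horizontal coordinate of a square. -/
noncomputable def hflip (g : G) (s : X.S) : Bool :=
  (ρ.onCorner g (corner s false false)).2 (hdir (ρ.squareMap g s))

/-- Whether `g` reverses the vertical coordinate of a square. -/
noncomputable def vflip (g : G) (s : X.S) : Bool :=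
  (ρ.onCorner g (corner s false false)).2 (!hdir (ρ.squareMap g s))

variable {ρ}

theorem onCorner_corner_false_false (g : G) (s : X.S) : ρ.onCorner g (corner s false false) =
    corner (ρ.squareMap g s) (hflip ρ g s) (vflip ρ g s) := by
  have h : (ρ.onCorner g (corner s false false)).1 = ρ.squareMap g s := ρ.onCorner_fst g _
  conv_lhs => rw [← corner_self (ρ.onCorner g (corner s false false)), h]
  rfl

variable (hρ : PreservesVH ρ)

include hρ

theorem exists_perm_hdir (g : G) (q : X.Corner) : ∃ π : Equiv.Perm Bool,
    π (hdir q.1) = hdir (ρ.squareMap g q.1) ∧ π (!hdir q.1) = (!hdir (ρ.squareMap g q.1)) ∧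
      ∀ i, ρ.onEdge g (X.cornerEdge q i) = X.cornerEdge (ρ.onCorner g q) (π i) ∧
        ρ.onCorner g (X.nextCorner q i) = X.nextCorner (ρ.onCorner g q) (π i) := by
  obtain ⟨π, hπ⟩ := ρ.corner_eq g q
  have hhor : π (hdir q.1) = hdir (ρ.squareMap g q.1) := by
    have hedge := congrArg Prod.fst (hπ (hdir q.1)).1
    have hnot : (ρ.onEdge g (X.cornerEdge q (hdir q.1))).1 ∉ X.vertical := by
      rw [← Prod.mk.eta (p := X.cornerEdge q (hdir q.1)), ρ.onEdge_eq]
      exact fun h => side_hdir_notMem _ _ ((hρ _ _).1 h)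
    rw [hedge] at hnot
    rw [← ρ.onCorner_fst]
    exact eq_hdir hnot
  refine ⟨π, hhor, ?_, hπ⟩
  rw [← hhor]
  exact Bool.eq_not_of_ne (π.injective.ne (by simp))

theorem onCorner_corner (g : G) (s : X.S) (a t : Bool) : ρ.onCorner g (corner s a t) =
    corner (ρ.squareMap g s) (a ^^ hflip ρ g s) (t ^^ vflip ρ g s) := by
  have next_hor {a t a' t' : Bool} (h : ρ.onCorner g (corner s a t) =
      corner (ρ.squareMap g s) a' t') :
      ρ.onCorner g (corner s (!a) t) = corner (ρ.squareMap g s) (!a') t' := by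
    obtain ⟨π, hhor, -, hπ⟩ := exists_perm_hdir hρ g (corner s a t)
    have hnext := (hπ (hdir s)).2
    rw [show π (hdir s) = _ from hhor, h] at hnext
    exact (congrArg _ (nextCorner_hdir s a t)).symm.trans (hnext.trans (nextCorner_hdir _ _ _))
  have next_ver {a t a' t' : Bool} (h : ρ.onCorner g (corner s a t) =
      corner (ρ.squareMap g s) a' t') :
      ρ.onCorner g (corner s a !t) = corner (ρ.squareMap g s) a' !t' := by
    obtain ⟨π, -, hver, hπ⟩ := exists_perm_hdir hρ g (corner s a t)
    have hnext := (hπ (!hdir s)).2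
    rw [show π (!hdir s) = _ from hver, h] at hnext
    exact (congrArg _ (nextCorner_not_hdir s a t)).symm.trans
      (hnext.trans (nextCorner_not_hdir _ _ _))
  have h00 := onCorner_corner_false_false (ρ := ρ) g s
  cases a <;> cases t <;> simp only [Bool.false_xor, Bool.true_xor]
  · exact h00
  · exact next_ver h00
  · exact next_hor h00
  · exact next_ver (next_hor h00)

theorem onEdge_horizontal_side (g : G) (s : X.S) (a t : Bool) :
    ρ.onEdge g (X.side s (hdir s) t, a ^^ X.reversed s (hdir s) t) =
      (X.side (ρ.squareMap g s) (hdir (ρ.squareMap g s)) (t ^^ vflip ρ g s),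
        (a ^^ hflip ρ g s) ^^
          X.reversed (ρ.squareMap g s) (hdir (ρ.squareMap g s)) (t ^^ vflip ρ g s)) := by
  obtain ⟨π, hhor, -, hπ⟩ := exists_perm_hdir hρ g (corner s a t)
  have hedge := (hπ (hdir s)).1
  rw [show π (hdir s) = _ from hhor, onCorner_corner hρ] at hedge
  exact (congrArg _ (cornerEdge_hdir s a t)).symm.trans (hedge.trans (cornerEdge_hdir _ _ _))

theorem onEdge_vertical_side (g : G) (s : X.S) (a t : Bool) :
    ρ.onEdge g (X.side s (!hdir s) a, t ^^ X.reversed s (!hdir s) a) =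
      (X.side (ρ.squareMap g s) (!hdir (ρ.squareMap g s)) (a ^^ hflip ρ g s),
        (t ^^ vflip ρ g s) ^^
          X.reversed (ρ.squareMap g s) (!hdir (ρ.squareMap g s)) (a ^^ hflip ρ g s)) := by
  obtain ⟨π, -, hver, hπ⟩ := exists_perm_hdir hρ g (corner s a t)
  have hedge := (hπ (!hdir s)).1
  rw [show π (!hdir s) = _ from hver, onCorner_corner hρ] at hedge
  exact (congrArg _ (cornerEdge_not_hdir s a t)).symm.trans
    (hedge.trans (cornerEdge_not_hdir _ _ _))

theorem edgeMap_vertical_side (g : G) (s : X.S) (a : Bool) :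
    ρ.edgeMap g (X.side s (!hdir s) a) =
      X.side (ρ.squareMap g s) (!hdir (ρ.squareMap g s)) (a ^^ hflip ρ g s) := by
  have h := onEdge_vertical_side hρ g s a false
  rw [ρ.onEdge_eq] at h
  exact (Prod.mk.inj h).1

theorem flip_mul (g h : G) (s : X.S) :
    hflip ρ (g * h) s = (hflip ρ h s ^^ hflip ρ g (ρ.squareMap h s)) ∧
      vflip ρ (g * h) s = (vflip ρ h s ^^ vflip ρ g (ρ.squareMap h s)) := by
  have hcorner : ρ.onCorner (g * h) (corner s false false) =
      ρ.onCorner g (ρ.onCorner h (corner s false false)) := by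
    rw [map_mul, Equiv.Perm.mul_apply]
  rw [onCorner_corner_false_false, onCorner_corner_false_false, onCorner_corner hρ] at hcorner
  exact (corner_injective hcorner).2

omit hρ in
theorem flip_one (s : X.S) : hflip ρ 1 s = false ∧ vflip ρ 1 s = false := by
  have hcorner : ρ.onCorner 1 (corner s false false) = corner s false false := by
    rw [map_one, Equiv.Perm.one_apply]
  rw [onCorner_corner_false_false] at hcorner
  exact (corner_injective hcorner).2

end VHComplex

/-! ### The induced action on the simplexification -/

namespace VHComplex

open GenSimplicialComplex

variable {X : VHComplex.{u}} {G : Type*} [Group G] {ρ : X.toSquareComplex.Action G}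

variable (hρ : PreservesVH ρ)

include hρ

theorem edgeMap_mem_vertical {g : G} {e : X.E} (he : e ∈ X.vertical) :
    ρ.edgeMap g e ∈ X.vertical :=
  (hρ g e).2 he

theorem edgeMap_notMem_vertical {g : G} {e : X.E} (he : e ∉ X.vertical) :
    ρ.edgeMap g e ∉ X.vertical :=
  fun h => he ((hρ g e).1 h)

/-- The induced map from the corners of the star of `e*` to those of the star of `(g e)*`. -/
noncomputable def starCornerMap (g : G) {e : X.E} (he : e ∈ X.vertical) :
    X.StarCorner e → X.StarCorner (ρ.edgeMap g e)
  | .apex b => .apex (ρ.endMap g e b)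
  | .center => .center
  | .square s i t h => .square (ρ.squareMap g s) (!hdir (ρ.squareMap g s)) (t ^^ hflip ρ g s) (by
      obtain rfl := eq_not_hdir (h ▸ he)
      rw [← edgeMap_vertical_side hρ, h])

theorem starCornerMap_injective (g : G) {e : X.E} (he : e ∈ X.vertical) :
    Function.Injective (starCornerMap hρ g he) := by
  intro x y hxy
  cases x <;> cases y <;> simp only [starCornerMap, reduceCtorEq, StarCorner.apex.injEq,
    StarCorner.square.injEq] at hxy
  case apex.apex => exact congrArg _ (ρ.endMap_injective g e hxy)
  case center.center => rfl
  case square.square s i t h s' i' t' h' =>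
    obtain rfl := ρ.squareMap_injective g hxy.1
    obtain rfl := (eq_not_hdir (h ▸ he)).trans (eq_not_hdir (h' ▸ he)).symm
    simp only [true_and, Bool.xor_left_inj] at hxy
    subst hxy
    rfl

/-- `starCornerMap` as an embedding. -/
noncomputable def starCornerEmb (g : G) {e : X.E} (he : e ∈ X.vertical) :
    X.StarCorner e ↪ X.StarCorner (ρ.edgeMap g e) :=
  ⟨starCornerMap hρ g he, starCornerMap_injective hρ g he⟩

theorem exists_apex_of_starCornerMap_eq_apex {g : G} {e : X.E} (he : e ∈ X.vertical)
    {c : X.StarCorner e} {b : Bool} (h : starCornerMap hρ g he c = .apex b) :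
    ∃ b', c = .apex b' ∧ ρ.endMap g e b' = b := by
  cases c <;> simp only [starCornerMap, reduceCtorEq, StarCorner.apex.injEq] at h
  exact ⟨_, rfl, h⟩

theorem spans_starCornerEmb (g : G) {e : X.E} (he : e ∈ X.vertical) {n : ℕ}
    {f : Fin (n + 1) ↪ X.StarCorner e} (hf : Spans f) :
    Spans (f.trans (starCornerEmb hρ g he)) := by
  intro j k hj hk
  obtain ⟨b, hb, hgb⟩ := exists_apex_of_starCornerMap_eq_apex hρ he hj
  obtain ⟨c, hc, hgc⟩ := exists_apex_of_starCornerMap_eq_apex hρ he hk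
  cases b <;> cases c
  · simp [hgb] at hgc
  · exact hf _ _ hb hc
  · exact hf _ _ hc hb
  · simp [hgb] at hgc

omit hρ in
/-- The induced map on the corners of a triangle of the square `s` with a horizontal side. -/
noncomputable def triCornerEmb (ρ : X.toSquareComplex.Action G) (g : G) (s : X.S) :
    Option Bool ↪ Option Bool where
  toFun := Option.map fun a => a ^^ hflip ρ g s
  inj' := Option.map_injective fun _ _ h => Bool.xor_left_inj.1 h

/-- The induced action on the ordered simplices of the simplexification. -/
noncomputable def simplexMap (g : G) : ∀ {n : ℕ}, X.OrderedSimplex n → X.OrderedSimplex n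
  | _, .vert v => .vert (ρ.onVertex g v)
  | _, .edge e he => .edge (ρ.edgeMap g e) (edgeMap_mem_vertical hρ he)
  | _, .square s => .square (ρ.squareMap g s)
  | _, .hor e he b => .hor (ρ.edgeMap g e) (edgeMap_notMem_vertical hρ he) (ρ.endMap g e b)
  | _, .tri s _ t _ f => .tri (ρ.squareMap g s) (hdir (ρ.squareMap g s)) (t ^^ vflip ρ g s)
      (side_hdir_notMem _ _) (f.trans (triCornerEmb ρ g s))
  | _, .star e he f hf => .star (ρ.edgeMap g e) (edgeMap_mem_vertical hρ he)
      (f.trans (starCornerEmb hρ g he)) (spans_starCornerEmb hρ g he hf)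

omit hρ in
theorem tri_congr {s s' : X.S} {i i' t t' : Bool} {h : X.side s i t ∉ X.vertical}
    {h' : X.side s' i' t' ∉ X.vertical} {f f' : Fin 3 ↪ Option Bool} (hs : s = s') (hi : i = i')
    (ht : t = t') (hf : ∀ j, f j = f' j) :
    OrderedSimplex.tri s i t h f = .tri s' i' t' h' f' := by
  subst hs hi ht
  rw [Function.Embedding.ext hf]

theorem simplexMap_one {n : ℕ} (x : X.OrderedSimplex n) : simplexMap hρ 1 x = x := by
  cases x with
  | vert v => simp [simplexMap]
  | edge e he => simp only [simplexMap, ρ.edgeMap_one]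
  | square s => simp only [simplexMap, ρ.squareMap_one]
  | hor e he b => simp only [simplexMap, ρ.edgeMap_one, ρ.endMap_one]
  | tri s i t h f =>
    obtain ⟨hhor, hver⟩ := flip_one (ρ := ρ) s
    refine tri_congr (ρ.squareMap_one s) (by rw [ρ.squareMap_one, eq_hdir h])
      (by rw [hver, Bool.xor_false]) fun j => ?_
    simp [triCornerEmb, hhor]
  | star e he f hf =>
    refine star_eq_iff.2 ⟨ρ.edgeMap_one e, fun j => ?_⟩
    change (starCornerMap hρ 1 he (f j)).code = _
    cases f j with
    | apex b => exact congrArg _ (ρ.endMap_one e b)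
    | center => rfl
    | square s i t h =>
      simp only [starCornerMap, StarCorner.code, ρ.squareMap_one, (flip_one (ρ := ρ) s).1,
        Bool.xor_false, ← eq_not_hdir (h ▸ he)]

theorem simplexMap_mul (g h : G) {n : ℕ} (x : X.OrderedSimplex n) :
    simplexMap hρ (g * h) x = simplexMap hρ g (simplexMap hρ h x) := by
  cases x with
  | vert v => simp [simplexMap]
  | edge e he => simp only [simplexMap, ρ.edgeMap_mul]
  | square s => simp only [simplexMap, ρ.squareMap_mul]
  | hor e he b => simp only [simplexMap, ρ.edgeMap_mul, ρ.endMap_mul]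
  | tri s i t hs f =>
    obtain ⟨hhor, hver⟩ := flip_mul hρ g h s
    refine tri_congr (ρ.squareMap_mul g h s) (by rw [ρ.squareMap_mul])
      (by rw [hver, Bool.xor_assoc]) fun j => ?_
    simp [triCornerEmb, hhor, Function.comp_def]
  | star e he f hf =>
    refine star_eq_iff.2 ⟨ρ.edgeMap_mul g h e, fun j => ?_⟩
    change (starCornerMap hρ (g * h) he (f j)).code =
      (starCornerMap hρ g (edgeMap_mem_vertical hρ he) (starCornerMap hρ h he (f j))).code
    cases f j with
    | apex b => exact congrArg _ (ρ.endMap_mul g h e b)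
    | center => rfl
    | square s i t hs =>
      simp only [starCornerMap, StarCorner.code, ρ.squareMap_mul, (flip_mul hρ g h s).1,
        Bool.xor_assoc]

theorem simplexMap_ofStar (g : G) {e : X.E} (he : e ∈ X.vertical) {m : ℕ}
    (f : Fin (m + 1) ↪ X.StarCorner e) (hf : Spans f) : simplexMap hρ g (ofStar he f hf) =
      ofStar (edgeMap_mem_vertical hρ he) (f.trans (starCornerEmb hρ g he))
        (spans_starCornerEmb hρ g he hf) := by
  cases m with
  | succ m => rfl
  | zero =>
    change simplexMap hρ g (starVertex he (f 0)) =
      starVertex (edgeMap_mem_vertical hρ he) (starCornerMap hρ g he (f 0))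
    cases f 0 with
    | apex b => exact congrArg OrderedSimplex.vert (ρ.onVertex_ends g e b)
    | center => rfl
    | square s i t h => rfl

theorem simplexMap_ofHor (g : G) (e : X.E) (he : e ∉ X.vertical) {m : ℕ}
    (f : Fin (m + 1) ↪ Bool) : simplexMap hρ g (ofHor e he f) =
      ofHor (ρ.edgeMap g e) (edgeMap_notMem_vertical hρ he)
        (f.trans ⟨ρ.endMap g e, ρ.endMap_injective g e⟩) := by
  match m, f with
  | 0, f => exact congrArg OrderedSimplex.vert (ρ.onVertex_ends g e (f 0))
  | 1, f => rfl
  | m + 2, f => exact absurd (Fintype.card_le_of_embedding f) (by simp)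

theorem simplexMap_hor_side (g : G) (s : X.S) (a t : Bool) :
    simplexMap hρ g (.hor (X.side s (hdir s) t) (side_hdir_notMem s t)
        (a ^^ X.reversed s (hdir s) t)) =
      .hor (X.side (ρ.squareMap g s) (hdir (ρ.squareMap g s)) (t ^^ vflip ρ g s))
        (side_hdir_notMem _ _) ((a ^^ hflip ρ g s) ^^
          X.reversed (ρ.squareMap g s) (hdir (ρ.squareMap g s)) (t ^^ vflip ρ g s)) := by
  have h := onEdge_horizontal_side hρ g s a t
  rw [ρ.onEdge_eq] at h
  obtain ⟨hedge, hend⟩ := Prod.mk.inj h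
  simp only [simplexMap, hedge, hend]

theorem simplexMap_triEdge (g : G) (s : X.S) (t : Bool) {x y : Option Bool} (hxy : x ≠ y) :
    simplexMap hρ g (triEdge s (hdir s) t (side_hdir_notMem s t) x y) =
      triEdge (ρ.squareMap g s) (hdir (ρ.squareMap g s)) (t ^^ vflip ρ g s) (side_hdir_notMem _ _)
        (triCornerEmb ρ g s x) (triCornerEmb ρ g s y) := by
  have hvertical (a : Bool) := onEdge_vertical_side hρ g s a t
  simp only [ρ.onEdge_eq, Prod.mk.injEq] at hvertical
  apply edgeLabel_injective
  rcases x with _ | a <;> rcases y with _ | b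
  · exact absurd rfl hxy
  · obtain ⟨hedge, hend⟩ := hvertical b
    refine Eq.trans ?_ (edgeLabel_triEdge_none_some _ _ _ (side_hdir_notMem _ _) _).symm
    simp only [outLabel, ← hedge, ← hend]
    rfl
  · obtain ⟨hedge, hend⟩ := hvertical a
    refine Eq.trans ?_ (edgeLabel_triEdge_some_none _ _ _ (side_hdir_notMem _ _) _).symm
    simp only [inLabel, ← hedge, ← hend]
    rfl
  · exact congrArg edgeLabel (simplexMap_hor_side hρ g s a t)

theorem simplexMap_triVertex (g : G) (s : X.S) (t : Bool) (x : Option Bool) :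
    simplexMap hρ g (triVertex s (hdir s) t x) =
      triVertex (ρ.squareMap g s) (hdir (ρ.squareMap g s)) (t ^^ vflip ρ g s)
        (triCornerEmb ρ g s x) := by
  cases x with
  | none => rfl
  | some a =>
    have h := onEdge_horizontal_side hρ g s a t
    rw [ρ.onEdge_eq] at h
    obtain ⟨hedge, hend⟩ := Prod.mk.inj h
    refine congrArg OrderedSimplex.vert ((ρ.onVertex_ends g _ _).trans ?_)
    rw [hedge, hend]

theorem simplexMap_ofTri (g : G) (s : X.S) (t : Bool) {m : ℕ} (f : Fin (m + 1) ↪ Option Bool) :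
    simplexMap hρ g (ofTri s (hdir s) t (side_hdir_notMem s t) f) =
      ofTri (ρ.squareMap g s) (hdir (ρ.squareMap g s)) (t ^^ vflip ρ g s) (side_hdir_notMem _ _)
        (f.trans (triCornerEmb ρ g s)) := by
  match m, f with
  | 0, f => exact simplexMap_triVertex hρ g s t (f 0)
  | 1, f => exact simplexMap_triEdge hρ g s t (f.injective.ne (by decide))
  | 2, f => rfl
  | m + 3, f => exact absurd (Fintype.card_le_of_embedding f) (by simp)

theorem simplexMap_face (g : G) {m n : ℕ} (θ : Fin (m + 1) ↪ Fin (n + 1)) (x : X.OrderedSimplex n) :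
    simplexMap hρ g (simplexFace θ x) = simplexFace θ (simplexMap hρ g x) := by
  cases x with
  | vert v => obtain rfl := emb_fin_one θ; rfl
  | edge e he => obtain rfl := emb_fin_one θ; rfl
  | square s => obtain rfl := emb_fin_one θ; rfl
  | hor e he b =>
    refine (simplexMap_ofHor hρ g e he _).trans
      (congrArg (ofHor _ (edgeMap_notMem_vertical hρ he)) ?_)
    ext1 j
    have endMap_pairEmb (k : Fin 2) : ρ.endMap g e (pairEmb b (!b) (by simp) k) =
        pairEmb (ρ.endMap g e b) (!ρ.endMap g e b) (by simp) k := by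
      fin_cases k
      · rfl
      · exact ρ.endMap_not g e b
    exact endMap_pairEmb (θ j)
  | tri s i t h f =>
    obtain rfl := eq_hdir h
    exact simplexMap_ofTri hρ g s t _
  | star e he f hf => exact simplexMap_ofStar hρ g he _ _

/-- The action on the simplexification induced by an action on a `VH`-complex. -/
noncomputable def simplexificationAction : X.simplexification.Action G where
  act n :=
    letI : MulAction G (X.OrderedSimplex n) :=
      { smul := fun g x => simplexMap hρ g x
        one_smul := simplexMap_one hρ
        mul_smul := fun g h x => simplexMap_mul hρ g h x }
    MulAction.toPermHom G (X.OrderedSimplex n)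
  act_face g _ _ θ x := simplexMap_face hρ g θ x

end VHComplex

/-! ### Geometric actions -/

namespace VHComplex

open GenSimplicialComplex

variable {X : VHComplex.{u}}

/-- The cell of the square complex from which a simplex of the simplexification arises. -/
def carrier : ∀ {n : ℕ}, X.OrderedSimplex n → X.V ⊕ X.E ⊕ X.S
  | _, .vert v => .inl v
  | _, .edge e _ => .inr (.inl e)
  | _, .square s => .inr (.inr s)
  | _, .hor e _ _ => .inr (.inl e)
  | _, .tri s _ _ _ _ => .inr (.inr s)
  | _, .star e _ _ _ => .inr (.inl e)

theorem carrier_face {n : ℕ} (θ : Fin (n + 1) ↪ Fin (n + 1)) (x : X.OrderedSimplex n) :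
    carrier (simplexFace θ x) = carrier x := by
  cases x <;> rfl

theorem finite_carrier_eq_vertex (v : X.V) :
    {y : Σ n, X.OrderedSimplex n | carrier y.2 = .inl v}.Finite := by
  refine (finite_singleton (⟨0, .vert v⟩ : Σ n, X.OrderedSimplex n)).subset ?_
  rintro ⟨n, y⟩ hy
  cases y <;> simp only [carrier, mem_ofPred_eq, reduceCtorEq, Sum.inl.injEq] at hy
  rw [hy, mem_singleton_iff]

theorem finite_carrier_eq_vertical_edge {e : X.E} (he : e ∈ X.vertical)
    [Finite (X.StarCorner e)] :
    {y : Σ n, X.OrderedSimplex n | carrier y.2 = .inr (.inl e)}.Finite := by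
  have := Fintype.ofFinite (X.StarCorner e)
  let ofFaces : (Σ n : Fin (Fintype.card (X.StarCorner e)),
      {f : Fin (n.1 + 2) ↪ X.StarCorner e // Spans f}) → Σ n, X.OrderedSimplex n :=
    fun p => ⟨p.1.1 + 1, .star e he p.2.1 p.2.2⟩
  refine ((finite_singleton ⟨0, .edge e he⟩).union (finite_range ofFaces)).subset ?_
  rintro ⟨n, y⟩ hy
  cases y <;> simp only [carrier, mem_ofPred_eq, reduceCtorEq, Sum.inl.injEq, Sum.inr.injEq] at hy
  case edge e' he' =>
    subst hy
    exact .inl rfl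
  case hor e' he' b => exact absurd (hy ▸ he) he'
  case star n e' he' f hf =>
    subst hy
    have hn : n < Fintype.card (X.StarCorner e') := by
      have hcard := Fintype.card_le_of_embedding f
      rw [Fintype.card_fin] at hcard
      lia
    exact .inr ⟨⟨⟨n, hn⟩, f, hf⟩, rfl⟩

theorem finite_carrier_eq_horizontal_edge {e : X.E} (he : e ∉ X.vertical) :
    {y : Σ n, X.OrderedSimplex n | carrier y.2 = .inr (.inl e)}.Finite := by
  refine (finite_range fun b => (⟨1, .hor e he b⟩ : Σ n, X.OrderedSimplex n)).subset ?_
  rintro ⟨n, y⟩ hy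
  cases y <;> simp only [carrier, mem_ofPred_eq, reduceCtorEq, Sum.inl.injEq, Sum.inr.injEq] at hy
  case edge e' he' => exact absurd (hy ▸ he') he
  case hor e' he' b =>
    subst hy
    exact ⟨b, rfl⟩
  case star e' he' f hf => exact absurd (hy ▸ he') he

theorem finite_carrier_eq_square (s : X.S) :
    {y : Σ n, X.OrderedSimplex n | carrier y.2 = .inr (.inr s)}.Finite := by
  let ofCorners : Bool × (Fin 3 ↪ Option Bool) → Σ n, X.OrderedSimplex n :=
    fun p => ⟨2, .tri s (hdir s) p.1 (side_hdir_notMem s p.1) p.2⟩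
  refine ((finite_singleton ⟨0, .square s⟩).union (finite_range ofCorners)).subset ?_
  rintro ⟨n, y⟩ hy
  cases y <;> simp only [carrier, mem_ofPred_eq, reduceCtorEq, Sum.inr.injEq] at hy
  case square s' =>
    subst hy
    exact .inl rfl
  case tri s' i t h f =>
    subst hy
    obtain rfl := eq_hdir h
    exact .inr ⟨(t, f), rfl⟩

theorem finite_carrier_eq (hfin : ∀ e ∈ X.vertical, Finite (X.StarCorner e))
    (c : X.V ⊕ X.E ⊕ X.S) : {y : Σ n, X.OrderedSimplex n | carrier y.2 = c}.Finite := by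
  rcases c with v | e | s
  · exact finite_carrier_eq_vertex v
  · by_cases he : e ∈ X.vertical
    · have := hfin e he
      exact finite_carrier_eq_vertical_edge he
    · exact finite_carrier_eq_horizontal_edge he
  · exact finite_carrier_eq_square s

theorem finite_starCorner {e : X.E} (he : e ∈ X.vertical)
    (hfin : {s : X.S | ∃ a, X.side s (!hdir s) a = e}.Finite) : Finite (X.StarCorner e) := by
  have := hfin.to_subtype
  let encode : X.StarCorner e → Bool ⊕ Unit ⊕ ({s : X.S | ∃ a, X.side s (!hdir s) a = e} × Bool)
    | .apex b => .inl b
    | .center => .inr (.inl ())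
    | .square s i t h => .inr (.inr (⟨s, t, eq_not_hdir (h ▸ he) ▸ h⟩, t))
  refine Finite.of_injective encode fun x y hxy => ?_
  cases x <;> cases y <;> simp only [encode, reduceCtorEq, Sum.inl.injEq, Sum.inr.injEq,
    Prod.mk.injEq, Subtype.mk.injEq] at hxy
  case apex.apex => rw [hxy]
  case center.center => rfl
  case square.square s i t h s' i' t' h' =>
    obtain ⟨rfl, rfl⟩ := hxy
    obtain rfl := (eq_not_hdir (h ▸ he)).trans (eq_not_hdir (h' ▸ he)).symm
    rfl

variable {G : Type*} [Group G] {ρ : X.toSquareComplex.Action G} (hρ : PreservesVH ρ)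

theorem carrier_simplexMap (g : G) {n : ℕ} (x : X.OrderedSimplex n) :
    carrier (simplexMap hρ g x) = ρ.cellMap g (carrier x) := by
  cases x <;> rfl

variable (hgeom : ρ.IsGeometric)

include hρ hgeom

theorem finite_setOf_vertical_side_eq (e : X.E) :
    {s : X.S | ∃ a, X.side s (!hdir s) a = e}.Finite := by
  obtain ⟨R, hR, hcover⟩ := hgeom.2.2.2
  have hG : (⋃ r ∈ R, ⋃ a, {g : G | ρ.edgeMap g (X.side r (!hdir r) a) = e}).Finite :=
    hR.biUnion fun r _ => finite_iUnion fun a => hgeom.finite_edgeMap_eq _ _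
  refine ((hG.prod hR).image fun p => ρ.squareMap p.1 p.2).subset ?_
  rintro s ⟨a, ha⟩
  obtain ⟨g, r, hr, rfl⟩ := hcover s
  refine ⟨(g, r), ⟨mem_biUnion hr (mem_iUnion.2 ⟨a ^^ hflip ρ g r, ?_⟩), hr⟩, rfl⟩
  rw [mem_ofPred_eq, edgeMap_vertical_side hρ, Bool.xor_assoc, Bool.xor_self, Bool.xor_false, ha]

theorem isGeometric_simplexificationAction : (simplexificationAction hρ).IsGeometric := by
  constructor
  · intro n (x : X.OrderedSimplex n)
    refine (hgeom.finite_cellMap_eq_self (carrier x)).subset ?_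
    rintro g ⟨θ, hθ⟩
    have hcarrier : carrier (simplexFace θ x) = carrier (simplexMap hρ g x) :=
      congrArg carrier hθ
    rw [carrier_face, carrier_simplexMap] at hcarrier
    exact hcarrier.symm
  · obtain ⟨D, hD, hcover⟩ := hgeom.exists_finite_cells
    have hfin (e : X.E) (he : e ∈ X.vertical) : Finite (X.StarCorner e) :=
      finite_starCorner he (finite_setOf_vertical_side_eq hρ hgeom e)
    refine ⟨⋃ d ∈ D, {y | carrier y.2 = d},
      hD.biUnion fun d _ => finite_carrier_eq hfin d, fun n (x : X.OrderedSimplex n) => ?_⟩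
    obtain ⟨g, d, hd, hgd⟩ := hcover (carrier x)
    refine ⟨g, simplexMap hρ g⁻¹ x, mem_biUnion hd ?_, ?_⟩
    · change carrier (simplexMap hρ g⁻¹ x) = d
      rw [carrier_simplexMap, ← hgd, ρ.cellMap_inv_cellMap]
    · change simplexMap hρ g (simplexMap hρ g⁻¹ x) = x
      rw [← simplexMap_mul, mul_inv_cancel, simplexMap_one]

end VHComplex

theorem corollary2p2 (X : VHComplex.{u}) (hX : X.toSquareComplex.IsCAT0) :
    X.simplexification.IsSystolic ∧
      ∀ (G : Type u) [Group G] (ρ : X.toSquareComplex.Action G),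
        VHComplex.PreservesVH ρ → ρ.IsGeometric → IsSystolicGroup G := by
  have := hX.1
  have hsys : X.simplexification.IsSystolic :=
    ⟨VHComplex.simplyConnectedSpace_simplexification,
      VHComplex.isLocallySixLarge_simplexification hX.2⟩
  exact ⟨hsys, fun G _ ρ hρ hgeom => ⟨X.simplexification, hsys,
    VHComplex.simplexificationAction hρ, VHComplex.isGeometric_simplexificationAction hρ hgeom⟩⟩
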